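/- **Notation.** On $\mathbb R^n$ let $d\gamma=(2\pi)^{-n/2}e^{-|x|^2/2}\,dx$. For a measure $\mu$ let $W^{1,p}(\mathbb R^n,d\mu)$ be the space of functions in $L^p(d\mu)$ whose weak gradient exists and lies in $L^p(d\mu)$, and put $\|g\|_{W^{1,1}(\mathbb R^n,d\mu)}=\int|g|\,d\mu+\int|\nabla g|\,d\mu$. For $f\ge 0$ with $\sqrt f\in W^{1,2}(\mathbb R^n,d\gamma)$ and for $u\in W^{1,2}(\mathbb R^n,e^{-\pi|x|^2}dx)$ with $u\ge 0$ define $$\delta(f)=\frac12\int\frac{|\nabla f|^2}{f}\,d\gamma-\int f\log f\,d\gamma,\qquad \delta_*(u)=\frac1\pi\int|\nabla u|^2e^{-\pi|x|^2}dx-\int |u|^2\log |u|^2\,e^{-\pi|x|^2}dx .$$ For $\alpha\in\mathbb R$ let $\mathcal D_\alpha$ be the set of $f:\mathbb R\to\mathbb R$, $f\ge0$ $\gamma$-a.e., with $\sqrt f\in W^{1,2}(\mathbb R,d\gamma)$, $\int f\,d\gamma=1$, $\int xf\,d\gamma=0$ and $\int x^2f\,d\gamma\le\alpha$. Let $\mathcal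 U_\alpha$ be the set of $u\in W^{1,2}(\mathbb R,e^{-\pi x^2}dx)$, $u\ge0$ a.e., with $\int |u|^2e^{-\pi x^2}dx=1$, $\int x|u|^2e^{-\pi x^2}dx=0$ and $\int x^2|u|^2e^{-\pi x^2}dx\le\alpha$. **Corollary 1.2.** For every $\alpha\in\mathbb R$ there are constants $a_\alpha>0$ and $\overline a_\alpha>0$, depending only on $\alpha$, such that the following holds. (1) For every $f\in\mathcal D_\alpha$, $$\|f-1\|_{W^{1,1}(\mathbb R,d\gamma)}\le a_\alpha\big(\delta(f)^{1/4}+\delta(f)^{3/4}\big),$$ and, with the same constant, for every $n$ and every $f(x_1,\dots,x_n)=\prod_{k=1}^n f_k(x_k)$ with $f_1,\dots,f_n\in\mathcal D_\alpha$, $$\|f-1\|_{W^{1,1}(\mathbb R^n,d\gamma)}\le a_\alpha\, n^{3/4}\big(\delta(f)^{1/4}+\delta(f)^{3/4}\big).$$ (2) For every $u\in\mathcal U_\alpha$, $$\|u-1\|_{W^{1,1}(\mathbb R,e^{-\pi x^2}dx)}\le\overline a_\alpha\big(\delta_*(u)^{1/4}+\delta_*(u)\big),$$ and, with the same constant, for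 every $n$ and every $u(x_1,\dots,x_n)=\prod_{k=1}^n u_k(x_k)$ with $u_1,\dots,u_n\in\mathcal U_\alpha$, $$\|u-1\|_{W^{1,1}(\mathbb R^n,e^{-\pi|x|^2}dx)}\le n\,\overline a_\alpha\big(\delta_*(u)^{1/4}+\delta_*(u)\big).$$ In all cases the function on the left belongs to the stated space $W^{1,1}$, and the deficit on the right is well defined: $\sqrt f$, respectively $u$, lies in the corresponding $W^{1,2}$ space and the integrals in the definition of the deficit converge. -/

import Mathlib

open MeasureTheory
open scoped ENNReal ContDiff

namespace LSI

noncomputable section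

section General

variable {E : Type*} [NormedAddCommGroup E] [InnerProductSpace ℝ E] [MeasureSpace E]

/-- `G` is a weak (distributional) gradient of `f` with respect to Lebesgue measure: both are
locally integrable, and `∫ f ∂_v φ dx = - ∫ φ ⟨G, v⟩ dx` for every smooth compactly supported
`φ` and every direction `v`. -/
def IsWeakGradient (f : E → ℝ) (G : E → E) : Prop :=
  LocallyIntegrable f volume ∧ LocallyIntegrable G volume ∧
    ∀ φ : E → ℝ, ContDiff ℝ ∞ φ → HasCompactSupport φ → ∀ v : E,
      ∫ x, f x * fderiv ℝ φ x v = - ∫ x, φ x * inner ℝ (G x) v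

open Classical in
/-- The weak gradient of `f` (unique up to a Lebesgue null set), and `0` if there is none. -/
def weakGrad (f : E → ℝ) : E → E :=
  if h : ∃ G : E → E, IsWeakGradient f G then h.choose else 0

/-- Membership in the weighted Sobolev space `W^{1,p}(E, dμ)`: `f ∈ L^p(μ)` has a weak gradient,
and the weak gradient lies in `L^p(μ)`. -/
def MemSobolev (p : ℝ≥0∞) (μ : Measure E) (f : E → ℝ) : Prop :=
  MemLp f p μ ∧ (∃ G : E → E, IsWeakGradient f G) ∧ MemLp (weakGrad f) p μ

/-- The `W^{1,1}(E, dμ)` norm `∫ |f| dμ + ∫ |∇f| dμ`, meant for `f` with `MemSobolev 1 μ f`. -/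
def sobolevNorm (μ : Measure E) (f : E → ℝ) : ℝ :=
  (∫ x, |f x| ∂μ) + ∫ x, ‖weakGrad f x‖ ∂μ

/-- The standard Gaussian measure `dγ = (2π)^{-n/2} e^{-|x|²/2} dx`, with `n = dim E`. -/
def gammaMeasure (E : Type*) [NormedAddCommGroup E] [InnerProductSpace ℝ E] [MeasureSpace E] :
    Measure E :=
  volume.withDensity fun x =>
    ENNReal.ofReal ((2 * Real.pi) ^ (-(Module.finrank ℝ E : ℝ) / 2) * Real.exp (-‖x‖ ^ 2 / 2))

/-- The Gaussian measure `e^{-π|x|²} dx`. -/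
def piMeasure (E : Type*) [NormedAddCommGroup E] [InnerProductSpace ℝ E] [MeasureSpace E] :
    Measure E :=
  volume.withDensity fun x => ENNReal.ofReal (Real.exp (-Real.pi * ‖x‖ ^ 2))

/-- The log-Sobolev deficit `δ(f) = (1/2) ∫ |∇f|²/f dγ - ∫ f log f dγ` of a density `f`.
The first integrand is `0` wherever `f = 0`. -/
def deficit (f : E → ℝ) : ℝ :=
  (1 / 2) * (∫ x, ‖weakGrad f x‖ ^ 2 / f x ∂gammaMeasure E)
    - ∫ x, f x * Real.log (f x) ∂gammaMeasure E

/-- The requirements under which `deficit f` is meaningful: `√f ∈ W^{1,2}(dγ)`, and both integrals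
in its definition converge. -/
structure DeficitWellDefined (f : E → ℝ) : Prop where
  sqrt_mem : MemSobolev 2 (gammaMeasure E) fun x => Real.sqrt (f x)
  fisher : Integrable (fun x => ‖weakGrad f x‖ ^ 2 / f x) (gammaMeasure E)
  entropy : Integrable (fun x => f x * Real.log (f x)) (gammaMeasure E)

/-- The deficit `δ_*(u)`, given by
`π δ_*(u) = ∫ |∇u|² e^{-π|x|²} dx - π ∫ |u|² log |u|² e^{-π|x|²} dx`. -/
def deficitStar (u : E → ℝ) : ℝ :=
  (1 / Real.pi) * ((∫ x, ‖weakGrad u x‖ ^ 2 ∂piMeasure E)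
    - Real.pi * ∫ x, |u x| ^ 2 * Real.log (|u x| ^ 2) ∂piMeasure E)

/-- The requirements under which `deficitStar u` is meaningful: `u ∈ W^{1,2}(e^{-π|x|²} dx)` (so
that the Dirichlet integral converges), and the entropy integral converges. -/
structure DeficitStarWellDefined (u : E → ℝ) : Prop where
  mem : MemSobolev 2 (piMeasure E) u
  entropy : Integrable (fun x => |u x| ^ 2 * Real.log (|u x| ^ 2)) (piMeasure E)

end General

/-- One-dimensional probability densities `f` with respect to `γ`, normalized and centered, with
second moment at most `α`, in the domain `√f ∈ W^{1,2}(ℝ, dγ)` of the deficit. -/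
structure IsDensity (α : ℝ) (f : ℝ → ℝ) : Prop where
  nonneg : ∀ᵐ x ∂gammaMeasure ℝ, 0 ≤ f x
  integrable : Integrable f (gammaMeasure ℝ)
  normalized : ∫ x, f x ∂gammaMeasure ℝ = 1
  centered : ∫ x, x * f x ∂gammaMeasure ℝ = 0
  moment_integrable : Integrable (fun x => |x| ^ 2 * f x) (gammaMeasure ℝ)
  moment_le : ∫ x, |x| ^ 2 * f x ∂gammaMeasure ℝ ≤ α
  sqrt_mem : MemSobolev 2 (gammaMeasure ℝ) fun x => Real.sqrt (f x)

/-- One-dimensional non-negative functions `u`, normalized and centered in `L²(ℝ, e^{-π|x|²} dx)`,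
with second moment at most `α`, in the domain `W^{1,2}(ℝ, e^{-π|x|²} dx)` of `δ_*`. -/
structure IsAmplitude (α : ℝ) (u : ℝ → ℝ) : Prop where
  nonneg : ∀ᵐ x ∂piMeasure ℝ, 0 ≤ u x
  normalized : ∫ x, |u x| ^ 2 ∂piMeasure ℝ = 1
  centered : ∫ x, x * |u x| ^ 2 ∂piMeasure ℝ = 0
  moment_integrable : Integrable (fun x => |x| ^ 2 * |u x| ^ 2) (piMeasure ℝ)
  moment_le : ∫ x, |x| ^ 2 * |u x| ^ 2 ∂piMeasure ℝ ≤ α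
  mem : MemSobolev 2 (piMeasure ℝ) u

/-- The product function `(x₁, …, xₙ) ↦ ∏ₖ fₖ(xₖ)` on `ℝⁿ`. -/
def tensor {n : ℕ} (f : Fin n → ℝ → ℝ) : EuclideanSpace ℝ (Fin n) → ℝ :=
  fun x => ∏ k, f k (x k)

end

end LSI

/-! In one dimension, write `f = v ^ 2` with `v ≥ 0` the locally absolutely continuous
representative of `√f` and `w = v'`. Let `p = v ^ 2 φ` be the Lebesgue density of `f dγ`, `q = p'`,
and `T` the monotone map transporting `p` to the standard Gaussian, so that `T' = p / φ(T)`. The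
inequality `log T' ≤ T' - 1`, integrated against `p` and followed by an integration by parts, bounds
the entropy of `p` by `-∫ q T` and constants (`IsContDensity.integral_mul_log_le`). Completing the
square turns this into the log-Sobolev inequality with remainder `∫ |2w + (T - x) v|² dγ ≤ 2δ`
(`IsProfile.integral_error_sq_le`).

The remainder says that `q + T p = E √p` with `‖E‖₂ ≤ h` whenever `2δ ≤ h²`. Since the integral of
`T p` over `(-∞, x]` is `-φ(T x)`, integrating gives `p - φ(T)`. Cauchy–Schwarz on a tail then
yields `|p - φ(T)| ≤ h exp(-T²/4)`, that is, `|T' - 1| ≤ √(2π) h exp(T²/4)`. The growth `exp(T²/4)`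
is still integrable against the Gaussian, so `T` is close in `L¹(p)` to a translation on the region
where this bound is at most `1/2`. The complement has mass `O(h²)` and costs `O(h)` by the second
moment bound, and centering forces the translation to be `O(h)`. Hence `∫ |T - x| p = O(h)`
(`IsNearGaussian.integral_abs_transport_sub_le`).

Now `f' φ = q + x p = (q + T p) - (T - x) p`, so `‖f'‖₁ = O(√δ)` for small `δ`, and an `L¹` Poincaré
inequality bounds `‖f - 1‖₁` likewise. For `v` itself, `|w| ≤ |f'|` where `v ≥ 1/2`. The set where
`v < 1/2` has Gaussian mass `O(√δ)`, and Cauchy–Schwarz against the bounded `‖w‖₂` produces the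
exponent `1/4` (`IsProfile.integral_abs_le_add`). For large `δ`, the bound `‖w‖₂² ≤ δ + 1 + m`, with
`m` the second moment, suffices. Both regimes are combined in `exists_profile_bound`. The statement
for `u` is the one for `v` after scaling by `√(2π)`.

For products, the deficit is additive, and telescoping bounds the `W^{1,1}` distance to `1` by the
sum over the factors (`memSobolev_sobolevNorm_tensor_sub_one`). A power mean inequality
(`sum_rpow_le`) gives `n ^ (3/4)` in the first part. In the second, each deficit is bounded by the
total, which gives the factor `n`. -/

namespace LSI

open Set Filter
open scoped Topology

/-! ### Locally absolutely continuous functions on the line -/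

/-- `v` is locally absolutely continuous with almost everywhere derivative `w`. -/
structure IsPrimitive (v w : ℝ → ℝ) : Prop where
  locallyIntegrable : LocallyIntegrable w volume
  integral_eq : ∀ a b, ∫ x in a..b, w x = v b - v a

theorem _root_.MeasureTheory.LocallyIntegrable.intervalIntegrable' {w : ℝ → ℝ}
    (hw : LocallyIntegrable w volume) (a b : ℝ) : IntervalIntegrable w volume a b :=
  intervalIntegrable_iff.mpr
    ((hw.integrableOn_isCompact isCompact_uIcc).mono_set uIoc_subset_uIcc)

theorem fderiv_real_apply (φ : ℝ → ℝ) (x c : ℝ) : fderiv ℝ φ x c = c * deriv φ x := by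
  rw [← fderiv_apply_one_eq_deriv, ← smul_eq_mul, ← map_smul]; simp

namespace IsPrimitive

variable {v w v₁ w₁ v₂ w₂ : ℝ → ℝ}

theorem intervalIntegrable (h : IsPrimitive v w) (a b : ℝ) : IntervalIntegrable w volume a b :=
  h.locallyIntegrable.intervalIntegrable' a b

theorem eq_add (h : IsPrimitive v w) (a x : ℝ) : v x = v a + ∫ t in a..x, w t := by
  rw [h.integral_eq]; ring

theorem funext_eq (h : IsPrimitive v w) (a : ℝ) : v = fun x => v a + ∫ t in a..x, w t :=
  funext fun x => h.eq_add a x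

theorem continuous (h : IsPrimitive v w) : Continuous v := by
  rw [h.funext_eq 0]
  exact continuous_const.add (intervalIntegral.continuous_primitive (fun a b => h.intervalIntegrable a b) 0)

theorem absolutelyContinuous (h : IsPrimitive v w) (a b : ℝ) :
    AbsolutelyContinuousOnInterval v a b := by
  have h1 := (h.intervalIntegrable a b).absolutelyContinuousOnInterval_intervalIntegral
    (c := a) left_mem_uIcc
  have h2 : AbsolutelyContinuousOnInterval (fun _ : ℝ => v a) a b :=
    (contDiffOn_const (n := 1)).absolutelyContinuousOnInterval
  rw [h.funext_eq a]
  exact h2.add h1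

theorem ae_hasDerivAt (h : IsPrimitive v w) : ∀ᵐ x, HasDerivAt v (w x) x := by
  filter_upwards [LocallyIntegrable.ae_hasDerivAt_integral h.locallyIntegrable] with x hx
  rw [h.funext_eq 0]
  exact (hx 0).const_add _

theorem mul (h₁ : IsPrimitive v₁ w₁) (h₂ : IsPrimitive v₂ w₂) :
    IsPrimitive (fun x => v₁ x * v₂ x) (fun x => w₁ x * v₂ x + v₁ x * w₂ x) where
  locallyIntegrable := by
    rw [← locallyIntegrableOn_univ]
    refine LocallyIntegrableOn.add ?_ ?_
    · exact (locallyIntegrableOn_univ.mpr h₁.locallyIntegrable).mul_continuousOn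
        h₂.continuous.continuousOn isOpen_univ.isLocallyClosed
    · exact (locallyIntegrableOn_univ.mpr h₂.locallyIntegrable).continuousOn_mul
        h₁.continuous.continuousOn isOpen_univ.isLocallyClosed
  integral_eq a b := by
    rw [← (h₁.absolutelyContinuous a b).integral_deriv_mul_eq_sub (h₂.absolutelyContinuous a b)]
    refine intervalIntegral.integral_congr_ae ?_
    filter_upwards [h₁.ae_hasDerivAt, h₂.ae_hasDerivAt] with x hx1 hx2 _
    rw [hx1.deriv, hx2.deriv]

theorem of_hasDerivAt (h : ∀ x, HasDerivAt v (w x) x) (hw : Continuous w) : IsPrimitive v w where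
  locallyIntegrable := hw.locallyIntegrable
  integral_eq _ _ := intervalIntegral.integral_eq_sub_of_hasDerivAt (fun x _ => h x)
    (hw.intervalIntegrable _ _)

theorem comp_div (h : IsPrimitive v w) {s : ℝ} (hs : 0 < s) :
    IsPrimitive (fun x => v (x / s)) (fun x => w (x / s) / s) where
  locallyIntegrable := by
    rw [locallyIntegrable_iff]
    intro k hk
    obtain ⟨R, hR⟩ := hk.isBounded.subset_closedBall 0
    have h1 : IntervalIntegrable (fun x => w (x / s) / s) volume (-|R|) |R| := by
      have := (h.intervalIntegrable (-|R| / s) (|R| / s)).comp_mul_right (c := s⁻¹)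
      simp only [div_eq_mul_inv, inv_inv, mul_assoc, inv_mul_cancel₀ hs.ne', mul_one] at this
      exact this.mul_const _
    rw [intervalIntegrable_iff_integrableOn_Icc_of_le (by linarith [abs_nonneg R])] at h1
    refine h1.mono_set fun x hx => ?_
    have := hR hx
    rw [Metric.mem_closedBall, dist_zero_right, Real.norm_eq_abs] at this
    exact abs_le.1 (this.trans (le_abs_self R))
  integral_eq a b := by
    rw [intervalIntegral.integral_div, intervalIntegral.integral_comp_div _ hs.ne', h.integral_eq]
    simp [hs.ne']

/-- The derivative of a nonnegative locally absolutely continuous function vanishes almost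
everywhere on its zero set. -/
theorem ae_eq_zero (h : IsPrimitive v w) (hv : ∀ x, 0 ≤ v x) : ∀ᵐ x, v x = 0 → w x = 0 := by
  filter_upwards [h.ae_hasDerivAt] with x hx h0
  exact IsLocalMin.hasDerivAt_eq_zero (f := v) (Filter.Eventually.of_forall fun y => by
    rw [h0]; exact hv y) hx

theorem isWeakGradient (h : IsPrimitive v w) : IsWeakGradient v w := by
  refine ⟨h.continuous.locallyIntegrable, h.locallyIntegrable, fun φ hφ hc c => ?_⟩
  have hφ1 : IsPrimitive φ (deriv φ) := of_hasDerivAt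
    (fun x => (hφ.differentiable (by simp) x).hasDerivAt) (hφ.continuous_deriv (by simp))
  obtain ⟨R, hR⟩ := hc.isCompact.isBounded.subset_closedBall 0
  -- The margin `1` puts both endpoints outside the support, so integration by parts has no boundary
  -- terms. The right endpoint lies in the `Ioc` and is treated separately below.
  have hsupp : ∀ x, x ∉ Ioc (-(|R| + 1)) (|R| + 1) → φ x = 0 ∧ deriv φ x = 0 := by
    intro x hx
    have hx' : x ∉ tsupport φ := fun hm => hx (by
      have := hR hm
      rw [Metric.mem_closedBall, dist_zero_right, Real.norm_eq_abs] at this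
      have h1 := le_abs_self R
      have h2 := abs_le.1 (this.trans h1)
      exact ⟨by linarith [h2.1], by linarith [h2.2]⟩)
    exact ⟨image_eq_zero_of_notMem_tsupport hx',
      image_eq_zero_of_notMem_tsupport fun hm => hx' (tsupport_deriv_subset hm)⟩
  have key := (h.mul hφ1).integral_eq (-(|R| + 1)) (|R| + 1)
  have e1 : φ (|R| + 1) = 0 := by
    have hR2 : |R| + 1 ∉ tsupport φ := fun hm => by
      have := hR hm
      rw [Metric.mem_closedBall, dist_zero_right, Real.norm_eq_abs] at this
      have h1 := le_abs_self R
      have h3 := le_abs_self (|R| + 1)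
      linarith
    exact image_eq_zero_of_notMem_tsupport hR2
  have e2 : φ (-(|R| + 1)) = 0 := (hsupp _ (by simp)).1
  rw [e1, e2, intervalIntegral.integral_of_le (by have := abs_nonneg R; linarith),
    setIntegral_eq_integral_of_forall_compl_eq_zero
      (fun x hx => by simp [(hsupp x hx).1, (hsupp x hx).2]), integral_add] at key
  · have e3 : ∀ x, v x * fderiv ℝ φ x c = c * (v x * deriv φ x) := fun x => by
      rw [fderiv_real_apply]; ring
    have e4 : ∀ x, φ x * inner ℝ (w x) c = c * (w x * φ x) := fun x => by
      simp [inner]; ring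
    simp_rw [e3, e4, integral_const_mul]
    have : (∫ x, v x * deriv φ x) = - ∫ x, w x * φ x := by linarith
    rw [this]; ring
  · simpa [mul_comm] using
      h.locallyIntegrable.integrable_smul_left_of_hasCompactSupport hφ.continuous hc
  · exact (h.continuous.mul (hφ.continuous_deriv (by simp))).integrable_of_hasCompactSupport
      (hc.deriv.mul_left)

end IsPrimitive

/-! ### Weak derivatives on the line -/

/-- **du Bois-Reymond.** A locally integrable function orthogonal to all derivatives of test
functions is almost everywhere constant. -/
theorem ae_eq_const_of_integral_mul_deriv_eq_zero {g : ℝ → ℝ} (hg : LocallyIntegrable g volume)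
    (h : ∀ φ : ℝ → ℝ, ContDiff ℝ ∞ φ → HasCompactSupport φ → ∫ x, g x * deriv φ x = 0) :
    ∃ c, ∀ᵐ x, g x = c := by
  let η₀ : ContDiffBump (0 : ℝ) := ⟨1, 2, by norm_num, by norm_num⟩
  let η : ℝ → ℝ := η₀.normed volume
  have hη : ContDiff ℝ ∞ η := η₀.contDiff_normed
  have hηc : HasCompactSupport η := η₀.hasCompactSupport_normed
  have hη1 : ∫ x, η x = 1 := η₀.integral_normed
  refine ⟨∫ x, g x * η x, ae_eq_of_integral_contDiff_smul_eq hg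
    (locallyIntegrable_const _) fun φ hφ hc => ?_⟩
  set m := ∫ x, φ x with hm
  have hφi : Integrable φ := hφ.continuous.integrable_of_hasCompactSupport hc
  have hηi : Integrable η := hη.continuous.integrable_of_hasCompactSupport hηc
  let θ : ℝ → ℝ := fun x => φ x - m * η x
  -- Subtracting `m` times a bump of integral one makes the total integral zero. The primitive `Θ`
  -- therefore vanishes on both sides of the support and is an admissible test function; the
  -- constant is `∫ g η`.
  have hθ : ContDiff ℝ ∞ θ := hφ.sub (contDiff_const.mul hη)
  have hθc : HasCompactSupport θ := hc.sub (hηc.mul_left)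
  have hθi : Integrable θ := hφi.sub (hηi.const_mul m)
  have hθ0 : ∫ x, θ x = 0 := by
    simp only [θ]
    rw [integral_sub hφi (hηi.const_mul m), integral_const_mul, hη1, ← hm]; ring
  let Θ : ℝ → ℝ := fun x => ∫ t in Iic x, θ t
  have hΘ : ∀ x, Θ x = Θ 0 + ∫ t in (0 : ℝ)..x, θ t := fun x => by
    rw [← intervalIntegral.integral_Iic_sub_Iic hθi.integrableOn hθi.integrableOn]; simp [Θ]
  have hΘd : ∀ x, HasDerivAt Θ (θ x) x := fun x => by
    rw [funext hΘ]
    exact (intervalIntegral.integral_hasDerivAt_right (hθ.continuous.intervalIntegrable _ _)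
      hθ.continuous.stronglyMeasurable.stronglyMeasurableAtFilter
      hθ.continuous.continuousAt).const_add _
  have hΘderiv : deriv Θ = θ := funext fun x => (hΘd x).deriv
  have hΘs : ContDiff ℝ ∞ Θ := by
    rw [contDiff_infty_iff_deriv]
    exact ⟨fun x => (hΘd x).differentiableAt, hΘderiv ▸ hθ⟩
  obtain ⟨R, hR⟩ := hθc.isCompact.isBounded.subset_closedBall 0
  have hz : ∀ x, R < |x| → θ x = 0 := fun x hx => image_eq_zero_of_notMem_tsupport fun hmem => by
    have := hR hmem
    rw [Metric.mem_closedBall, dist_zero_right, Real.norm_eq_abs] at this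
    linarith
  have hΘc : HasCompactSupport Θ := by
    refine HasCompactSupport.intro (isCompact_Icc (a := -|R|) (b := |R|)) fun x hx => ?_
    have hRR := le_abs_self R
    rw [mem_Icc, not_and_or, not_le, not_le] at hx
    rcases hx with hx | hx
    · refine setIntegral_eq_zero_of_forall_eq_zero fun t ht => hz t ?_
      rw [lt_abs]; right; have : t ≤ x := ht; linarith
    · have h1 : ∫ t in Ioi x, θ t = 0 := setIntegral_eq_zero_of_forall_eq_zero fun t ht => hz t (by
        rw [lt_abs]; left; have : x < t := ht; linarith)
      have h2 := intervalIntegral.integral_Iic_add_Ioi (b := x) hθi.integrableOn hθi.integrableOn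
      simp only [Θ]; linarith
  have hmain := h Θ hΘs hΘc
  rw [hΘderiv] at hmain
  have i1 : Integrable fun x => g x * φ x := by
    simpa [mul_comm] using hg.integrable_smul_left_of_hasCompactSupport hφ.continuous hc
  have i2 : Integrable fun x => g x * η x := by
    simpa [mul_comm] using hg.integrable_smul_left_of_hasCompactSupport hη.continuous hηc
  have e : ∀ x, g x * θ x = g x * φ x - m * (g x * η x) := fun x => by simp only [θ]; ring
  simp_rw [e] at hmain
  rw [integral_sub i1 (i2.const_mul m), integral_const_mul] at hmain
  simp only [smul_eq_mul, integral_mul_const]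
  rw [← hm]
  have : (∫ x, φ x * g x) = ∫ x, g x * φ x := by simp_rw [mul_comm]
  linarith

/-- On the line, a function with a weak gradient has a locally absolutely continuous
representative. -/
theorem IsWeakGradient.exists_isPrimitive {u G : ℝ → ℝ} (h : IsWeakGradient u G) :
    ∃ v, IsPrimitive v G ∧ u =ᵐ[volume] v := by
  have hV : IsPrimitive (fun x => ∫ t in (0 : ℝ)..x, G t) G := ⟨h.2.1, fun a b => by
    rw [intervalIntegral.integral_interval_sub_left] <;> exact h.2.1.intervalIntegrable' _ _⟩
  -- The primitive of `G` also has weak derivative `G`, so its difference with `u` is orthogonal to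
  -- derivatives of test functions.
  obtain ⟨c, hc⟩ := ae_eq_const_of_integral_mul_deriv_eq_zero
    (g := fun x => u x - ∫ t in (0 : ℝ)..x, G t) (h.1.sub hV.continuous.locallyIntegrable) (by
      intro φ hφ hφc
      have h1 := h.2.2 φ hφ hφc 1
      have h2 := hV.isWeakGradient.2.2 φ hφ hφc 1
      simp only [fderiv_real_apply, one_mul] at h1 h2
      have hd : Continuous (deriv φ) := hφ.continuous_deriv (by simp)
      simp_rw [sub_mul]
      rw [integral_sub, h1, h2, sub_self]
      · simpa [mul_comm] using h.1.integrable_smul_left_of_hasCompactSupport hd hφc.deriv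
      · simpa [mul_comm] using
          hV.continuous.locallyIntegrable.integrable_smul_left_of_hasCompactSupport hd hφc.deriv)
  refine ⟨fun x => c + ∫ t in (0 : ℝ)..x, G t, ⟨h.2.1, fun a b => ?_⟩, ?_⟩
  · rw [hV.integral_eq]; ring
  · filter_upwards [hc] with x hx
    linarith

/-- Cauchy–Schwarz. -/
theorem integral_abs_mul_le {X : Type*} [MeasurableSpace X] {μ : Measure X} {f g : X → ℝ}
    (hf : MemLp f 2 μ) (hg : MemLp g 2 μ) :
    ∫ x, |f x * g x| ∂μ ≤ √(∫ x, f x ^ 2 ∂μ) * √(∫ x, g x ^ 2 ∂μ) := by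
  have := integral_mul_le_Lp_mul_Lq_of_nonneg (μ := μ) (f := fun x => |f x|) (g := fun x => |g x|)
    Real.HolderConjugate.two_two (Eventually.of_forall fun x => abs_nonneg _)
    (Eventually.of_forall fun x => abs_nonneg _) (by simpa using hf.norm)
    (by simpa using hg.norm)
  simpa [abs_mul, Real.sqrt_eq_rpow] using this

/-! ### Densities and their distribution functions -/

/-- The measure on the line with density `p`. -/
noncomputable def densityMeasure (p : ℝ → ℝ) : Measure ℝ :=
  volume.withDensity fun x => ENNReal.ofReal (p x)

/-- The distribution function of the density `p`. -/
noncomputable def cumul (p : ℝ → ℝ) (x : ℝ) : ℝ := ∫ t in Iic x, p t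

section Density

variable {p : ℝ → ℝ}

theorem integral_densityMeasure (hp : Measurable p) (h0 : ∀ x, 0 ≤ p x) (g : ℝ → ℝ) :
    ∫ x, g x ∂densityMeasure p = ∫ x, g x * p x := by
  rw [densityMeasure, integral_withDensity_eq_integral_toReal_smul hp.ennreal_ofReal (by simp)]
  simp [ENNReal.toReal_ofReal (h0 _), mul_comm]

theorem integrable_densityMeasure (hp : Measurable p) (h0 : ∀ x, 0 ≤ p x) {g : ℝ → ℝ} :
    Integrable g (densityMeasure p) ↔ Integrable fun x => g x * p x := by
  rw [densityMeasure, integrable_withDensity_iff_integrable_smul' hp.ennreal_ofReal (by simp)]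
  simp [ENNReal.toReal_ofReal (h0 _), mul_comm]

theorem setIntegral_densityMeasure (hp : Measurable p) (h0 : ∀ x, 0 ≤ p x) (g : ℝ → ℝ) {s : Set ℝ}
    (hs : MeasurableSet s) :
    ∫ x in s, g x ∂densityMeasure p = ∫ x in s, g x * p x := by
  rw [← integral_indicator hs, integral_densityMeasure hp h0, ← integral_indicator hs]
  congr 1 with x
  by_cases hx : x ∈ s <;> simp [hx]

theorem cumul_sub (hi : Integrable p) (a b : ℝ) : cumul p b - cumul p a = ∫ t in a..b, p t :=
  intervalIntegral.integral_Iic_sub_Iic hi.integrableOn hi.integrableOn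

theorem hasDerivAt_cumul (hc : Continuous p) (hi : Integrable p) (x : ℝ) :
    HasDerivAt (cumul p) (p x) x := by
  have : cumul p = fun x => cumul p 0 + ∫ t in (0 : ℝ)..x, p t :=
    funext fun x => by rw [← cumul_sub hi]; ring
  rw [this]
  exact (intervalIntegral.integral_hasDerivAt_right (hc.intervalIntegrable _ _)
    hc.stronglyMeasurable.stronglyMeasurableAtFilter hc.continuousAt).const_add _

theorem continuous_cumul (hc : Continuous p) (hi : Integrable p) : Continuous (cumul p) :=
  continuous_iff_continuousAt.2 fun x => (hasDerivAt_cumul hc hi x).continuousAt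

theorem monotone_cumul (h0 : ∀ x, 0 ≤ p x) (hi : Integrable p) : Monotone (cumul p) :=
  fun _ _ hab => setIntegral_mono_set hi.integrableOn (Eventually.of_forall h0)
    (Iic_subset_Iic.2 hab).eventuallyLE

theorem cumul_nonneg (h0 : ∀ x, 0 ≤ p x) (x : ℝ) : 0 ≤ cumul p x := integral_nonneg h0

theorem cumul_le (h0 : ∀ x, 0 ≤ p x) (hi : Integrable p) (x : ℝ) : cumul p x ≤ ∫ t, p t :=
  setIntegral_le_integral hi (Eventually.of_forall h0)

theorem cumul_add_integral_Ioi (hi : Integrable p) (x : ℝ) :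
    cumul p x + ∫ t in Ioi x, p t = ∫ t, p t :=
  intervalIntegral.integral_Iic_add_Ioi hi.integrableOn hi.integrableOn

theorem tendsto_cumul_atTop (hi : Integrable p) : Tendsto (cumul p) atTop (𝓝 (∫ t, p t)) :=
  (aecover_Iic tendsto_id).integral_tendsto_of_countably_generated hi

theorem tendsto_cumul_atBot : Tendsto (cumul p) atBot (𝓝 0) :=
  tendsto_integral_Iic_zero tendsto_id

theorem densityMeasure_Iic (h0 : ∀ x, 0 ≤ p x) (hi : Integrable p) (x : ℝ) :
    densityMeasure p (Iic x) = ENNReal.ofReal (cumul p x) := by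
  rw [densityMeasure, withDensity_apply _ measurableSet_Iic, cumul,
    ofReal_integral_eq_lintegral_ofReal hi.integrableOn (Eventually.of_forall h0)]

theorem densityMeasure_univ (h0 : ∀ x, 0 ≤ p x) (hi : Integrable p) :
    densityMeasure p univ = ENNReal.ofReal (∫ x, p x) := by
  rw [densityMeasure, withDensity_apply _ MeasurableSet.univ, Measure.restrict_univ,
    ofReal_integral_eq_lintegral_ofReal hi (Eventually.of_forall h0)]

end Density

/-! ### The standard Gaussian density -/

/-- The standard Gaussian density on the line. -/
noncomputable def phi (x : ℝ) : ℝ := (√(2 * Real.pi))⁻¹ * Real.exp (-x ^ 2 / 2)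

theorem sqrt_two_pi_pos : 0 < √(2 * Real.pi) := Real.sqrt_pos.2 (by positivity)

theorem phi_pos (x : ℝ) : 0 < phi x := mul_pos (inv_pos.2 sqrt_two_pi_pos) (Real.exp_pos _)

theorem phi_nonneg (x : ℝ) : 0 ≤ phi x := (phi_pos x).le

theorem phi_neg (x : ℝ) : phi (-x) = phi x := by simp [phi]

theorem hasDerivAt_phi (x : ℝ) : HasDerivAt phi (-x * phi x) x := by
  have h1 : HasDerivAt (fun x : ℝ => -x ^ 2 / 2) (-x) x := by
    have := ((hasDerivAt_pow 2 x).neg).div_const 2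
    convert! this using 1
    simp; ring
  have := h1.exp.const_mul (√(2 * Real.pi))⁻¹
  convert! this using 1
  simp only [phi]; ring

theorem continuous_phi : Continuous phi := by unfold phi; fun_prop

theorem isPrimitive_phi : IsPrimitive phi (fun x => -x * phi x) :=
  IsPrimitive.of_hasDerivAt hasDerivAt_phi (continuous_neg.mul continuous_phi)

theorem log_phi (x : ℝ) : Real.log (phi x) = -Real.log (2 * Real.pi) / 2 - x ^ 2 / 2 := by
  rw [phi, Real.log_mul (inv_pos.2 sqrt_two_pi_pos).ne' (Real.exp_pos _).ne', Real.log_inv,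
    Real.log_exp, Real.log_sqrt (by positivity)]
  ring

theorem phi_eq (x : ℝ) : phi x = (√(2 * Real.pi))⁻¹ * Real.exp (-(1 / 2) * x ^ 2) := by
  rw [phi]; congr 2; ring

theorem integrable_phi : Integrable phi := by
  rw [funext phi_eq]
  exact (integrable_exp_neg_mul_sq (by norm_num)).const_mul _

theorem integral_phi : ∫ x, phi x = 1 := by
  simp_rw [phi_eq]
  rw [integral_const_mul, integral_gaussian, div_div_eq_mul_div, div_one, mul_comm Real.pi,
    inv_mul_cancel₀ sqrt_two_pi_pos.ne']

theorem integrable_mul_phi : Integrable fun x => x * phi x := by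
  have : (fun x => x * phi x)
      = fun x => (√(2 * Real.pi))⁻¹ * (x * Real.exp (-(1 / 2) * x ^ 2)) := by
    ext x; rw [phi_eq]; ring
  rw [this]
  exact (integrable_mul_exp_neg_mul_sq (by norm_num)).const_mul _

theorem integrable_sq_mul_phi : Integrable fun x => x ^ 2 * phi x := by
  have : (fun x => x ^ 2 * phi x)
      = fun x : ℝ => (√(2 * Real.pi))⁻¹ * (x ^ (2 : ℝ) * Real.exp (-(1 / 2) * x ^ 2)) := by
    ext x; rw [phi_eq, Real.rpow_two]; ring
  rw [this]
  exact (integrable_rpow_mul_exp_neg_mul_sq (by norm_num) (by norm_num)).const_mul _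

/-- Integrability of `w` makes `v` converge at both ends, and integrability of `v` forces the limits
to be zero. This replaces every discussion of boundary terms over the whole line. -/
theorem tendsto_of_isPrimitive_of_integrable {v w : ℝ → ℝ} (h : IsPrimitive v w)
    (hv : Integrable v) (hw : Integrable w) :
    Tendsto v atBot (𝓝 0) ∧ Tendsto v atTop (𝓝 0) ∧
      (∀ x, v x = cumul w x) ∧ ∫ x, w x = 0 := by
  have e : ∀ x, v x = (v 0 - cumul w 0) + cumul w x := fun x => by
    have := h.integral_eq 0 x
    rw [← cumul_sub hw] at this; linarith
  have hb : Tendsto v atBot (𝓝 (v 0 - cumul w 0)) := by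
    rw [funext e]
    simpa using tendsto_cumul_atBot.const_add (v 0 - cumul w 0)
  have ht : Tendsto v atTop (𝓝 (v 0 - cumul w 0 + ∫ x, w x)) := by
    rw [funext e]
    simpa using (tendsto_cumul_atTop hw).const_add (v 0 - cumul w 0)
  have hb0 := IntegrableAtFilter.eq_zero_of_tendsto (hv.integrableAtFilter atBot)
    (fun s hs => by
      obtain ⟨a, ha⟩ := mem_atBot_sets.1 hs
      exact measure_mono_top (fun x hx => ha x hx) (Real.volume_Iic (a := a))) hb
  have ht0 := IntegrableAtFilter.eq_zero_of_tendsto (hv.integrableAtFilter atTop)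
    (fun s hs => by
      obtain ⟨a, ha⟩ := mem_atTop_sets.1 hs
      exact measure_mono_top (fun x hx => ha x hx) (Real.volume_Ici (a := a))) ht
  rw [hb0] at hb; rw [ht0] at ht
  exact ⟨hb, ht, fun x => by rw [e x, hb0, zero_add], by linarith⟩

theorem integral_Iic_mul_phi (y : ℝ) : ∫ t in Iic y, t * phi t = -phi y := by
  have := (tendsto_of_isPrimitive_of_integrable isPrimitive_phi integrable_phi
    (by simpa using integrable_mul_phi.neg)).2.2.1 y
  rw [this, cumul, ← integral_neg]
  congr 1 with x; ring

theorem integral_mul_phi : ∫ t, t * phi t = 0 := by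
  have := (tendsto_of_isPrimitive_of_integrable isPrimitive_phi integrable_phi
    (by simpa using integrable_mul_phi.neg)).2.2.2
  simpa [integral_neg] using this

/-- The Gaussian second moment. -/
theorem integral_sq_mul_phi : ∫ t, t ^ 2 * phi t = 1 := by
  have h1 : IsPrimitive (fun x => x * phi x) (fun x => 1 * phi x + x * (-x * phi x)) :=
    (IsPrimitive.of_hasDerivAt (v := fun x => x) (w := fun _ => 1) hasDerivAt_id'
      continuous_const).mul isPrimitive_phi
  have e : (fun x => 1 * phi x + x * (-x * phi x)) = fun x => phi x - x ^ 2 * phi x := by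
    ext x; ring
  rw [e] at h1
  have := (tendsto_of_isPrimitive_of_integrable h1 integrable_mul_phi
    (integrable_phi.sub integrable_sq_mul_phi)).2.2.2
  rw [integral_sub integrable_phi integrable_sq_mul_phi, integral_phi] at this
  linarith

/-- For `s ≥ t ≥ 0` one has `s² ≥ t² + (s - t)²`, so the tail is dominated by a translated Gaussian
times `exp(-t²/2)`. -/
theorem integral_Ioi_phi_le {t : ℝ} (ht : 0 ≤ t) : ∫ s in Ioi t, phi s ≤ Real.exp (-t ^ 2 / 2) := by
  have hi : Integrable fun s => Real.exp (-t ^ 2 / 2) * phi (s - t) :=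
    (integrable_phi.comp_sub_right t).const_mul _
  calc ∫ s in Ioi t, phi s ≤ ∫ s in Ioi t, Real.exp (-t ^ 2 / 2) * phi (s - t) := by
        refine setIntegral_mono_on integrable_phi.integrableOn hi.integrableOn measurableSet_Ioi ?_
        intro s hs
        have hs' : t < s := hs
        rw [phi, phi, mul_left_comm, ← Real.exp_add]
        refine mul_le_mul_of_nonneg_left (Real.exp_le_exp.2 ?_) (inv_pos.2 sqrt_two_pi_pos).le
        nlinarith [mul_nonneg ht (sub_nonneg.2 hs'.le)]
    _ ≤ ∫ s, Real.exp (-t ^ 2 / 2) * phi (s - t) :=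
        setIntegral_le_integral hi (Eventually.of_forall fun s =>
          mul_nonneg (Real.exp_pos _).le (phi_nonneg _))
    _ = Real.exp (-t ^ 2 / 2) := by
        rw [integral_const_mul, integral_sub_right_eq_self, integral_phi, mul_one]

theorem cumul_phi_neg (t : ℝ) : cumul phi (-t) = ∫ s in Ioi t, phi s := by
  rw [cumul, ← integral_comp_neg_Ioi]
  simp [phi_neg]

theorem cumul_phi_le {t : ℝ} (ht : t ≤ 0) : cumul phi t ≤ Real.exp (-t ^ 2 / 2) := by
  have := integral_Ioi_phi_le (t := -t) (by linarith)
  rw [← cumul_phi_neg] at this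
  simpa using this

theorem one_sub_cumul_phi (t : ℝ) : 1 - cumul phi t = ∫ s in Ioi t, phi s := by
  have := cumul_add_integral_Ioi integrable_phi t
  rw [integral_phi] at this; linarith

theorem strictMono_cumul_phi : StrictMono (cumul phi) :=
  strictMono_of_hasDerivAt_pos (hasDerivAt_cumul continuous_phi integrable_phi) phi_pos

theorem cumul_phi_pos (t : ℝ) : 0 < cumul phi t :=
  (cumul_nonneg phi_nonneg (t - 1)).trans_lt (strictMono_cumul_phi (by linarith))

theorem cumul_phi_lt_one (t : ℝ) : cumul phi t < 1 :=
  (strictMono_cumul_phi (lt_add_one t)).trans_le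
    ((cumul_le phi_nonneg integrable_phi _).trans_eq integral_phi)

theorem exists_cumul_eq {p : ℝ → ℝ} (hc : Continuous p) (hi : Integrable p) (h1 : ∫ x, p x = 1)
    {t : ℝ} (h0t : 0 < t) (ht1 : t < 1) : ∃ x, cumul p x = t := by
  have ha := ((tendsto_cumul_atBot (p := p)).eventually (gt_mem_nhds h0t)).exists
  have hb := ((h1 ▸ tendsto_cumul_atTop hi).eventually (lt_mem_nhds ht1)).exists
  exact mem_range_of_exists_le_of_exists_ge (continuous_cumul hc hi)
    (ha.imp fun _ h => h.le) (hb.imp fun _ h => h.le)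

/-! ### The Gaussian quantile and monotone transport -/

/-- The Gaussian quantile function, the inverse of `cumul phi` on `(0, 1)`. -/
noncomputable def quantile : ℝ → ℝ := Function.invFun (cumul phi)

theorem quantile_cumul (y : ℝ) : quantile (cumul phi y) = y :=
  Function.leftInverse_invFun strictMono_cumul_phi.injective y

theorem cumul_quantile {t : ℝ} (h0t : 0 < t) (ht1 : t < 1) : cumul phi (quantile t) = t :=
  Function.invFun_eq (exists_cumul_eq continuous_phi integrable_phi integral_phi h0t ht1)

theorem hasDerivAt_quantile {t : ℝ} (h0t : 0 < t) (ht1 : t < 1) :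
    HasDerivAt quantile (phi (quantile t))⁻¹ t := by
  have h1 : HasStrictDerivAt (cumul phi) (phi (quantile t)) (quantile t) :=
    hasStrictDerivAt_of_hasDerivAt_of_continuousAt
      (Eventually.of_forall fun y => hasDerivAt_cumul continuous_phi integrable_phi y)
      continuous_phi.continuousAt
  have h2 := h1.to_local_left_inverse (phi_pos _).ne' (g := quantile)
    (Eventually.of_forall quantile_cumul)
  rw [cumul_quantile h0t ht1] at h2
  exact h2.hasDerivAt

/-- Off the range of `cumul phi`, `Function.invFun` returns one fixed default value. `quantile` is
thus constant outside `(0, 1)`, which makes it measurable on the whole line. -/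
theorem quantile_of_notMem {t s : ℝ} (ht : t ∉ Ioo (0 : ℝ) 1) (hs : s ∉ Ioo (0 : ℝ) 1) :
    quantile t = quantile s := by
  have key : ∀ t : ℝ, t ∉ Ioo (0 : ℝ) 1 → ¬ ∃ y, cumul phi y = t := by
    rintro t ht ⟨y, rfl⟩
    exact ht ⟨cumul_phi_pos y, cumul_phi_lt_one y⟩
  rw [quantile, Function.invFun_neg (key t ht), Function.invFun_neg (key s hs)]

theorem measurable_quantile : Measurable quantile := by
  have h1 : ContinuousOn quantile (Ioo 0 1) := fun t ht =>
    (hasDerivAt_quantile ht.1 ht.2).continuousAt.continuousWithinAt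
  have h2 : quantile = (Ioo (0 : ℝ) 1).piecewise quantile (fun _ => quantile 0) := by
    ext t
    by_cases ht : t ∈ Ioo (0 : ℝ) 1
    · simp [ht]
    · rw [piecewise_eq_of_notMem _ _ _ ht]
      exact quantile_of_notMem ht (by simp)
  rw [h2]
  exact h1.measurable_piecewise continuousOn_const measurableSet_Ioo

/-- The monotone transport map from the density `p` to the standard Gaussian. -/
noncomputable def transport (p : ℝ → ℝ) (x : ℝ) : ℝ := quantile (cumul p x)

/-- Continuous probability densities on the line. -/
structure IsContDensity (p : ℝ → ℝ) : Prop where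
  continuous : Continuous p
  nonneg : ∀ x, 0 ≤ p x
  integrable : Integrable p
  integral_eq_one : ∫ x, p x = 1

/-- The open interval on which the distribution function of `p` lies strictly between `0`
and `1`. -/
def bulk (p : ℝ → ℝ) : Set ℝ := {x | cumul p x ∈ Ioo (0 : ℝ) 1}

namespace IsContDensity

variable {p : ℝ → ℝ} (hp : IsContDensity p)
include hp

theorem hasDerivAt_cumul (x : ℝ) : HasDerivAt (cumul p) (p x) x :=
  LSI.hasDerivAt_cumul hp.continuous hp.integrable x

theorem monotone_cumul : Monotone (cumul p) := LSI.monotone_cumul hp.nonneg hp.integrable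

theorem continuous_cumul : Continuous (cumul p) :=
  LSI.continuous_cumul hp.continuous hp.integrable

theorem cumul_le_one (x : ℝ) : cumul p x ≤ 1 :=
  (cumul_le hp.nonneg hp.integrable x).trans_eq hp.integral_eq_one

theorem measurableSet_bulk : MeasurableSet (bulk p) :=
  hp.continuous_cumul.measurable measurableSet_Ioo

/-- Outside the bulk the distribution function attains its minimum `0` or its maximum `1`, so its
derivative vanishes. The arbitrary values of the transport there never matter, being always weighted
by `p` or its derivative. -/
theorem eq_zero_of_notMem {x : ℝ} (hx : x ∉ bulk p) : p x = 0 := by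
  have h0 := cumul_nonneg hp.nonneg (p := p)
  rcases (h0 x).eq_or_lt with h | h
  · exact IsLocalMin.hasDerivAt_eq_zero (Eventually.of_forall fun y => h ▸ h0 y)
      (hp.hasDerivAt_cumul x)
  · rcases (hp.cumul_le_one x).eq_or_lt with h' | h'
    · exact IsLocalMax.hasDerivAt_eq_zero (Eventually.of_forall fun y => h' ▸ hp.cumul_le_one y)
        (hp.hasDerivAt_cumul x)
    · exact absurd ⟨h, h'⟩ hx

theorem ae_mem_bulk : ∀ᵐ x ∂densityMeasure p, x ∈ bulk p := by
  rw [densityMeasure, ae_withDensity_iff hp.continuous.measurable.ennreal_ofReal]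
  refine Eventually.of_forall fun x hx => ?_
  by_contra h
  exact hx (by simp [hp.eq_zero_of_notMem h])

theorem isProbabilityMeasure : IsProbabilityMeasure (densityMeasure p) :=
  ⟨by rw [densityMeasure_univ hp.nonneg hp.integrable, hp.integral_eq_one, ENNReal.ofReal_one]⟩

omit hp in
theorem cumul_transport {x : ℝ} (hx : x ∈ bulk p) : cumul phi (transport p x) = cumul p x :=
  cumul_quantile hx.1 hx.2

omit hp in
theorem transport_le_iff {x : ℝ} (hx : x ∈ bulk p) (y : ℝ) :
    transport p x ≤ y ↔ cumul p x ≤ cumul phi y := by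
  rw [← cumul_transport hx, strictMono_cumul_phi.le_iff_le]

theorem transport_mono {x y : ℝ} (hx : x ∈ bulk p) (hy : y ∈ bulk p) (hxy : x ≤ y) :
    transport p x ≤ transport p y := by
  rw [transport_le_iff hx, cumul_transport hy]
  exact hp.monotone_cumul hxy

theorem mem_bulk_of_mem_Icc {x y z : ℝ} (hx : x ∈ bulk p) (hy : y ∈ bulk p) (hz : z ∈ Icc x y) :
    z ∈ bulk p :=
  ⟨hx.1.trans_le (hp.monotone_cumul hz.1), (hp.monotone_cumul hz.2).trans_lt hy.2⟩

theorem exists_transport_eq (y : ℝ) : ∃ x ∈ bulk p, transport p x = y := by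
  obtain ⟨x, hx⟩ := exists_cumul_eq hp.continuous hp.integrable hp.integral_eq_one
    (cumul_phi_pos y) (cumul_phi_lt_one y)
  exact ⟨x, by simp [bulk, hx, cumul_phi_pos, cumul_phi_lt_one],
    by rw [transport, hx, quantile_cumul]⟩

theorem measurable_transport : Measurable (transport p) :=
  measurable_quantile.comp hp.continuous_cumul.measurable

theorem hasDerivAt_transport {x : ℝ} (hx : x ∈ bulk p) :
    HasDerivAt (transport p) (p x / phi (transport p x)) x := by
  have := (hasDerivAt_quantile hx.1 hx.2).comp x (hp.hasDerivAt_cumul x)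
  rwa [mul_comm, ← div_eq_mul_inv] at this

/-- The density may vanish on intervals, so the distribution function need not be injective. Its
sublevel set is a half-line ending at the supremum, where the value `c` is attained by continuity.
-/
theorem densityMeasure_cumul_le {c : ℝ} (h0c : 0 < c) (hc1 : c < 1) :
    densityMeasure p {x | cumul p x ≤ c} = ENNReal.ofReal c := by
  obtain ⟨x₀, hx₀⟩ := exists_cumul_eq hp.continuous hp.integrable hp.integral_eq_one h0c hc1
  set Z := {x | cumul p x ≤ c} with hZ
  have hne : Z.Nonempty := ⟨x₀, hx₀.le⟩
  obtain ⟨B, hB⟩ := ((hp.integral_eq_one ▸ tendsto_cumul_atTop hp.integrable).eventually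
    (lt_mem_nhds hc1)).exists
  have hbdd : BddAbove Z := ⟨B, fun x hx => by
    by_contra h
    exact absurd (hp.monotone_cumul (not_le.1 h).le) (not_le.2 (lt_of_le_of_lt hx hB))⟩
  have hcl : IsClosed Z := isClosed_le hp.continuous_cumul continuous_const
  have hm : sSup Z ∈ Z := hcl.csSup_mem hne hbdd
  have hmc : cumul p (sSup Z) = c :=
    le_antisymm hm (hx₀ ▸ hp.monotone_cumul (le_csSup hbdd hx₀.le))
  have hZI : Z = Iic (sSup Z) := Subset.antisymm (fun x hx => le_csSup hbdd hx)
    fun x hx => (hp.monotone_cumul hx).trans hm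
  rw [hZI, densityMeasure_Iic hp.nonneg hp.integrable, hmc]

theorem densityMeasure_transport_le (y : ℝ) :
    densityMeasure p (transport p ⁻¹' Iic y) = ENNReal.ofReal (cumul phi y) := by
  rw [← hp.densityMeasure_cumul_le (cumul_phi_pos y) (cumul_phi_lt_one y)]
  refine measure_congr ?_
  filter_upwards [hp.ae_mem_bulk] with x hx
  exact propext (transport_le_iff hx y)

/-- The transport map pushes the density `p` to the standard Gaussian. -/
theorem map_transport : (densityMeasure p).map (transport p) = densityMeasure phi := by
  have := hp.isProbabilityMeasure
  have := Measure.isProbabilityMeasure_map hp.measurable_transport.aemeasurable (μ := densityMeasure p)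
  refine Measure.ext_of_Iic _ _ fun y => ?_
  rw [Measure.map_apply hp.measurable_transport measurableSet_Iic, hp.densityMeasure_transport_le,
    densityMeasure_Iic phi_nonneg integrable_phi]

theorem integrable_comp_transport {g : ℝ → ℝ} (hg : Measurable g) :
    Integrable (fun x => g (transport p x) * p x) ↔ Integrable fun y => g y * phi y := by
  rw [← integrable_densityMeasure continuous_phi.measurable phi_nonneg, ← hp.map_transport,
    integrable_map_measure hg.aestronglyMeasurable hp.measurable_transport.aemeasurable,
    ← integrable_densityMeasure hp.continuous.measurable hp.nonneg]
  rfl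

theorem integral_comp_transport {g : ℝ → ℝ} (hg : Measurable g) :
    ∫ x, g (transport p x) * p x = ∫ y, g y * phi y := by
  rw [← integral_densityMeasure continuous_phi.measurable phi_nonneg, ← hp.map_transport,
    integral_map hp.measurable_transport.aemeasurable hg.aestronglyMeasurable,
    ← integral_densityMeasure hp.continuous.measurable hp.nonneg]

/-- The set `{t ≤ x}` lies almost everywhere in `{T t ≤ T x}` by monotonicity, and both have
`p`-mass `cumul p x`. They can be exchanged, and pushing forward leaves a Gaussian first moment over
a half-line. -/
theorem setIntegral_transport {x : ℝ} (hx : x ∈ bulk p) :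
    ∫ t in Iic x, transport p t * p t = -phi (transport p x) := by
  have := hp.isProbabilityMeasure
  rw [← integral_Iic_mul_phi,
    ← setIntegral_densityMeasure hp.continuous.measurable hp.nonneg _ measurableSet_Iic,
    ← setIntegral_densityMeasure continuous_phi.measurable phi_nonneg _ measurableSet_Iic,
    ← hp.map_transport, setIntegral_map (f := fun y => y) measurableSet_Iic
      measurable_id.aestronglyMeasurable hp.measurable_transport.aemeasurable]
  refine setIntegral_congr_set (ae_eq_of_ae_subset_of_measure_ge ?_ ?_
    measurableSet_Iic.nullMeasurableSet (measure_ne_top _ _))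
  · filter_upwards [hp.ae_mem_bulk] with y hy hyx
    exact hp.transport_mono hy hx hyx
  · rw [hp.densityMeasure_transport_le, cumul_transport hx,
      densityMeasure_Iic hp.nonneg hp.integrable]

theorem integrable_transport_mul : Integrable fun x => transport p x * p x :=
  (hp.integrable_comp_transport measurable_id).2 integrable_mul_phi

theorem integral_transport_mul : ∫ x, transport p x * p x = 0 :=
  (hp.integral_comp_transport measurable_id).trans integral_mul_phi

theorem integrable_transport_sq : Integrable fun x => transport p x ^ 2 * p x :=
  (hp.integrable_comp_transport (measurable_id.pow_const 2)).2 integrable_sq_mul_phi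

theorem integral_transport_sq : ∫ x, transport p x ^ 2 * p x = 1 :=
  (hp.integral_comp_transport (measurable_id.pow_const 2)).trans integral_sq_mul_phi

/-- The defect of the Monge–Ampère equation with the identity, in integral form. -/
theorem sub_phi_transport {q : ℝ → ℝ} (hpq : IsPrimitive p q) (hq : Integrable q) {x : ℝ}
    (hx : x ∈ bulk p) :
    p x - phi (transport p x) = ∫ t in Iic x, (q t + transport p t * p t) := by
  rw [integral_add hq.integrableOn hp.integrable_transport_mul.integrableOn,
    hp.setIntegral_transport hx,
    (tendsto_of_isPrimitive_of_integrable hpq hp.integrable hq).2.2.1 x]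
  rfl

/-- The total integral of `q + T p` is zero, so the defect can be read off the right tail too. This
form is the efficient one where `T x ≥ 0`. -/
theorem sub_phi_transport' {q : ℝ → ℝ} (hpq : IsPrimitive p q) (hq : Integrable q) {x : ℝ}
    (hx : x ∈ bulk p) :
    p x - phi (transport p x) = -∫ t in Ioi x, (q t + transport p t * p t) := by
  have hi : Integrable fun t => q t + transport p t * p t := hq.add hp.integrable_transport_mul
  have h1 := intervalIntegral.integral_Iic_add_Ioi (b := x) hi.integrableOn hi.integrableOn
  rw [integral_add hq hp.integrable_transport_mul, hp.integral_transport_mul,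
    (tendsto_of_isPrimitive_of_integrable hpq hp.integrable hq).2.2.2] at h1
  rw [hp.sub_phi_transport hpq hq hx]
  linarith

/-- Displacement convexity of the entropy along the transport to the Gaussian. -/
theorem integral_mul_log_le {q : ℝ → ℝ} (hpq : IsPrimitive p q) (hq : Integrable q)
    (hqT : Integrable fun x => q x * transport p x)
    (hlog : Integrable fun x => p x * Real.log (p x)) :
    (∫ x, p x * Real.log (p x)) + (∫ x, q x * transport p x)
      + (3 / 2 + Real.log (2 * Real.pi) / 2) ≤ 0 := by
  set T := transport p with hT
  set κ := 1 + Real.log (2 * Real.pi) / 2 with hκ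
  have hT2 : Integrable fun x => T x ^ 2 * p x := hp.integrable_transport_sq
  have hT2' : ∫ x, T x ^ 2 * p x = 1 := hp.integral_transport_sq
  -- By the formula for `log φ`, this is `p log(p / φ(T)) + p + q T`. Since `log t ≤ t - 1`, it is
  -- at most `p T' + q T = (p T)'`. The terms with `κ` and `1 / 2` integrate to the constant `3 / 2
  -- + log(2π) / 2`.
  let G : ℝ → ℝ := fun x => p x * Real.log (p x) + q x * T x + (κ * p x + (1 / 2) * (T x ^ 2 * p x))
  have hG : Integrable G := (hlog.add hqT).add
    ((hp.integrable.const_mul _).add (hT2.const_mul _))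
  have hGint : ∫ x, G x = (∫ x, p x * Real.log (p x)) + (∫ x, q x * T x)
      + (3 / 2 + Real.log (2 * Real.pi) / 2) := by
    simp only [G]
    have hκi : Integrable fun x => κ * p x + 1 / 2 * (T x ^ 2 * p x) :=
      (hp.integrable.const_mul _).add (hT2.const_mul _)
    rw [integral_add (by exact hlog.add hqT) hκi, integral_add hlog hqT,
      integral_add (hp.integrable.const_mul _) (hT2.const_mul _),
      integral_const_mul, integral_const_mul, hp.integral_eq_one, hT2']
    rw [hκ]; ring
  rw [← hGint]
  -- Off the bulk `p` is zero, its minimum, so `q` vanishes there almost everywhere; the tail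
  -- integrals below see only points where `T` is monotone.
  have hq0 : ∀ᵐ x, x ∉ bulk p → q x = 0 := by
    filter_upwards [hpq.ae_eq_zero hp.nonneg] with x hx hxb
    exact hx (hp.eq_zero_of_notMem hxb)
  -- Cutting off at the levels `T = -(n + 1)` and `T = n + 1` gives windows inside the bulk on which
  -- `T` is continuously differentiable and which exhaust the bulk.
  choose a ha hTa using fun n : ℕ => hp.exists_transport_eq (-((n : ℝ) + 1))
  choose b hb hTb using fun n : ℕ => hp.exists_transport_eq ((n : ℝ) + 1)
  have hpos : ∀ n : ℕ, (0 : ℝ) ≤ (n : ℝ) + 1 := fun n => by positivity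
  have hab : ∀ n, a n ≤ b n := fun n => by
    by_contra h
    have h1 := hp.monotone_cumul (not_le.1 h).le
    rw [← cumul_transport (ha n), ← cumul_transport (hb n), strictMono_cumul_phi.le_iff_le, hTa,
      hTb] at h1
    linarith [hpos n]
  have hsub : ∀ n, ∀ x ∈ Icc (a n) (b n), x ∈ bulk p := fun n x hx =>
    hp.mem_bulk_of_mem_Icc (ha n) (hb n) hx
  -- The window contributes the boundary terms `(n + 1) (p (a n) + p (b n))`. They are dominated by
  -- the integral of `|q T|` outside the window, which tends to zero.
  have key : ∀ n, ∫ x in Ioc (a n) (b n), G x ≤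
      (∫ x, |q x * T x|) - ∫ x in Ioc (a n) (b n), |q x * T x| := by
    intro n
    have hI := tendsto_of_isPrimitive_of_integrable hpq hp.integrable hq
    have hTd : ∀ x ∈ uIcc (a n) (b n), HasDerivAt T (p x / phi (T x)) x := fun x hx =>
      hp.hasDerivAt_transport (hsub n x (uIcc_of_le (hab n) ▸ hx))
    have hTc : ContinuousOn T (uIcc (a n) (b n)) := fun x hx =>
      (hTd x hx).continuousAt.continuousWithinAt
    have hT'c : ContinuousOn (fun x => p x / phi (T x)) (uIcc (a n) (b n)) :=
      hp.continuous.continuousOn.div (continuous_phi.comp_continuousOn hTc)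
        fun x _ => (phi_pos _).ne'
    have hTac : AbsolutelyContinuousOnInterval T (a n) (b n) := by
      obtain ⟨K, hK⟩ := isCompact_uIcc.exists_bound_of_continuousOn hT'c
      refine LipschitzOnWith.absolutelyContinuousOnInterval (K := K.toNNReal) ?_
      refine (convex_uIcc _ _).lipschitzOnWith_of_nnnorm_hasDerivWithin_le
        (fun x hx => (hTd x hx).hasDerivWithinAt) fun x hx => ?_
      rw [← NNReal.coe_le_coe, coe_nnnorm]
      exact (hK x hx).trans (Real.le_coe_toNNReal K)
    have hparts := (hpq.absolutelyContinuous (a n) (b n)).integral_mul_deriv_eq_deriv_mul hTac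
    have e1 : ∫ x in a n..b n, p x * deriv T x = ∫ x in a n..b n, p x * (p x / phi (T x)) :=
      intervalIntegral.integral_congr fun x hx => by simp only [(hTd x hx).deriv]
    have e2 : ∫ x in a n..b n, deriv p x * T x = ∫ x in a n..b n, q x * T x :=
      intervalIntegral.integral_congr_ae (hpq.ae_hasDerivAt.mono fun x hx _ => by rw [hx.deriv])
    rw [e1, e2, hT, hTa, hTb, ← hT] at hparts
    have hpw : ∀ x ∈ Icc (a n) (b n), G x ≤ p x * (p x / phi (T x)) + q x * T x := by
      intro x hx
      simp only [G]
      rcases (hp.nonneg x).eq_or_lt with h | h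
      · simp [← h]
      · have h1 := Real.log_le_sub_one_of_pos (div_pos h (phi_pos (T x)))
        rw [Real.log_div h.ne' (phi_pos _).ne', log_phi] at h1
        have h2 := mul_le_mul_of_nonneg_left h1 h.le
        rw [hκ]
        nlinarith [h2]
    -- Here `p (b n)` is minus the integral of `q` to the right of `b n`, where `T ≥ n + 1`.
    have hb1 : ((n : ℝ) + 1) * p (b n) ≤ ∫ x in Ioi (b n), |q x * T x| := by
      have e : p (b n) = -∫ x in Ioi (b n), q x := by
        have := cumul_add_integral_Ioi hq (b n)
        rw [hI.2.2.2] at this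
        rw [hI.2.2.1]; linarith
      rw [e, ← integral_neg, ← integral_const_mul]
      refine setIntegral_mono_on_ae (hq.neg.const_mul _).integrableOn hqT.abs.integrableOn
        measurableSet_Ioi (hq0.mono fun x hx hxb => ?_)
      by_cases hxU : x ∈ bulk p
      · have h1 := hp.transport_mono (hb n) hxU (le_of_lt hxb)
        rw [hTb] at h1
        change _ ≤ T x at h1
        rw [abs_mul, mul_comm]
        exact (mul_le_mul_of_nonneg_right (neg_le_abs _) (hpos n)).trans
          (mul_le_mul_of_nonneg_left (h1.trans (le_abs_self _)) (abs_nonneg _))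
      · simp [hx hxU]
    have ha1 : ((n : ℝ) + 1) * p (a n) ≤ ∫ x in Iic (a n), |q x * T x| := by
      rw [hI.2.2.1, cumul, ← integral_const_mul]
      refine setIntegral_mono_on_ae (hq.const_mul _).integrableOn hqT.abs.integrableOn
        measurableSet_Iic (hq0.mono fun x hx hxb => ?_)
      by_cases hxU : x ∈ bulk p
      · have h1 := hp.transport_mono hxU (ha n) hxb
        rw [hTa] at h1
        change T x ≤ _ at h1
        rw [abs_mul, mul_comm]
        exact (mul_le_mul_of_nonneg_right (le_abs_self _) (hpos n)).trans
          (mul_le_mul_of_nonneg_left ((le_neg.1 h1).trans (neg_le_abs _)) (abs_nonneg _))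
      · simp [hx hxU]
    have hsplit : (∫ x in Iic (a n), |q x * T x|) + (∫ x in Ioc (a n) (b n), |q x * T x|)
        + ∫ x in Ioi (b n), |q x * T x| = ∫ x, |q x * T x| := by
      rw [← setIntegral_union (Iic_disjoint_Ioc le_rfl) measurableSet_Ioc hqT.abs.integrableOn
        hqT.abs.integrableOn, Iic_union_Ioc_eq_Iic (hab n)]
      exact intervalIntegral.integral_Iic_add_Ioi hqT.abs.integrableOn hqT.abs.integrableOn
    have hint1 : IntervalIntegrable (fun x => p x * (p x / phi (T x))) volume (a n) (b n) :=
      (hp.continuous.continuousOn.mul hT'c).intervalIntegrable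
    have hGle : ∫ x in a n..b n, G x ≤
        ∫ x in a n..b n, (p x * (p x / phi (T x)) + q x * T x) :=
      intervalIntegral.integral_mono_on (hab n) hG.intervalIntegrable
        (hint1.add hqT.intervalIntegrable) hpw
    rw [intervalIntegral.integral_add hint1 hqT.intervalIntegrable] at hGle
    rw [intervalIntegral.integral_of_le (hab n)] at hGle
    linarith
  have hcover : AECover (volume.restrict (bulk p)) atTop fun n => Ioc (a n) (b n) := by
    refine ⟨?_, fun n => measurableSet_Ioc⟩
    filter_upwards [ae_restrict_mem hp.measurableSet_bulk] with x hx
    obtain ⟨N, hN⟩ := exists_nat_gt |T x|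
    filter_upwards [eventually_ge_atTop N] with n hn
    have hn' : |T x| < (n : ℝ) + 1 := by
      have : (N : ℝ) ≤ n := Nat.cast_le.2 hn
      linarith
    rw [abs_lt] at hn'
    constructor
    · by_contra h
      have := hp.transport_mono hx (ha n) (not_lt.1 h)
      rw [hTa] at this; linarith
    · by_contra h
      have := hp.transport_mono (hb n) hx (not_le.1 h).le
      rw [hTb] at this; linarith
  have hres : ∀ n (f : ℝ → ℝ), ∫ x in Ioc (a n) (b n), f x ∂(volume.restrict (bulk p))
      = ∫ x in Ioc (a n) (b n), f x := fun n f => by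
    rw [Measure.restrict_restrict measurableSet_Ioc,
      inter_eq_left.2 fun x hx => hsub n x ⟨hx.1.le, hx.2⟩]
  have l1 := hcover.integral_tendsto_of_countably_generated hG.integrableOn
  have l2 := hcover.integral_tendsto_of_countably_generated hqT.abs.integrableOn
  simp only [hres] at l1 l2
  have e1 : ∫ x in bulk p, G x = ∫ x, G x :=
    setIntegral_eq_integral_of_ae_compl_eq_zero (hq0.mono fun x hx hxb => by
      simp [G, hx hxb, hp.eq_zero_of_notMem hxb])
  have e2 : ∫ x in bulk p, |q x * T x| = ∫ x, |q x * T x| :=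
    setIntegral_eq_integral_of_ae_compl_eq_zero (hq0.mono fun x hx hxb => by simp [hx hxb])
  rw [e1] at l1
  rw [e2] at l2
  have := le_of_tendsto_of_tendsto' l1 (l2.const_sub _) key
  simpa using this

end IsContDensity

/-! ### Stability of the transport map -/

theorem integral_abs_gt_phi_le {R : ℝ} (hR : 0 ≤ R) :
    ∫ y in {y : ℝ | R < |y|}, phi y ≤ 2 * Real.exp (-R ^ 2 / 2) := by
  have e : {y : ℝ | R < |y|} = Iio (-R) ∪ Ioi R := by
    ext y; simp only [mem_ofPred_eq, lt_abs, mem_union, mem_Iio, mem_Ioi]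
    constructor <;> rintro (h | h)
    · exact Or.inr h
    · exact Or.inl (by linarith)
    · exact Or.inr (by linarith)
    · exact Or.inl h
  have hd : Disjoint (Iio (-R)) (Ioi R) := by
    refine disjoint_left.2 fun y hy hy' => ?_
    simp only [mem_Iio, mem_Ioi] at hy hy'
    linarith
  rw [e, setIntegral_union hd measurableSet_Ioi integrable_phi.integrableOn
    integrable_phi.integrableOn, ← integral_Iic_eq_integral_Iio]
  have h1 : ∫ y in Iic (-R), phi y ≤ Real.exp (-R ^ 2 / 2) := by
    have := cumul_phi_le (t := -R) (by linarith)
    rwa [neg_sq] at this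
  linarith [integral_Ioi_phi_le hR]

theorem integrable_abs_mul_exp_mul_phi :
    Integrable fun y => |y| * Real.exp (y ^ 2 / 4) * phi y := by
  have : (fun y => |y| * Real.exp (y ^ 2 / 4) * phi y)
      = fun y => (√(2 * Real.pi))⁻¹ * |y * Real.exp (-(1 / 4) * y ^ 2)| := by
    ext y
    rw [phi, abs_mul, abs_of_pos (Real.exp_pos _), mul_assoc, mul_left_comm (Real.exp _),
      ← Real.exp_add]
    ring_nf
  rw [this]
  exact (integrable_mul_exp_neg_mul_sq (by norm_num)).abs.const_mul _

/-- `p` is a continuous density with derivative `q` whose transport to the Gaussian satisfies the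
Euler–Lagrange equation `q + T p = 0` up to an error `E √p` with `‖E‖₂ ≤ h`. -/
structure IsNearGaussian (p q E : ℝ → ℝ) (h : ℝ) : Prop where
  density : IsContDensity p
  primitive : IsPrimitive p q
  integrable : Integrable q
  pos : 0 < h
  memLp : MemLp E 2
  integral_sq_le : ∫ x, E x ^ 2 ≤ h ^ 2
  defect_eq : ∀ x, q x + transport p x * p x = E x * √(p x)

namespace IsNearGaussian

variable {p q E : ℝ → ℝ} {h : ℝ} (H : IsNearGaussian p q E h)
include H

theorem memLp_sqrt : MemLp (fun x => √(p x)) 2 := by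
  rw [memLp_two_iff_integrable_sq H.density.continuous.sqrt.aestronglyMeasurable]
  simpa [Real.sq_sqrt (H.density.nonneg _)] using H.density.integrable

/-- Cauchy–Schwarz for `E` and `√p`. The gain is that the bound carries the square root of the mass
of `s`, which is small on tails. -/
theorem setIntegral_defect_le (s : Set ℝ) :
    |∫ x in s, (q x + transport p x * p x)| ≤ h * √(∫ x in s, p x) := by
  refine (abs_integral_le_integral_abs).trans ?_
  simp_rw [H.defect_eq]
  refine (integral_abs_mul_le (H.memLp.restrict s) (H.memLp_sqrt.restrict s)).trans ?_
  simp_rw [Real.sq_sqrt (H.density.nonneg _)]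
  refine mul_le_mul_of_nonneg_right (Real.sqrt_le_iff.2 ⟨H.pos.le, le_trans ?_ H.integral_sq_le⟩)
    (Real.sqrt_nonneg _)
  exact setIntegral_le_integral H.memLp.integrable_sq (Eventually.of_forall fun x => sq_nonneg _)

theorem integral_abs_defect_le : ∫ x, |q x + transport p x * p x| ≤ h := by
  simp_rw [H.defect_eq]
  refine (integral_abs_mul_le H.memLp H.memLp_sqrt).trans ?_
  simp_rw [Real.sq_sqrt (H.density.nonneg _)]
  rw [H.density.integral_eq_one, Real.sqrt_one, mul_one]
  exact Real.sqrt_le_iff.2 ⟨H.pos.le, H.integral_sq_le⟩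

/-- The defect is an integral of `q + T p` over a tail on the side of the sign of `T x`. The
`p`-mass of that tail equals the Gaussian mass beyond `T x`, at most `exp(-T²/2)`, and its square
root gives the exponent `-T²/4`. -/
theorem abs_sub_phi_le {x : ℝ} (hx : x ∈ bulk p) :
    |p x - phi (transport p x)| ≤ h * Real.exp (-transport p x ^ 2 / 4) := by
  have hp := H.density
  have hs : ∀ t : ℝ, √(Real.exp (-t ^ 2 / 2)) = Real.exp (-t ^ 2 / 4) := fun t => by
    rw [← Real.exp_half]; ring_nf
  rcases le_total (transport p x) 0 with h0 | h0
  · rw [hp.sub_phi_transport H.primitive H.integrable hx]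
    refine (H.setIntegral_defect_le _).trans (mul_le_mul_of_nonneg_left ?_ H.pos.le)
    rw [← hs]
    refine Real.sqrt_le_sqrt ?_
    have := cumul_phi_le h0
    rwa [IsContDensity.cumul_transport hx] at this
  · rw [hp.sub_phi_transport' H.primitive H.integrable hx, abs_neg]
    refine (H.setIntegral_defect_le _).trans (mul_le_mul_of_nonneg_left ?_ H.pos.le)
    rw [← hs]
    refine Real.sqrt_le_sqrt ?_
    have := integral_Ioi_phi_le h0
    rw [← one_sub_cumul_phi, IsContDensity.cumul_transport hx] at this
    have h2 := cumul_add_integral_Ioi hp.integrable x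
    rw [hp.integral_eq_one] at h2
    linarith

/-- Dividing the previous bound by `φ(T)` costs `√(2π) exp(T²/2)`. Half of the Gaussian exponent
survives, so `exp(T²/4)` remains integrable under the law of `T`. -/
theorem abs_deriv_sub_one_le {x : ℝ} (hx : x ∈ bulk p) :
    |p x / phi (transport p x) - 1| ≤ h * √(2 * Real.pi) * Real.exp (transport p x ^ 2 / 4) := by
  have h1 := H.abs_sub_phi_le hx
  have hφ := phi_pos (transport p x)
  rw [div_sub_one hφ.ne', abs_div, abs_of_pos hφ, div_le_iff₀ hφ]
  refine h1.trans_eq ?_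
  rw [phi]
  have : √(2 * Real.pi) ≠ 0 := sqrt_two_pi_pos.ne'
  have e : Real.exp (-transport p x ^ 2 / 4)
      = Real.exp (transport p x ^ 2 / 4) * Real.exp (-transport p x ^ 2 / 2) := by
    rw [← Real.exp_add]; ring_nf
  rw [e]
  field_simp

/-- In the bulk the transport map is close to a translation. -/
theorem abs_transport_sub_le {x x₀ : ℝ} (hx : x ∈ bulk p) (hx₀ : x₀ ∈ bulk p)
    (h0 : transport p x₀ = 0)
    (hs : h * √(2 * Real.pi) * Real.exp (transport p x ^ 2 / 4) ≤ 1 / 2) :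
    |transport p x - (x - x₀)| ≤
      2 * (h * √(2 * Real.pi)) * (|transport p x| * Real.exp (transport p x ^ 2 / 4)) := by
  have hp := H.density
  set T := transport p with hT
  set ε := h * √(2 * Real.pi) * Real.exp (T x ^ 2 / 4) with hε
  -- As `T` is monotone and vanishes at `x₀`, the bound on the derivative at `x` is valid along the
  -- whole segment.
  have hseg : ∀ t ∈ uIcc x₀ x, t ∈ bulk p ∧ |T t| ≤ |T x| := by
    intro t ht
    rcases le_total x₀ x with hle | hle
    · rw [uIcc_of_le hle] at ht
      have htb := hp.mem_bulk_of_mem_Icc hx₀ hx ht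
      have h1 := hp.transport_mono hx₀ htb ht.1
      have h2 := hp.transport_mono htb hx ht.2
      change T x₀ ≤ T t at h1
      rw [h0] at h1
      exact ⟨htb, abs_le_abs h2 (by linarith)⟩
    · rw [uIcc_of_ge hle] at ht
      have htb := hp.mem_bulk_of_mem_Icc hx hx₀ ht
      have h1 := hp.transport_mono hx htb ht.1
      have h2 := hp.transport_mono htb hx₀ ht.2
      change T t ≤ T x₀ at h2
      rw [h0] at h2
      exact ⟨htb, abs_le_abs_of_nonpos h2 h1⟩
  have hmv := (convex_uIcc x₀ x).norm_image_sub_le_of_norm_hasDerivWithin_le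
    (f := fun t => T t - t) (f' := fun t => p t / phi (T t) - 1) (C := ε)
    (fun t ht => ((hp.hasDerivAt_transport (hseg t ht).1).sub (hasDerivAt_id' t)).hasDerivWithinAt)
    (fun t ht => by
      refine (H.abs_deriv_sub_one_le (hseg t ht).1).trans ?_
      refine mul_le_mul_of_nonneg_left (Real.exp_le_exp.2 ?_)
        (mul_nonneg H.pos.le (Real.sqrt_nonneg _))
      have := sq_le_sq.2 (hseg t ht).2
      linarith) left_mem_uIcc right_mem_uIcc
  rw [h0, Real.norm_eq_abs, Real.norm_eq_abs] at hmv
  have e : T x - x - (0 - x₀) = T x - (x - x₀) := by ring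
  rw [e] at hmv
  have hε0 : 0 ≤ ε := by have := H.pos; positivity
  -- Since `ε ≤ 1 / 2`, the error is at most half of `|x - x₀|` and is absorbed, so `|x - x₀|` can
  -- be traded for `|T x|`.
  have h1 : |x - x₀| ≤ 2 * |T x| := by
    have h2 : |x - x₀| ≤ |T x| + |T x - (x - x₀)| := by
      have := abs_sub (T x) (T x - (x - x₀))
      rwa [sub_sub_cancel] at this
    have h3 : ε * |x - x₀| ≤ 1 / 2 * |x - x₀| := mul_le_mul_of_nonneg_right hs (abs_nonneg _)
    linarith
  calc |T x - (x - x₀)| ≤ ε * |x - x₀| := hmv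
    _ ≤ ε * (2 * |T x|) := mul_le_mul_of_nonneg_left h1 hε0
    _ = _ := by rw [hε]; ring

end IsNearGaussian

/-- The constant in the bulk estimate for the transport map. -/
noncomputable def bulkConst : ℝ :=
  2 * √(2 * Real.pi) * ∫ y, |y| * Real.exp (y ^ 2 / 4) * phi y

theorem bulkConst_nonneg : 0 ≤ bulkConst :=
  mul_nonneg (by positivity) (integral_nonneg fun y =>
    mul_nonneg (mul_nonneg (abs_nonneg _) (Real.exp_pos _).le) (phi_nonneg _))

/-- The constant in the tail estimate for the transport map. -/
noncomputable def tailConst (m : ℝ) : ℝ := √(16 * Real.pi) * √(2 + 2 * m)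

namespace IsNearGaussian

variable {p q E : ℝ → ℝ} {h : ℝ} (H : IsNearGaussian p q E h)
include H

theorem memLp_transport : MemLp (transport p) 2 (densityMeasure p) := by
  rw [memLp_two_iff_integrable_sq H.density.measurable_transport.aestronglyMeasurable,
    integrable_densityMeasure H.density.continuous.measurable H.density.nonneg]
  exact H.density.integrable_transport_sq

/-- Under `p` the second moment of `T` is that of the Gaussian, namely `1`. This is the crude bound
used on the tail. -/
theorem integral_transport_sub_sq_le (hm : Integrable (fun x => x ^ 2) (densityMeasure p)) :
    ∫ x, (transport p x - x) ^ 2 ∂densityMeasure p ≤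
      2 + 2 * ∫ x, x ^ 2 ∂densityMeasure p := by
  have h1 := H.memLp_transport
  have h2 : MemLp (fun x : ℝ => x) 2 (densityMeasure p) :=
    (memLp_two_iff_integrable_sq measurable_id.aestronglyMeasurable).2 hm
  have h3 : ∫ x, transport p x ^ 2 ∂densityMeasure p = 1 := by
    rw [integral_densityMeasure H.density.continuous.measurable H.density.nonneg]
    exact H.density.integral_transport_sq
  have h4 : Integrable (fun x => 2 * transport p x ^ 2) (densityMeasure p) :=
    h1.integrable_sq.const_mul 2
  have h5 : Integrable (fun x : ℝ => 2 * x ^ 2) (densityMeasure p) := hm.const_mul 2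
  have h6 : Integrable (fun x => (transport p x - x) ^ 2) (densityMeasure p) :=
    (h1.sub h2).integrable_sq
  have h7 : ∫ x, (transport p x - x) ^ 2 ∂densityMeasure p ≤
      ∫ x, (2 * transport p x ^ 2 + 2 * x ^ 2) ∂densityMeasure p :=
    integral_mono h6 (h4.add h5) fun x => by
      have := sq_nonneg (transport p x + x)
      simp only; linarith
  rwa [integral_add h4 h5, integral_const_mul, integral_const_mul, h3, mul_one] at h7

/-- The line is split at `|T| = R`. Inside, `T` is close to `x - x₀` in `L¹`; outside, a mass of
order `h²` and bounded second moments cost order `h`. Both `T` and `x` have mean zero, which forces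
the translation `x₀` to be of order `h`. The factor `3` is one for the two regions and two for
`|x₀|`. -/
theorem integral_abs_transport_sub_le (hm : Integrable (fun x => x ^ 2) (densityMeasure p))
    (hc : ∫ x, x ∂densityMeasure p = 0) (hh : h ≤ 1 / 16) :
    ∫ x, |transport p x - x| ∂densityMeasure p ≤
      3 * (bulkConst + tailConst (∫ x, x ^ 2 ∂densityMeasure p)) * h := by
  have hp := H.density
  have hpos := H.pos
  have hprob := hp.isProbabilityMeasure
  set μ := densityMeasure p with hμ
  set T := transport p with hT
  set m := ∫ x, x ^ 2 ∂μ with hm_def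
  -- With `R` chosen so that `exp(R²/4) = 1 / a`, the bound on `|T' - 1|` is exactly `1 / 2` at `|T|
  -- = R`, and the mass outside is at most `2 exp(-R²/2) = 2 a²`. The restriction `h ≤ 1 / 16` gives
  -- `a² ≤ 1 / 4`, hence `a < 1` and a mass of at least `1 / 2` inside.
  set a := 2 * √(2 * Real.pi) * h with ha
  have ha0 : 0 < a := by have := sqrt_two_pi_pos; positivity
  have hpi : Real.pi ≤ 3.15 := Real.pi_lt_d2.le
  have ha2 : a ^ 2 = 8 * Real.pi * h ^ 2 := by
    rw [ha, mul_pow, mul_pow, Real.sq_sqrt (by positivity)]; ring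
  have hh2 : h ^ 2 ≤ 1 / 256 := by nlinarith
  have ha2' : a ^ 2 ≤ 1 / 4 := by
    rw [ha2]; nlinarith [Real.pi_pos]
  have ha1 : a < 1 := by nlinarith
  set R := √(4 * -Real.log a) with hR
  have hR0 : 0 ≤ R := Real.sqrt_nonneg _
  have hR2 : R ^ 2 = 4 * -Real.log a :=
    Real.sq_sqrt (by have := Real.log_neg ha0 ha1; linarith)
  have hexp4 : Real.exp (R ^ 2 / 4) = a⁻¹ := by
    rw [hR2, mul_div_cancel_left₀ _ (by norm_num), Real.exp_neg, Real.exp_log ha0]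
  have hexp2 : Real.exp (-R ^ 2 / 2) = a ^ 2 := by
    rw [hR2]
    have : -(4 * -Real.log a) / 2 = Real.log a + Real.log a := by ring
    rw [this, Real.exp_add, Real.exp_log ha0, sq]
  let B : Set ℝ := {x | |T x| ≤ R}
  have hB : MeasurableSet B := measurableSet_le hp.measurable_transport.abs measurable_const
  have hTm := H.memLp_transport
  have hxm : MemLp (fun x : ℝ => x) 2 μ :=
    (memLp_two_iff_integrable_sq measurable_id.aestronglyMeasurable).2 hm
  have hDm : MemLp (fun x => T x - x) 2 μ := hTm.sub hxm
  have hDi : Integrable (fun x => T x - x) μ := hDm.integrable one_le_two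
  have hTi : Integrable T μ := hTm.integrable one_le_two
  have hxi : Integrable (fun x : ℝ => x) μ := hxm.integrable one_le_two
  have hD0 : ∫ x, (T x - x) ∂μ = 0 := by
    rw [integral_sub hTi hxi, hc, integral_densityMeasure hp.continuous.measurable hp.nonneg,
      hp.integral_transport_mul, sub_zero]
  obtain ⟨x₀, hx₀, hTx₀⟩ := hp.exists_transport_eq 0
  -- the tail
  have htail : μ.real Bᶜ ≤ 2 * a ^ 2 := by
    have e1 : μ Bᶜ = densityMeasure phi {y : ℝ | R < |y|} := by
      rw [← hp.map_transport, Measure.map_apply hp.measurable_transport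
        (measurableSet_lt measurable_const measurable_abs)]
      congr 1; ext x; simp [B, hT]
    have e2 : densityMeasure phi {y : ℝ | R < |y|}
        = ENNReal.ofReal (∫ y in {y : ℝ | R < |y|}, phi y) := by
      rw [densityMeasure, withDensity_apply _ (measurableSet_lt measurable_const measurable_abs),
        ofReal_integral_eq_lintegral_ofReal integrable_phi.integrableOn
          (Eventually.of_forall phi_nonneg)]
    rw [Measure.real, e1, e2, ENNReal.toReal_ofReal (integral_nonneg phi_nonneg), ← hexp2]
    exact integral_abs_gt_phi_le hR0
  have hDtail : ∫ x in Bᶜ, |T x - x| ∂μ ≤ tailConst m * h := by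
    have h1 := integral_abs_mul_le (μ := μ.restrict Bᶜ) (memLp_const (1 : ℝ)) (hDm.restrict Bᶜ)
    simp only [one_mul, one_pow, integral_const, smul_eq_mul, mul_one, measureReal_restrict_apply_univ]
      at h1
    refine h1.trans ?_
    have h2 : ∫ x in Bᶜ, (T x - x) ^ 2 ∂μ ≤ 2 + 2 * m :=
      (setIntegral_le_integral hDm.integrable_sq (Eventually.of_forall fun x => sq_nonneg _)).trans
        (H.integral_transport_sub_sq_le hm)
    have h3 : √(μ.real Bᶜ) ≤ √(16 * Real.pi) * h := by
      rw [← Real.sqrt_sq hpos.le, ← Real.sqrt_mul (by positivity)]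
      refine Real.sqrt_le_sqrt (htail.trans_eq ?_)
      rw [ha2]; ring
    calc √(μ.real Bᶜ) * √(∫ x in Bᶜ, (T x - x) ^ 2 ∂μ)
        ≤ (√(16 * Real.pi) * h) * √(2 + 2 * m) :=
          mul_le_mul h3 (Real.sqrt_le_sqrt h2) (Real.sqrt_nonneg _) (by positivity)
      _ = tailConst m * h := by rw [tailConst]; ring
  -- the bulk
  have hg : Measurable fun y : ℝ => |y| * Real.exp (y ^ 2 / 4) := by fun_prop
  have hgi : Integrable (fun x => |T x| * Real.exp (T x ^ 2 / 4)) μ := by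
    rw [integrable_densityMeasure hp.continuous.measurable hp.nonneg]
    exact (hp.integrable_comp_transport hg).2 integrable_abs_mul_exp_mul_phi
  have hgint : ∫ x, |T x| * Real.exp (T x ^ 2 / 4) ∂μ
      = ∫ y, |y| * Real.exp (y ^ 2 / 4) * phi y := by
    rw [integral_densityMeasure hp.continuous.measurable hp.nonneg]
    exact hp.integral_comp_transport hg
  have hD0i : Integrable (fun x => T x - x + x₀) μ := hDi.add (integrable_const _)
  have hbulk : ∫ x in B, |T x - x + x₀| ∂μ ≤ bulkConst * h := by
    calc ∫ x in B, |T x - x + x₀| ∂μ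
        ≤ ∫ x in B, 2 * (h * √(2 * Real.pi)) * (|T x| * Real.exp (T x ^ 2 / 4)) ∂μ := by
          refine setIntegral_mono_on_ae hD0i.abs.integrableOn (hgi.const_mul _).integrableOn hB ?_
          filter_upwards [hp.ae_mem_bulk] with x hx hxB
          have hTx : T x ^ 2 ≤ R ^ 2 := sq_le_sq.2 (by rwa [abs_of_nonneg hR0])
          have := H.abs_transport_sub_le hx hx₀ hTx₀ (by
            have h1 : Real.exp (T x ^ 2 / 4) ≤ a⁻¹ := by
              rw [← hexp4]; exact Real.exp_le_exp.2 (by linarith)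
            calc h * √(2 * Real.pi) * Real.exp (T x ^ 2 / 4)
                ≤ h * √(2 * Real.pi) * a⁻¹ := mul_le_mul_of_nonneg_left h1 (by positivity)
              _ = 1 / 2 := by
                have := sqrt_two_pi_pos.ne'
                have := hpos.ne'
                rw [ha]; field_simp)
          rwa [← sub_add] at this
      _ ≤ ∫ x, 2 * (h * √(2 * Real.pi)) * (|T x| * Real.exp (T x ^ 2 / 4)) ∂μ :=
          setIntegral_le_integral (hgi.const_mul _) (Eventually.of_forall fun x => by
            simp only [Pi.zero_apply]; positivity)
      _ = bulkConst * h := by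
          rw [integral_const_mul, hgint, bulkConst]; ring
  have hBmass : 1 / 2 ≤ μ.real B := by
    have := probReal_compl_eq_one_sub (μ := μ) hB
    linarith
  -- Since `∫ (T - x) = 0`, the integral over `B` of `T - x + x₀` determines `μ(B) x₀` up to the
  -- tail, and `μ(B) ≥ 1 / 2`.
  have hx₀le : |x₀| ≤ 2 * ((bulkConst + tailConst m) * h) := by
    have h1 : ∫ x in B, (T x - x + x₀) ∂μ = (∫ x in B, (T x - x) ∂μ) + μ.real B * x₀ := by
      rw [integral_add hDi.integrableOn (integrable_const _)]
      simp
    have h2 := integral_add_compl hB hDi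
    rw [hD0] at h2
    have h3 : μ.real B * x₀ = (∫ x in B, (T x - x + x₀) ∂μ) + ∫ x in Bᶜ, (T x - x) ∂μ := by
      linarith
    have h4 : μ.real B * |x₀| ≤ (bulkConst + tailConst m) * h := by
      rw [← abs_of_nonneg (measureReal_nonneg (μ := μ) (s := B)), ← abs_mul, h3]
      refine (abs_add_le _ _).trans ?_
      have h5 := (abs_integral_le_integral_abs (μ := μ.restrict B) (f := fun x => T x - x + x₀)).trans hbulk
      have h6 := (abs_integral_le_integral_abs (μ := μ.restrict Bᶜ) (f := fun x => T x - x)).trans hDtail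
      linarith
    nlinarith [abs_nonneg x₀]
  have hBD : ∫ x in B, |T x - x| ∂μ ≤ (∫ x in B, |T x - x + x₀| ∂μ) + |x₀| := by
    calc ∫ x in B, |T x - x| ∂μ ≤ ∫ x in B, (|T x - x + x₀| + |x₀|) ∂μ := by
          refine integral_mono hDi.abs.integrableOn
            (hD0i.abs.integrableOn.add (integrable_const _)) fun x => ?_
          have := abs_sub (T x - x + x₀) x₀
          rwa [add_sub_cancel_right] at this
      _ = (∫ x in B, |T x - x + x₀| ∂μ) + μ.real B * |x₀| := by
          rw [integral_add hD0i.abs.integrableOn (integrable_const _)]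
          simp
      _ ≤ _ := by
          have := mul_le_mul_of_nonneg_right (measureReal_le_one (μ := μ) (s := B)) (abs_nonneg x₀)
          linarith
  rw [← integral_add_compl hB hDi.abs]
  nlinarith

end IsNearGaussian

/-! ### Profiles and the log-Sobolev inequality with remainder -/

/-- The standard Gaussian measure on the line, given by its density. -/
noncomputable abbrev gauss : Measure ℝ := densityMeasure phi

theorem isContDensity_phi : IsContDensity phi :=
  ⟨continuous_phi, phi_nonneg, integrable_phi, integral_phi⟩

instance : IsProbabilityMeasure gauss := isContDensity_phi.isProbabilityMeasure

theorem integral_gauss (g : ℝ → ℝ) : ∫ x, g x ∂gauss = ∫ x, g x * phi x :=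
  integral_densityMeasure continuous_phi.measurable phi_nonneg g

theorem integrable_gauss {g : ℝ → ℝ} : Integrable g gauss ↔ Integrable fun x => g x * phi x :=
  integrable_densityMeasure continuous_phi.measurable phi_nonneg

/-- `v` is a nonnegative locally absolutely continuous function with derivative `w`, normalized and
centered in `L²` of the Gaussian, with second moment `m`. -/
structure IsProfile (m : ℝ) (v w : ℝ → ℝ) : Prop where
  primitive : IsPrimitive v w
  nonneg : ∀ x, 0 ≤ v x
  memLp : MemLp v 2 gauss
  memLp_deriv : MemLp w 2 gauss
  memLp_mul : MemLp (fun x => x * v x) 2 gauss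
  normalized : ∫ x, v x ^ 2 ∂gauss = 1
  centered : ∫ x, x * v x ^ 2 ∂gauss = 0
  moment : ∫ x, x ^ 2 * v x ^ 2 ∂gauss = m

/-- The log-Sobolev deficit of the density `v ^ 2`. -/
noncomputable def profileDeficit (v w : ℝ → ℝ) : ℝ :=
  2 * (∫ x, w x ^ 2 ∂gauss) - ∫ x, v x ^ 2 * Real.log (v x ^ 2) ∂gauss

/-- The Lebesgue density of the measure with Gaussian density `v ^ 2`. -/
noncomputable def profileDensity (v : ℝ → ℝ) (x : ℝ) : ℝ := v x ^ 2 * phi x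

/-- The derivative of `profileDensity v` when `w` is the derivative of `v`. -/
noncomputable def profileDensityDeriv (v w : ℝ → ℝ) (x : ℝ) : ℝ :=
  (2 * (w x * v x) - (x * v x) * v x) * phi x

namespace IsProfile

variable {m : ℝ} {v w : ℝ → ℝ} (H : IsProfile m v w)
include H

theorem density : IsContDensity (profileDensity v) where
  continuous := (H.primitive.continuous.pow 2).mul continuous_phi
  nonneg x := mul_nonneg (sq_nonneg _) (phi_nonneg x)
  integrable := integrable_gauss.1 H.memLp.integrable_sq
  integral_eq_one := by rw [← H.normalized, integral_gauss]; rfl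

theorem integrable_deriv_mul : Integrable (fun x => w x * v x) gauss :=
  H.memLp.integrable_mul H.memLp_deriv |>.congr (Eventually.of_forall fun _ => mul_comm _ _)

theorem integrable_mul_sq : Integrable (fun x => (x * v x) * v x) gauss :=
  H.memLp_mul.integrable_mul H.memLp

theorem integrable_sq_mul_sq : Integrable (fun x => x ^ 2 * v x ^ 2) gauss :=
  H.memLp_mul.integrable_sq.congr (Eventually.of_forall fun _ => mul_pow _ _ _)

theorem integrable_mul_deriv_mul : Integrable (fun x => (x * v x) * w x) gauss :=
  H.memLp_mul.integrable_mul H.memLp_deriv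

theorem density_primitive : IsPrimitive (profileDensity v) (profileDensityDeriv v w) := by
  convert! (H.primitive.mul H.primitive).mul isPrimitive_phi using 1
  · ext x; simp only [profileDensity]; ring
  · ext x; simp only [profileDensityDeriv]; ring

theorem integrable_densityDeriv : Integrable (profileDensityDeriv v w) :=
  integrable_gauss.1 ((H.integrable_deriv_mul.const_mul 2).sub H.integrable_mul_sq)

theorem density_le (x : ℝ) : profileDensity v x ≤ ∫ t, |profileDensityDeriv v w t| := by
  rw [(tendsto_of_isPrimitive_of_integrable H.density_primitive H.density.integrable
    H.integrable_densityDeriv).2.2.1 x]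
  exact (setIntegral_mono H.integrable_densityDeriv.integrableOn
    H.integrable_densityDeriv.abs.integrableOn fun t => le_abs_self _).trans
    (setIntegral_le_integral H.integrable_densityDeriv.abs
      (Eventually.of_forall fun t => abs_nonneg _))

/-- From below, `t log t ≥ -1`. From above, `log v² = log p - log φ`, where `p` is bounded by the
`L¹` norm of its derivative and `-log φ` is quadratic, so the finite second moment suffices. -/
theorem entropy_integrable : Integrable (fun x => v x ^ 2 * Real.log (v x ^ 2)) gauss := by
  set B := ∫ t, |profileDensityDeriv v w t|
  have hB : 0 ≤ B := integral_nonneg fun t => abs_nonneg _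
  set C := B + Real.log (2 * Real.pi) / 2
  have hC : 0 ≤ Real.log (2 * Real.pi) := Real.log_nonneg (by linarith [Real.pi_gt_three])
  have hi : Integrable (fun x => 1 + (C * v x ^ 2 + (1 / 2) * (x ^ 2 * v x ^ 2))) gauss :=
    (integrable_const 1).add ((H.memLp.integrable_sq.const_mul C).add
      (H.integrable_sq_mul_sq.const_mul _))
  have hm : Measurable v := H.primitive.continuous.measurable
  refine hi.mono' (by fun_prop) (Eventually.of_forall fun x => ?_)
  have hv2 := sq_nonneg (v x)
  rw [Real.norm_eq_abs, abs_le]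
  have hC0 : 0 ≤ C := by positivity
  constructor
  · have h1 : -1 ≤ v x ^ 2 * Real.log (v x ^ 2) := by
      rcases hv2.eq_or_lt with h | h
      · simp [← h]
      · have := Real.one_sub_inv_le_log_of_pos h
        have h2 := mul_le_mul_of_nonneg_left this h.le
        rw [mul_sub, mul_inv_cancel₀ h.ne'] at h2
        linarith
    have h2 : 0 ≤ C * v x ^ 2 + (1 / 2) * (x ^ 2 * v x ^ 2) := by positivity
    linarith
  · rcases hv2.eq_or_lt with h | h
    · simp [← h]
    · have h1 : Real.log (v x ^ 2) = Real.log (profileDensity v x) - Real.log (phi x) := by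
        rw [profileDensity, Real.log_mul h.ne' (phi_pos x).ne']; ring
      have h2 : Real.log (profileDensity v x) ≤ B :=
        (Real.log_le_sub_one_of_pos (mul_pos h (phi_pos x))).trans
          (by
            have := H.density_le x
            rw [profileDensity] at this
            linarith)
      rw [h1, log_phi]
      have := mul_le_mul_of_nonneg_left h2 hv2
      simp only [C]
      nlinarith

omit H in
theorem density_mul_log (x : ℝ) : profileDensity v x * Real.log (profileDensity v x)
    = (v x ^ 2 * Real.log (v x ^ 2) - (Real.log (2 * Real.pi) / 2) * v x ^ 2
      - (1 / 2) * (x ^ 2 * v x ^ 2)) * phi x := by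
  rcases (sq_nonneg (v x)).eq_or_lt with h | h
  · simp [profileDensity, ← h]
  · rw [profileDensity, Real.log_mul h.ne' (phi_pos x).ne', log_phi]; ring

theorem integrable_density_mul_log :
    Integrable fun x => profileDensity v x * Real.log (profileDensity v x) := by
  simp_rw [density_mul_log]
  exact integrable_gauss.1 ((H.entropy_integrable.sub (H.memLp.integrable_sq.const_mul _)).sub
    (H.integrable_sq_mul_sq.const_mul _))

theorem memLp_transport_mul :
    MemLp (fun x => transport (profileDensity v) x * v x) 2 gauss := by
  have hm : AEStronglyMeasurable (fun x => transport (profileDensity v) x * v x) gauss :=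
    (H.density.measurable_transport.mul
      H.primitive.continuous.measurable).aestronglyMeasurable
  rw [memLp_two_iff_integrable_sq hm, integrable_gauss]
  refine H.density.integrable_transport_sq.congr (Eventually.of_forall fun x => ?_)
  simp only [profileDensity]; ring

/-- The error in the Euler–Lagrange equation of the transport. -/
theorem memLp_error :
    MemLp (fun x => 2 * w x + (transport (profileDensity v) x * v x - x * v x)) 2 gauss :=
  (H.memLp_deriv.const_mul 2).add (H.memLp_transport_mul.sub H.memLp_mul)

/-- The integral of `(x p)' = p + x q` over the line is zero. -/
theorem integral_mul_deriv : 2 * (∫ x, (x * v x) * w x ∂gauss) = m - 1 := by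
  have h1 : IsPrimitive (fun x => x * profileDensity v x)
      (fun x => 1 * profileDensity v x + x * profileDensityDeriv v w x) :=
    (IsPrimitive.of_hasDerivAt (v := fun x => x) (w := fun _ => 1) hasDerivAt_id'
      continuous_const).mul H.density_primitive
  have i1 : Integrable fun x => x * profileDensity v x := by
    refine (integrable_gauss.1 H.integrable_mul_sq).congr (Eventually.of_forall fun x => ?_)
    simp only [profileDensity]; ring
  have i3 : Integrable (fun x => 2 * ((x * v x) * w x) - x ^ 2 * v x ^ 2) gauss :=
    (H.integrable_mul_deriv_mul.const_mul 2).sub H.integrable_sq_mul_sq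
  have i2 : Integrable (fun x => v x ^ 2 + (2 * ((x * v x) * w x) - x ^ 2 * v x ^ 2)) gauss :=
    H.memLp.integrable_sq.add i3
  have e : (fun x => 1 * profileDensity v x + x * profileDensityDeriv v w x)
      = fun x => (v x ^ 2 + (2 * ((x * v x) * w x) - x ^ 2 * v x ^ 2)) * phi x := by
    ext x; simp only [profileDensity, profileDensityDeriv]; ring
  rw [e] at h1
  have h2 := (tendsto_of_isPrimitive_of_integrable h1 i1 (integrable_gauss.1 i2)).2.2.2
  rw [← integral_gauss, integral_add H.memLp.integrable_sq i3,
    integral_sub (H.integrable_mul_deriv_mul.const_mul 2) H.integrable_sq_mul_sq,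
    integral_const_mul, H.normalized, H.moment] at h2
  linarith

/-- The transport form of the log-Sobolev inequality with remainder. -/
theorem integral_error_sq_le :
    ∫ x, (2 * w x + (transport (profileDensity v) x * v x - x * v x)) ^ 2 ∂gauss ≤
      2 * profileDeficit v w := by
  set T := transport (profileDensity v) with hT
  have iw := H.memLp_deriv.integrable_sq
  have iTv := H.memLp_transport_mul
  have iT2 : Integrable (fun x => (T x * v x) ^ 2) gauss := iTv.integrable_sq
  have ix2 := H.memLp_mul.integrable_sq
  have iwT : Integrable (fun x => w x * (T x * v x)) gauss := H.memLp_deriv.integrable_mul iTv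
  have iwx : Integrable (fun x => w x * (x * v x)) gauss :=
    H.memLp_deriv.integrable_mul H.memLp_mul
  have iTx : Integrable (fun x => (T x * v x) * (x * v x)) gauss := iTv.integrable_mul H.memLp_mul
  have hT2 : ∫ x, (T x * v x) ^ 2 ∂gauss = 1 := by
    rw [integral_gauss, ← H.density.integral_transport_sq]
    congr 1 with x
    simp only [profileDensity]; ring
  have hx2 : ∫ x, (x * v x) ^ 2 ∂gauss = m := by
    rw [← H.moment]; simp_rw [mul_pow]
  have hwx : 2 * ∫ x, w x * (x * v x) ∂gauss = m - 1 := by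
    rw [← H.integral_mul_deriv]; simp_rw [mul_comm]
  have hexp : ∫ x, (2 * w x + (T x * v x - x * v x)) ^ 2 ∂gauss
      = 4 * (∫ x, w x ^ 2 ∂gauss) + 4 * (∫ x, w x * (T x * v x) ∂gauss)
        - 4 * (∫ x, w x * (x * v x) ∂gauss) + (∫ x, (T x * v x) ^ 2 ∂gauss)
        - 2 * (∫ x, (T x * v x) * (x * v x) ∂gauss) + ∫ x, (x * v x) ^ 2 ∂gauss := by
    have e : ∀ x, (2 * w x + (T x * v x - x * v x)) ^ 2
        = 4 * w x ^ 2 + 4 * (w x * (T x * v x)) - 4 * (w x * (x * v x)) + (T x * v x) ^ 2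
          - 2 * ((T x * v x) * (x * v x)) + (x * v x) ^ 2 := fun x => by ring
    have j1 := iw.const_mul 4
    have j2 := iwT.const_mul 4
    have j3 := iwx.const_mul 4
    have j5 := iTx.const_mul 2
    simp_rw [e]
    rw [integral_add (by exact (((j1.add j2).sub j3).add iT2).sub j5) ix2,
      integral_sub (by exact ((j1.add j2).sub j3).add iT2) j5,
      integral_add (by exact (j1.add j2).sub j3) iT2,
      integral_sub (by exact j1.add j2) j3, integral_add j1 j2]
    simp only [integral_const_mul]
  have iqT : Integrable fun x => profileDensityDeriv v w x * T x := by
    refine (integrable_gauss.1 ((iwT.const_mul 2).sub iTx)).congr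
      (Eventually.of_forall fun x => ?_)
    simp only [profileDensityDeriv, Pi.sub_apply]; ring
  have hqT : ∫ x, profileDensityDeriv v w x * T x
      = 2 * (∫ x, w x * (T x * v x) ∂gauss) - ∫ x, (T x * v x) * (x * v x) ∂gauss := by
    rw [← integral_const_mul, ← integral_sub (iwT.const_mul 2) iTx, integral_gauss]
    congr 1 with x
    simp only [profileDensityDeriv]; ring
  have hlog : ∫ x, profileDensity v x * Real.log (profileDensity v x)
      = (∫ x, v x ^ 2 * Real.log (v x ^ 2) ∂gauss) - Real.log (2 * Real.pi) / 2 - (1 / 2) * m := by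
    simp_rw [density_mul_log]
    have k1 : Integrable (fun x => v x ^ 2 * Real.log (v x ^ 2)
        - Real.log (2 * Real.pi) / 2 * v x ^ 2) gauss :=
      H.entropy_integrable.sub (H.memLp.integrable_sq.const_mul _)
    rw [← integral_gauss, integral_sub k1 (H.integrable_sq_mul_sq.const_mul _),
      integral_sub H.entropy_integrable (H.memLp.integrable_sq.const_mul _), integral_const_mul,
      integral_const_mul, H.normalized, H.moment]
    ring
  -- Twice the term `∫ q T` of this inequality is the part `4 ∫ w T v - 2 ∫ x T v²` of the expanded
  -- square. The terms `log(2π)` cancel, and the second moments `1` and `m` of `T` and `x` match the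
  -- remaining constants.
  have key := H.density.integral_mul_log_le H.density_primitive H.integrable_densityDeriv iqT
    H.integrable_density_mul_log
  rw [hlog] at key
  change _ + (∫ x, profileDensityDeriv v w x * T x) + _ ≤ 0 at key
  rw [hqT] at key
  rw [hexp, hT2, hx2, profileDeficit]
  linarith

/-- The Gaussian log-Sobolev inequality for the density `v ^ 2`. -/
theorem deficit_nonneg : 0 ≤ profileDeficit v w := by
  have := H.integral_error_sq_le
  have h2 : 0 ≤ ∫ x, (2 * w x + (transport (profileDensity v) x * v x - x * v x)) ^ 2 ∂gauss :=
    integral_nonneg fun x => sq_nonneg _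
  linarith

/-- As `v ≥ 0`, `√p = v √φ`; factoring it out of `q + T p` leaves the error function times `√φ`,
whose Lebesgue `L²` norm is the Gaussian one of the error. -/
theorem isNearGaussian {h : ℝ} (hh : 0 < h) (hd : 2 * profileDeficit v w ≤ h ^ 2) :
    IsNearGaussian (profileDensity v) (profileDensityDeriv v w)
      (fun x => (2 * w x + (transport (profileDensity v) x * v x - x * v x)) * √(phi x)) h where
  density := H.density
  primitive := H.density_primitive
  integrable := H.integrable_densityDeriv
  pos := hh
  memLp := by
    have h1 : AEStronglyMeasurable w volume := H.primitive.locallyIntegrable.aestronglyMeasurable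
    have h2 : Measurable (transport (profileDensity v)) := H.density.measurable_transport
    have h3 : Measurable v := H.primitive.continuous.measurable
    rw [memLp_two_iff_integrable_sq]
    · simp_rw [mul_pow, Real.sq_sqrt (phi_nonneg _)]
      exact integrable_gauss.1 H.memLp_error.integrable_sq
    · exact ((h1.const_mul 2).add ((h2.mul h3).sub
        (measurable_id.mul h3)).aestronglyMeasurable).mul
        continuous_phi.sqrt.aestronglyMeasurable
  integral_sq_le := by
    simp_rw [mul_pow, Real.sq_sqrt (phi_nonneg _)]
    rw [← integral_gauss]
    exact H.integral_error_sq_le.trans hd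
  defect_eq x := by
    have e : √(profileDensity v x) = v x * √(phi x) := by
      rw [profileDensity, Real.sqrt_mul (sq_nonneg _), Real.sqrt_sq (H.nonneg x)]
    have e2 : √(phi x) * √(phi x) = phi x := Real.mul_self_sqrt (phi_nonneg x)
    rw [e, profileDensityDeriv, profileDensity]
    linear_combination (-(2 * w x + (transport (profileDensity v) x * v x - x * v x)) * v x) * e2

theorem integrable_sq_density : Integrable (fun x => x ^ 2) (densityMeasure (profileDensity v)) := by
  rw [integrable_densityMeasure H.density.continuous.measurable H.density.nonneg]
  refine (integrable_gauss.1 H.integrable_sq_mul_sq).congr (Eventually.of_forall fun x => ?_)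
  simp only [profileDensity]; ring

theorem integral_sq_density : ∫ x, x ^ 2 ∂densityMeasure (profileDensity v) = m := by
  rw [integral_densityMeasure H.density.continuous.measurable H.density.nonneg, ← H.moment,
    integral_gauss]
  congr 1 with x
  simp only [profileDensity]; ring

theorem moment_nonneg : 0 ≤ m := H.moment ▸ integral_nonneg fun x => by positivity

/-- Write `2w` as the error minus `(T - x) v`: the error is controlled by the deficit, the other
term by the second moments of `T` and `x`. The deficit thus controls the Fisher information. -/
theorem integral_deriv_sq_le : ∫ x, w x ^ 2 ∂gauss ≤ profileDeficit v w + (1 + m) := by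
  set T := transport (profileDensity v) with hT
  have i1 := H.memLp_error.integrable_sq
  have i2 : Integrable (fun x => (T x * v x) ^ 2) gauss := H.memLp_transport_mul.integrable_sq
  have i3 := H.memLp_mul.integrable_sq
  have i4 : Integrable (fun x => (T x * v x) ^ 2 + (x * v x) ^ 2) gauss := i2.add i3
  have h1 := H.integral_error_sq_le
  have hT2 : ∫ x, (T x * v x) ^ 2 ∂gauss = 1 := by
    rw [integral_gauss, ← H.density.integral_transport_sq]
    congr 1 with x
    simp only [profileDensity]; ring
  have hx2 : ∫ x, (x * v x) ^ 2 ∂gauss = m := by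
    rw [← H.moment]; simp_rw [mul_pow]
  have h4 : ∫ x, w x ^ 2 ∂gauss ≤ ∫ x, ((1 / 2) * (2 * w x + (T x * v x - x * v x)) ^ 2 +
      ((T x * v x) ^ 2 + (x * v x) ^ 2)) ∂gauss := by
    refine integral_mono H.memLp_deriv.integrable_sq ((i1.const_mul _).add (i2.add i3)) fun x => ?_
    have a1 := sq_nonneg (2 * w x + 2 * (T x * v x - x * v x))
    have a2 := sq_nonneg (T x * v x + x * v x)
    simp only
    nlinarith
  rw [integral_add (i1.const_mul _) i4, integral_const_mul] at h4
  have h5 : ∫ x, ((T x * v x) ^ 2 + (x * v x) ^ 2) ∂gauss = 1 + m := by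
    rw [integral_add i2 i3, hT2, hx2]
  linarith

/-- Smallness of the Gaussian gradient of the density `v ^ 2` in `L¹`. -/
theorem integral_abs_deriv_le {h : ℝ} (hh : 0 < h) (hh' : h ≤ 1 / 16)
    (hd : 2 * profileDeficit v w ≤ h ^ 2) :
    ∫ x, |2 * (w x * v x)| ∂gauss ≤ (1 + 3 * (bulkConst + tailConst m)) * h := by
  have N := H.isNearGaussian hh hd
  set p := profileDensity v with hp
  set T := transport p with hT
  have h1 := N.integral_abs_transport_sub_le H.integrable_sq_density (by
    rw [integral_densityMeasure H.density.continuous.measurable H.density.nonneg, ← H.centered,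
      integral_gauss]
    congr 1 with x
    simp only [profileDensity]; ring) hh'
  rw [H.integral_sq_density] at h1
  have h2 := N.integral_abs_defect_le
  rw [integral_densityMeasure H.density.continuous.measurable H.density.nonneg] at h1
  have i1 : Integrable fun x => |profileDensityDeriv v w x + T x * p x| :=
    (H.integrable_densityDeriv.add H.density.integrable_transport_mul).abs
  have i2 : Integrable fun x => |T x - x| * p x := by
    have : Integrable (fun x => ((T x * v x) - (x * v x)) * v x) gauss :=
      (H.memLp_transport_mul.sub H.memLp_mul).integrable_mul H.memLp
    refine (integrable_gauss.1 this).abs.congr (Eventually.of_forall fun x => ?_)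
    simp only [hp, profileDensity]
    rw [← abs_of_nonneg (mul_nonneg (sq_nonneg (v x)) (phi_nonneg x)), ← abs_mul]
    ring_nf
  rw [integral_gauss]
  -- The integrand is `|q + x p|`, split as `(q + T p) - (T - x) p`.
  calc ∫ x, |2 * (w x * v x)| * phi x
      ≤ ∫ x, (|profileDensityDeriv v w x + T x * p x| + |T x - x| * p x) := by
        refine integral_mono (integrable_gauss.1 (H.integrable_deriv_mul.const_mul 2).abs)
          (i1.add i2) fun x => ?_
        simp only
        have e1 : |2 * (w x * v x)| * phi x = |2 * (w x * v x) * phi x| := by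
          rw [abs_mul _ (phi x), abs_of_nonneg (phi_nonneg x)]
        have e2 : |T x - x| * p x = |(T x - x) * p x| := by
          rw [abs_mul _ (p x), abs_of_nonneg (H.density.nonneg x)]
        rw [e1, e2]
        refine le_trans (le_of_eq ?_) (abs_sub _ _)
        simp only [hp, profileDensityDeriv, profileDensity]
        ring_nf
    _ ≤ h + 3 * (bulkConst + tailConst m) * h := by
        rw [integral_add i1 i2]
        exact add_le_add h2 h1
    _ = _ := by ring

end IsProfile

/-! ### The Gaussian `L¹` Poincaré inequality -/

theorem exp_eq_sqrt_mul_phi (t : ℝ) : Real.exp (-t ^ 2 / 2) = √(2 * Real.pi) * phi t := by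
  rw [phi, ← mul_assoc, mul_inv_cancel₀ sqrt_two_pi_pos.ne', one_mul]

theorem isPrimitive_cumul_phi (c : ℝ) : IsPrimitive (fun x => cumul phi x - c) phi :=
  IsPrimitive.of_hasDerivAt
    (fun x => (hasDerivAt_cumul continuous_phi integrable_phi x).sub_const c) continuous_phi

/-- The `L¹` Poincaré inequality for the Gaussian on the line, centered at the median. -/
theorem integral_abs_sub_median_le {f g : ℝ → ℝ} (hfg : IsPrimitive f g)
    (hf : Integrable f gauss) (hg : Integrable g gauss) :
    ∫ x, |f x - f 0| ∂gauss ≤ √(2 * Real.pi) * ∫ x, |g x| ∂gauss := by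
  -- The primitive of `|g|` from the median dominates `|f - f 0|` in absolute value and has constant
  -- sign on each side of `0`.
  let A : ℝ → ℝ := fun x => ∫ t in (0 : ℝ)..x, |g t|
  have hgl : LocallyIntegrable (fun t => |g t|) volume :=
    hfg.locallyIntegrable.mono hfg.locallyIntegrable.aestronglyMeasurable.norm
      (Eventually.of_forall fun x => by simp)
  have hA : IsPrimitive A (fun t => |g t|) := ⟨hgl, fun a b => by
    simp only [A]
    rw [intervalIntegral.integral_interval_sub_left] <;> exact hgl.intervalIntegrable' _ _⟩
  have hA0 : A 0 = 0 := intervalIntegral.integral_same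
  have hAf : ∀ x, |f x - f 0| ≤ |A x| := fun x => by
    rw [← hfg.integral_eq]
    simpa [A] using intervalIntegral.norm_integral_le_abs_integral_norm (f := g) (a := 0) (b := x)
      (μ := volume)
  have hA_nonneg : ∀ x, 0 ≤ x → 0 ≤ A x := fun x hx =>
    intervalIntegral.integral_nonneg hx fun t _ => abs_nonneg _
  have hA_nonpos : ∀ x, x ≤ 0 → A x ≤ 0 := fun x hx => by
    simp only [A]
    rw [intervalIntegral.integral_symm]
    exact neg_nonpos.2 (intervalIntegral.integral_nonneg hx fun t _ => abs_nonneg _)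
  have hgφ : Integrable fun t => |g t| * phi t := integrable_gauss.1 hg.abs
  have hfφ : Integrable fun x => |f x - f 0| * phi x :=
    integrable_gauss.1 (hf.sub (integrable_const _)).abs
  have hAc := hA.continuous
  have hfc : Continuous fun x => |f x - f 0| * phi x :=
    (hfg.continuous.sub continuous_const).abs.mul continuous_phi
  have hgi : ∀ (k : ℝ → ℝ), Continuous k → ∀ a b,
      IntervalIntegrable (fun t => |g t| * k t) volume a b := fun k hk a b =>
    (hgl.intervalIntegrable' a b).mul_continuousOn hk.continuousOn
  have hcφ : Continuous (cumul phi) := continuous_cumul continuous_phi integrable_phi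
  have hAφ : ∀ a b, IntervalIntegrable (fun t => A t * phi t) volume a b := fun a b =>
    (hAc.mul continuous_phi).intervalIntegrable a b
  -- Integrating `A φ` by parts with the antiderivative `cumul phi - 1` on the right and `cumul phi`
  -- on the left makes the boundary terms favorable. Both are Gaussian tails, at most `√(2π) φ` in
  -- absolute value.
  have key : ∀ N : ℝ, 0 ≤ N → ∫ x in -N..N, |f x - f 0| * phi x ≤
      √(2 * Real.pi) * ∫ x in -N..N, |g x| * phi x := by
    intro N hN
    have right : ∫ x in (0 : ℝ)..N, |f x - f 0| * phi x ≤
        √(2 * Real.pi) * ∫ x in (0 : ℝ)..N, |g x| * phi x := by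
      have h1 := (hA.mul (isPrimitive_cumul_phi 1)).integral_eq 0 N
      rw [hA0, zero_mul, sub_zero, intervalIntegral.integral_add
        (hgi (fun x => cumul phi x - 1) (hcφ.sub continuous_const) _ _) (hAφ _ _)] at h1
      have h2 : A N * (cumul phi N - 1) ≤ 0 :=
        mul_nonpos_of_nonneg_of_nonpos (hA_nonneg N hN) (by linarith [cumul_phi_lt_one N])
      have h3 : ∫ x in (0 : ℝ)..N, |f x - f 0| * phi x ≤ ∫ x in (0 : ℝ)..N, A x * phi x :=
        intervalIntegral.integral_mono_on hN (hfc.intervalIntegrable _ _) (hAφ _ _) fun x hx =>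
          mul_le_mul_of_nonneg_right ((hAf x).trans_eq (abs_of_nonneg (hA_nonneg x hx.1)))
            (phi_nonneg x)
      have h4 : ∫ x in (0 : ℝ)..N, -(√(2 * Real.pi) * (|g x| * phi x)) ≤
          ∫ x in (0 : ℝ)..N, |g x| * (cumul phi x - 1) :=
        intervalIntegral.integral_mono_on hN ((hgi _ continuous_phi _ _).const_mul _).neg
          (hgi (fun x => cumul phi x - 1) (hcφ.sub continuous_const) _ _) fun x hx => by
            have := integral_Ioi_phi_le hx.1
            rw [← one_sub_cumul_phi, exp_eq_sqrt_mul_phi] at this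
            nlinarith [abs_nonneg (g x)]
      rw [intervalIntegral.integral_neg, intervalIntegral.integral_const_mul] at h4
      linarith
    have left : ∫ x in -N..0, |f x - f 0| * phi x ≤
        √(2 * Real.pi) * ∫ x in -N..0, |g x| * phi x := by
      have h1 := (hA.mul (isPrimitive_cumul_phi 0)).integral_eq (-N) 0
      simp only [sub_zero] at h1
      rw [hA0, zero_mul, zero_sub, intervalIntegral.integral_add
        (hgi _ hcφ _ _) (hAφ _ _)] at h1
      have h2 : 0 ≤ -(A (-N) * cumul phi (-N)) := neg_nonneg.2
        (mul_nonpos_of_nonpos_of_nonneg (hA_nonpos _ (by linarith)) (cumul_phi_pos _).le)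
      have h3 : ∫ x in -N..0, |f x - f 0| * phi x ≤ ∫ x in -N..0, -(A x * phi x) :=
        intervalIntegral.integral_mono_on (by linarith) (hfc.intervalIntegrable _ _)
          (hAφ _ _).neg fun x hx => by
          rw [← neg_mul]
          exact mul_le_mul_of_nonneg_right ((hAf x).trans_eq (abs_of_nonpos (hA_nonpos x hx.2)))
            (phi_nonneg x)
      have h4 : ∫ x in -N..0, |g x| * cumul phi x ≤
          ∫ x in -N..0, √(2 * Real.pi) * (|g x| * phi x) :=
        intervalIntegral.integral_mono_on (by linarith) (hgi _ hcφ _ _)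
          ((hgi _ continuous_phi _ _).const_mul _) fun x hx => by
            have := cumul_phi_le hx.2
            rw [exp_eq_sqrt_mul_phi] at this
            nlinarith [abs_nonneg (g x)]
      rw [intervalIntegral.integral_neg] at h3
      rw [intervalIntegral.integral_const_mul] at h4
      linarith
    rw [← intervalIntegral.integral_add_adjacent_intervals (hfc.intervalIntegrable (-N) 0)
      (hfc.intervalIntegrable 0 N), ← intervalIntegral.integral_add_adjacent_intervals
      (hgi _ continuous_phi (-N) 0) (hgi _ continuous_phi 0 N), mul_add]
    exact add_le_add left right
  rw [integral_gauss, integral_gauss]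
  have l1 := intervalIntegral_tendsto_integral hfφ tendsto_neg_atTop_atBot tendsto_id
  have l2 := (intervalIntegral_tendsto_integral hgφ tendsto_neg_atTop_atBot tendsto_id).const_mul
    (√(2 * Real.pi))
  exact le_of_tendsto_of_tendsto l1 l2 ((eventually_ge_atTop 0).mono key)

/-- The `L¹` Poincaré inequality for the Gaussian on the line. -/
theorem integral_abs_sub_integral_le {f g : ℝ → ℝ} (hfg : IsPrimitive f g)
    (hf : Integrable f gauss) (hg : Integrable g gauss) {c : ℝ} (hc : ∫ x, f x ∂gauss = c) :
    ∫ x, |f x - c| ∂gauss ≤ 2 * √(2 * Real.pi) * ∫ x, |g x| ∂gauss := by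
  have h1 := integral_abs_sub_median_le hfg hf hg
  have i0 : Integrable (fun x => f x - f 0) gauss := hf.sub (integrable_const _)
  have h2 : |f 0 - c| ≤ ∫ x, |f x - f 0| ∂gauss := by
    have : c - f 0 = ∫ x, (f x - f 0) ∂gauss := by
      rw [integral_sub hf (integrable_const _), hc]; simp
    rw [abs_sub_comm, this]
    exact abs_integral_le_integral_abs
  have h3 : ∫ x, |f x - c| ∂gauss ≤ ∫ x, (|f x - f 0| + |f 0 - c|) ∂gauss :=
    integral_mono (hf.sub (integrable_const _)).abs (i0.abs.add (integrable_const _))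
      fun x => abs_sub_le _ _ _
  rw [integral_add i0.abs (integrable_const _)] at h3
  simp only [integral_const, probReal_univ, one_smul] at h3
  linarith

/-! ### Stability estimates for profiles -/

theorem tailConst_mono {m α : ℝ} (h : m ≤ α) : tailConst m ≤ tailConst α :=
  mul_le_mul_of_nonneg_left (Real.sqrt_le_sqrt (by linarith)) (Real.sqrt_nonneg _)

namespace IsProfile

variable {m α : ℝ} {v w : ℝ → ℝ} (H : IsProfile m v w)
include H

theorem sq_primitive : IsPrimitive (fun x => v x ^ 2) (fun x => 2 * (w x * v x)) := by
  convert! H.primitive.mul H.primitive using 1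
  · ext x; ring
  · ext x; ring

theorem integrable_sq_sub_one : Integrable (fun x => v x ^ 2 - 1) gauss :=
  H.memLp.integrable_sq.sub (integrable_const _)

/-- The transport estimate needs `h > 0`; letting `h` decrease to `√(2δ)` also covers the equality
case `δ = 0`. -/
theorem integral_abs_deriv_le_sqrt (hm : m ≤ α) (hd : 2 * profileDeficit v w < (1 / 16) ^ 2) :
    ∫ x, |2 * (w x * v x)| ∂gauss ≤
      (1 + 3 * (bulkConst + tailConst α)) * √(2 * profileDeficit v w) := by
  set C := 1 + 3 * (bulkConst + tailConst α) with hC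
  have hC0 : 0 < C := by
    have h1 := bulkConst_nonneg
    have h2 : 0 ≤ tailConst α := by unfold tailConst; positivity
    positivity
  set s := √(2 * profileDeficit v w) with hs
  have hs2 : s ^ 2 = 2 * profileDeficit v w :=
    Real.sq_sqrt (mul_nonneg zero_le_two H.deficit_nonneg)
  have hs0 : 0 ≤ s := Real.sqrt_nonneg _
  have hs1 : s < 1 / 16 := by
    rw [← hs2] at hd
    exact lt_of_pow_lt_pow_left₀ 2 (by norm_num) hd
  have hlim : Tendsto (fun t => C * t) (𝓝[>] s) (𝓝 (C * s)) :=
    ((continuous_const.mul continuous_id).tendsto s).mono_left nhdsWithin_le_nhds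
  refine ge_of_tendsto hlim ?_
  filter_upwards [Ioo_mem_nhdsGT hs1] with t ht
  refine (H.integral_abs_deriv_le (hs0.trans_lt ht.1) ht.2.le (by
    rw [← hs2]; exact pow_le_pow_left₀ hs0 ht.1.le 2)).trans ?_
  exact mul_le_mul_of_nonneg_right (by rw [hC]; linarith [tailConst_mono hm])
    (hs0.trans ht.1.le)

theorem integral_abs_sq_sub_one_le :
    ∫ x, |v x ^ 2 - 1| ∂gauss ≤ 2 * √(2 * Real.pi) * ∫ x, |2 * (w x * v x)| ∂gauss :=
  integral_abs_sub_integral_le H.sq_primitive H.memLp.integrable_sq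
    (H.integrable_deriv_mul.const_mul 2) H.normalized

theorem integral_abs_sq_sub_one_le_two : ∫ x, |v x ^ 2 - 1| ∂gauss ≤ 2 := by
  have h : ∫ x, |v x ^ 2 - 1| ∂gauss ≤ ∫ x, (v x ^ 2 + 1) ∂gauss :=
    integral_mono H.integrable_sq_sub_one.abs
      (H.memLp.integrable_sq.add (integrable_const _)) fun x => by
        simp only
        rw [abs_le]
        constructor <;> nlinarith [sq_nonneg (v x)]
  rw [integral_add H.memLp.integrable_sq (integrable_const _), H.normalized] at h
  simp at h
  linarith

/-- Pointwise, `|v² - 1| = |v - 1| (v + 1)` and `v + 1 ≥ 1`. -/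
theorem integral_abs_sub_one_le : ∫ x, |v x - 1| ∂gauss ≤ ∫ x, |v x ^ 2 - 1| ∂gauss := by
  refine integral_mono ((H.memLp.integrable one_le_two).sub (integrable_const _)).abs
    H.integrable_sq_sub_one.abs fun x => ?_
  have e : v x ^ 2 - 1 = (v x - 1) * (v x + 1) := by ring
  have h := H.nonneg x
  simp only
  rw [e, abs_mul, abs_of_nonneg (by linarith : 0 ≤ v x + 1)]
  nlinarith [abs_nonneg (v x - 1)]

theorem integral_abs_deriv_mul_le :
    ∫ x, |2 * (w x * v x)| ∂gauss ≤ 2 * √(∫ x, w x ^ 2 ∂gauss) := by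
  have := integral_abs_mul_le H.memLp_deriv H.memLp
  rw [H.normalized, Real.sqrt_one, mul_one] at this
  simp_rw [abs_mul (2 : ℝ), abs_two]
  rw [integral_const_mul]
  linarith

theorem integral_abs_deriv_le_norm : ∫ x, |w x| ∂gauss ≤ √(∫ x, w x ^ 2 ∂gauss) := by
  have := integral_abs_mul_le H.memLp_deriv (memLp_const (1 : ℝ))
  simpa using this

/-- Away from the set where `v` is small the gradient of `v` is controlled by that of `v ^ 2`. -/
theorem integral_abs_le_add : ∫ x, |w x| ∂gauss ≤ (∫ x, |2 * (w x * v x)| ∂gauss) +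
    √(2 * ∫ x, |v x ^ 2 - 1| ∂gauss) * √(∫ x, w x ^ 2 ∂gauss) := by
  let S : Set ℝ := {x | v x < 1 / 2}
  have hS : MeasurableSet S := measurableSet_lt H.primitive.continuous.measurable measurable_const
  have hw := H.memLp_deriv.integrable one_le_two
  have i2 := (H.integrable_deriv_mul.const_mul 2).abs
  have h1 : ∫ x in Sᶜ, |w x| ∂gauss ≤ ∫ x, |2 * (w x * v x)| ∂gauss := by
    refine (setIntegral_mono_on hw.abs.integrableOn i2.integrableOn hS.compl fun x hx => ?_).trans
      (setIntegral_le_integral i2 (Eventually.of_forall fun x => abs_nonneg _))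
    have hx' : 1 / 2 ≤ v x := not_lt.1 hx
    rw [abs_mul, abs_mul, abs_two, abs_of_nonneg (H.nonneg x)]
    nlinarith [abs_nonneg (w x)]
  -- On `S` one has `v² < 1 / 4`, hence `2 |v² - 1| ≥ 1`: this is Markov's inequality.
  have h2 : gauss.real S ≤ 2 * ∫ x, |v x ^ 2 - 1| ∂gauss := by
    rw [← integral_const_mul]
    calc gauss.real S = ∫ _ in S, (1 : ℝ) ∂gauss := by simp
      _ ≤ ∫ x in S, 2 * |v x ^ 2 - 1| ∂gauss := by
        refine setIntegral_mono_on (integrable_const _)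
          (H.integrable_sq_sub_one.abs.const_mul 2).integrableOn hS fun x hx => ?_
        have hx' : v x < 1 / 2 := hx
        have := H.nonneg x
        have := neg_le_abs (v x ^ 2 - 1)
        nlinarith
      _ ≤ _ := setIntegral_le_integral (H.integrable_sq_sub_one.abs.const_mul 2)
        (Eventually.of_forall fun x => by simp only [Pi.zero_apply]; positivity)
  have h3 : ∫ x in S, |w x| ∂gauss ≤
      √(2 * ∫ x, |v x ^ 2 - 1| ∂gauss) * √(∫ x, w x ^ 2 ∂gauss) := by
    have h4 := integral_abs_mul_le (μ := gauss.restrict S) (memLp_const (1 : ℝ))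
      (H.memLp_deriv.restrict S)
    simp only [one_mul, one_pow, integral_const, smul_eq_mul, mul_one,
      measureReal_restrict_apply_univ] at h4
    refine h4.trans (mul_le_mul (Real.sqrt_le_sqrt h2) (Real.sqrt_le_sqrt ?_)
      (Real.sqrt_nonneg _) (Real.sqrt_nonneg _))
    exact setIntegral_le_integral H.memLp_deriv.integrable_sq
      (Eventually.of_forall fun x => sq_nonneg _)
  rw [← integral_add_compl hS hw.abs]
  linarith

end IsProfile

/-- The exponent `1 / 2` lies between `1 / 4` and `s`, so one of the two powers dominates according
to whether `x ≤ 1`. -/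
theorem sqrt_le_rpow_add {x s : ℝ} (hx : 0 ≤ x) (hs : 1 / 2 ≤ s) :
    √x ≤ x ^ (1 / 4 : ℝ) + x ^ s := by
  rw [Real.sqrt_eq_rpow]
  have h1 := Real.rpow_nonneg hx (1 / 4)
  have h2 := Real.rpow_nonneg hx s
  rcases hx.eq_or_lt with rfl | hx'
  · rw [Real.zero_rpow (by norm_num)]; positivity
  rcases le_total x 1 with h | h
  · have := Real.rpow_le_rpow_of_exponent_ge hx' h (show (1 / 4 : ℝ) ≤ 1 / 2 by norm_num)
    linarith
  · have := Real.rpow_le_rpow_of_exponent_le h hs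
    linarith

/-- Stability of the log-Sobolev inequality on the line under a second moment bound, for
absolutely continuous profiles. -/
theorem exists_profile_bound (α : ℝ) : ∃ a : ℝ, 0 < a ∧ ∀ (m : ℝ) (v w : ℝ → ℝ), m ≤ α →
    IsProfile m v w →
      (∫ x, |v x ^ 2 - 1| ∂gauss) + ∫ x, |2 * (w x * v x)| ∂gauss ≤
        a * (profileDeficit v w ^ (1 / 4 : ℝ) + profileDeficit v w ^ (3 / 4 : ℝ)) ∧
      (∫ x, |v x - 1| ∂gauss) + ∫ x, |w x| ∂gauss ≤
        a * (profileDeficit v w ^ (1 / 4 : ℝ) + profileDeficit v w) := by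
  set C := 1 + 3 * (bulkConst + tailConst α) with hC
  set κ := 2 * √(2 * Real.pi) with hκ
  have hC0 : 0 < C := by
    have h1 := bulkConst_nonneg
    have h2 : 0 ≤ tailConst α := by unfold tailConst; positivity
    positivity
  have hκ0 : 0 ≤ κ := by positivity
  set β := √(2 + α) with hβ
  have hβ0 : 0 ≤ β := Real.sqrt_nonneg _
  -- The constant `a₁` serves small deficits and `a₂` large ones. If `α < 0` no profile exists, and
  -- `Real.sqrt` keeps the constants nonnegative.
  set a₁ := 2 * ((κ + 1) * C) + 2 * √(κ * C) * β with ha₁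
  set a₂ := 2 + 8 * (2 + 2 * β) with ha₂
  have ha₁0 : 0 ≤ a₁ := by positivity
  refine ⟨a₁ + a₂, by positivity, fun m v w hm H => ?_⟩
  set δ := profileDeficit v w with hδ
  have hδ0 : 0 ≤ δ := H.deficit_nonneg
  set X := ∫ x, |2 * (w x * v x)| ∂gauss with hX
  set Y := ∫ x, |v x ^ 2 - 1| ∂gauss with hY
  have hX0 : 0 ≤ X := integral_nonneg fun x => abs_nonneg _
  have hY0 : 0 ≤ Y := integral_nonneg fun x => abs_nonneg _
  have hYX : Y ≤ κ * X := H.integral_abs_sq_sub_one_le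
  have hY2 : Y ≤ 2 := H.integral_abs_sq_sub_one_le_two
  have hV : ∫ x, |v x - 1| ∂gauss ≤ Y := H.integral_abs_sub_one_le
  have hW := H.integral_deriv_sq_le
  set s := δ ^ (1 / 4 : ℝ) with hs
  have hs0 : 0 ≤ s := Real.rpow_nonneg hδ0 _
  have hss : s ^ 2 = √δ := by
    rw [hs, ← Real.rpow_natCast, ← Real.rpow_mul hδ0, Real.sqrt_eq_rpow]; norm_num
  have ht0 : 0 ≤ δ ^ (3 / 4 : ℝ) := Real.rpow_nonneg hδ0 _
  have ha₂0 : 0 ≤ a₂ := by positivity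
  -- The threshold is the restriction `h ≤ 1 / 16` of the transport estimate, with `h = √(2δ)`.
  by_cases hsmall : 2 * δ < (1 / 16) ^ 2
  · have hXs : X ≤ C * √(2 * δ) := H.integral_abs_deriv_le_sqrt hm hsmall
    have hδ1 : δ ≤ 1 := by norm_num at hsmall; linarith
    have hs1 : s ≤ 1 := Real.rpow_le_one hδ0 hδ1 (by norm_num)
    have h2δ : √(2 * δ) ≤ 2 * s ^ 2 := by
      rw [hss, Real.sqrt_mul zero_le_two]
      refine mul_le_mul_of_nonneg_right ?_ (Real.sqrt_nonneg _)
      exact (Real.sqrt_le_iff.2 ⟨by norm_num, by norm_num⟩)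
    have hX2 : X ≤ C * (2 * s ^ 2) := hXs.trans (mul_le_mul_of_nonneg_left h2δ hC0.le)
    have hXY : Y + X ≤ 2 * ((κ + 1) * C) * s := by
      have h1 : Y + X ≤ (κ + 1) * (C * (2 * s ^ 2)) := by
        have := mul_le_mul_of_nonneg_left hX2 (by positivity : 0 ≤ κ + 1)
        linarith
      have h2 : s ^ 2 ≤ s := by nlinarith
      have h3 := mul_le_mul_of_nonneg_left h2 (by positivity : 0 ≤ 2 * ((κ + 1) * C))
      linarith
    have hsw : √(∫ x, w x ^ 2 ∂gauss) ≤ β := Real.sqrt_le_sqrt (by linarith)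
    have hsY : √(2 * Y) ≤ 2 * √(κ * C) * s := by
      have e : 2 * √(κ * C) * s = √(4 * (κ * C) * s ^ 2) := by
        rw [Real.sqrt_mul (x := 4 * (κ * C)) (by positivity), Real.sqrt_sq hs0,
          Real.sqrt_mul (x := 4) (by norm_num)]
        norm_num
      rw [e]
      refine Real.sqrt_le_sqrt ?_
      have := mul_le_mul_of_nonneg_left hX2 hκ0
      linarith
    have hmain : (Y + X) + √(2 * Y) * √(∫ x, w x ^ 2 ∂gauss) ≤ a₁ * s := by
      refine (add_le_add hXY (mul_le_mul hsY hsw (Real.sqrt_nonneg _) (by positivity))).trans_eq ?_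
      rw [ha₁]; ring
    have hp : 0 ≤ √(2 * Y) * √(∫ x, w x ^ 2 ∂gauss) := by positivity
    have hfin : ∀ t : ℝ, 0 ≤ t → a₁ * s ≤ (a₁ + a₂) * (s + t) := fun t ht =>
      mul_le_mul (by linarith) (by linarith) hs0 (by positivity)
    constructor
    · linarith [hfin _ ht0]
    · linarith [hfin _ hδ0, H.integral_abs_le_add]
  -- Here `δ ≥ 1 / 512 ≥ 8⁻⁴`, so additive constants are absorbed by `8 δ ^ (1/4)`, and only the
  -- growth of `√δ` remains.
  · have hs8 : 1 ≤ 8 * s := by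
      have h1 : (1 / 8 : ℝ) ≤ s := by
        have h2 : ((1 / 8 : ℝ) ^ (4 : ℝ)) ^ (1 / 4 : ℝ) ≤ s := by
          refine Real.rpow_le_rpow (by positivity) ?_ (by norm_num)
          have : (1 / 8 : ℝ) ^ (4 : ℝ) = (1 / 8) ^ (4 : ℕ) := by
            rw [← Real.rpow_natCast]; norm_num
          rw [this]
          norm_num at hsmall ⊢
          linarith
        rwa [← Real.rpow_mul (by norm_num), show (4 : ℝ) * (1 / 4) = 1 by norm_num,
          Real.rpow_one] at h2
      linarith
    have hsw : √(∫ x, w x ^ 2 ∂gauss) ≤ √δ + β := by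
      have h1 := Real.sq_sqrt hδ0
      have h2 : β ^ 2 = 2 + α := Real.sq_sqrt (by linarith [H.moment_nonneg])
      refine Real.sqrt_le_iff.2 ⟨by positivity, ?_⟩
      nlinarith [mul_nonneg (Real.sqrt_nonneg δ) hβ0]
    have hXw : X ≤ 2 * √(∫ x, w x ^ 2 ∂gauss) := H.integral_abs_deriv_mul_le
    have hw1 : ∫ x, |w x| ∂gauss ≤ √(∫ x, w x ^ 2 ∂gauss) := H.integral_abs_deriv_le_norm
    have k1 := sqrt_le_rpow_add hδ0 (show (1 / 2 : ℝ) ≤ 3 / 4 by norm_num)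
    have k2 := sqrt_le_rpow_add hδ0 (show (1 / 2 : ℝ) ≤ 1 by norm_num)
    rw [Real.rpow_one] at k2
    have k3 : (2 + 2 * β) * 1 ≤ (2 + 2 * β) * (8 * s) :=
      mul_le_mul_of_nonneg_left hs8 (by positivity)
    have hfin : ∀ t : ℝ, 0 ≤ t → 2 * (s + t) + (2 + 2 * β) * (8 * s) ≤ (a₁ + a₂) * (s + t) := by
      intro t ht
      have e : (a₁ + a₂) * (s + t) = 2 * (s + t) + (2 + 2 * β) * (8 * s)
          + (a₁ * (s + t) + 8 * (2 + 2 * β) * t) := by rw [ha₂]; ring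
      rw [e]
      have : 0 ≤ a₁ * (s + t) + 8 * (2 + 2 * β) * t := by positivity
      linarith
    constructor
    · linarith [hfin _ ht0]
    · linarith [hfin _ hδ0]

/-! ### Weak gradients -/

section WeakGradient

variable {E : Type*} [NormedAddCommGroup E] [InnerProductSpace ℝ E] [MeasureSpace E]
  {f g : E → ℝ} {F G : E → E}

theorem IsWeakGradient.congr (h : IsWeakGradient f G) (hfg : f =ᵐ[volume] g) :
    IsWeakGradient g G := by
  refine ⟨h.1.congr hfg, h.2.1, fun φ hφ hc v => ?_⟩
  rw [← h.2.2 φ hφ hc v]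
  exact integral_congr_ae (hfg.mono fun x hx => by simp only [hx])

/-- Functions equal almost everywhere have the same set of weak gradients, so the choice returns the
very same function, not merely one equal almost everywhere. -/
theorem weakGrad_congr (hfg : f =ᵐ[volume] g) : weakGrad f = weakGrad g := by
  have : IsWeakGradient f = IsWeakGradient g :=
    funext fun G => propext ⟨fun h => h.congr hfg, fun h => h.congr hfg.symm⟩
  unfold weakGrad
  rw [this]

theorem isWeakGradient_weakGrad (h : ∃ G, IsWeakGradient f G) :
    IsWeakGradient f (weakGrad f) := by
  rw [weakGrad, dif_pos h]
  exact h.choose_spec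

variable [FiniteDimensional ℝ E] [BorelSpace E]

theorem IsWeakGradient.ae_eq (hF : IsWeakGradient f F) (hG : IsWeakGradient f G) :
    F =ᵐ[volume] G := by
  refine ae_eq_of_integral_contDiff_smul_eq hF.2.1 hG.2.1 fun φ hφ hc => ?_
  have iF := hF.2.1.integrable_smul_left_of_hasCompactSupport hφ.continuous hc
  have iG := hG.2.1.integrable_smul_left_of_hasCompactSupport hφ.continuous hc
  refine ext_inner_left ℝ fun v => ?_
  rw [← integral_inner iF, ← integral_inner iG]
  have h1 := hF.2.2 φ hφ hc v
  rw [hG.2.2 φ hφ hc v, neg_inj] at h1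
  simp_rw [inner_smul_right, real_inner_comm _ v]
  exact h1.symm

theorem weakGrad_ae_eq (h : IsWeakGradient f G) : weakGrad f =ᵐ[volume] G :=
  (isWeakGradient_weakGrad ⟨G, h⟩).ae_eq h

theorem IsWeakGradient.sub_const [(volume : Measure E).IsAddHaarMeasure]
    (h : IsWeakGradient f G) (c : ℝ) : IsWeakGradient (fun x => f x - c) G := by
  refine ⟨h.1.sub (locallyIntegrable_const c), h.2.1, fun φ hφ hc v => ?_⟩
  have hd : Continuous fun x => fderiv ℝ φ x v :=
    (hφ.continuous_fderiv (by simp)).clm_apply continuous_const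
  have hdc : HasCompactSupport fun x => fderiv ℝ φ x v :=
    (hc.fderiv ℝ).comp_left (g := fun L : E →L[ℝ] ℝ => L v) rfl
  have hdi := hd.integrable_of_hasCompactSupport hdc (μ := volume)
  -- Integration by parts against the constant `1`: a directional derivative of a test function has
  -- integral zero.
  have h0 := integral_mul_fderiv_eq_neg_fderiv_mul_of_integrable (μ := (volume : Measure E))
    (f := fun _ => (1 : ℝ)) (g := φ) (v := v) (by simp) (by simpa using hdi)
    (by simpa using hφ.continuous.integrable_of_hasCompactSupport hc)
    (fun _ _ => differentiableAt_const _) (fun x _ => hφ.differentiable (by simp) x)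
  simp only [one_mul, fderiv_fun_const, Pi.zero_apply, zero_apply, zero_mul,
    integral_zero, neg_zero] at h0
  simp_rw [sub_mul]
  rw [integral_sub _ (hdi.const_mul c), integral_const_mul, h0, mul_zero, sub_zero,
    h.2.2 φ hφ hc v]
  simpa [mul_comm] using h.1.integrable_smul_left_of_hasCompactSupport hd hdc

variable {p : ℝ≥0∞} {μ : Measure E}

omit [FiniteDimensional ℝ E] [BorelSpace E] in
theorem memSobolev_congr (hfg : f =ᵐ[volume] g) (hμ : μ ≪ volume) :
    MemSobolev p μ f ↔ MemSobolev p μ g := by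
  have : IsWeakGradient f = IsWeakGradient g :=
    funext fun G => propext ⟨fun h => h.congr hfg, fun h => h.congr hfg.symm⟩
  rw [MemSobolev, MemSobolev, weakGrad_congr hfg, this, memLp_congr_ae (hμ.ae_eq hfg)]

theorem memSobolev_of_isWeakGradient (h : IsWeakGradient f G) (hμ : μ ≪ volume)
    (hf : MemLp f p μ) (hG : MemLp G p μ) : MemSobolev p μ f :=
  ⟨hf, ⟨G, h⟩, (memLp_congr_ae (hμ.ae_eq (weakGrad_ae_eq h))).2 hG⟩

theorem sobolevNorm_eq (h : IsWeakGradient f G) (hμ : μ ≪ volume) :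
    sobolevNorm μ f = (∫ x, |f x| ∂μ) + ∫ x, ‖G x‖ ∂μ := by
  rw [sobolevNorm]
  congr 1
  exact integral_congr_ae ((hμ.ae_eq (weakGrad_ae_eq h)).mono fun x hx => by simp only [hx])

omit [FiniteDimensional ℝ E] [BorelSpace E] in
theorem sobolevNorm_congr (hfg : f =ᵐ[volume] g) (hμ : μ ≪ volume) :
    sobolevNorm μ f = sobolevNorm μ g := by
  rw [sobolevNorm, sobolevNorm, weakGrad_congr hfg]
  congr 1
  exact integral_congr_ae ((hμ.ae_eq hfg).mono fun x hx => by simp only [hx])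

omit [FiniteDimensional ℝ E] [BorelSpace E] in
theorem gammaMeasure_absolutelyContinuous : gammaMeasure E ≪ volume :=
  withDensity_absolutelyContinuous _ _

end WeakGradient

/-! ### The two Gaussian measures on the line and their rescaling -/

theorem ae_of_ae_densityMeasure {p : ℝ → ℝ} (hp : Measurable p) (h0 : ∀ x, 0 < p x)
    {P : ℝ → Prop} (h : ∀ᵐ x ∂densityMeasure p, P x) : ∀ᵐ x, P x := by
  rw [densityMeasure, ae_withDensity_iff hp.ennreal_ofReal] at h
  exact h.mono fun x hx => hx (by simpa using h0 x)

theorem densityMeasure_absolutelyContinuous (p : ℝ → ℝ) : densityMeasure p ≪ volume :=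
  withDensity_absolutelyContinuous _ _

theorem gammaMeasure_real : gammaMeasure ℝ = gauss := by
  rw [gammaMeasure, gauss, densityMeasure]
  congr 1 with x
  rw [phi, Module.finrank_self, Real.sqrt_eq_rpow, ← Real.rpow_neg (by positivity),
    Real.norm_eq_abs, sq_abs]
  norm_num

/-- The density of `piMeasure` on the line. -/
noncomputable def psi (x : ℝ) : ℝ := Real.exp (-Real.pi * x ^ 2)

theorem psi_pos (x : ℝ) : 0 < psi x := Real.exp_pos _

theorem continuous_psi : Continuous psi := by unfold psi; fun_prop

theorem piMeasure_real : piMeasure ℝ = densityMeasure psi := by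
  rw [piMeasure, densityMeasure]
  congr 1 with x
  rw [psi, Real.norm_eq_abs, sq_abs]

theorem isContDensity_psi : IsContDensity psi where
  continuous := continuous_psi
  nonneg x := (psi_pos x).le
  integrable := integrable_exp_neg_mul_sq Real.pi_pos
  integral_eq_one := by
    simp only [psi]
    rw [integral_gaussian, div_self Real.pi_ne_zero, Real.sqrt_one]

theorem phi_eq_psi (x : ℝ) : phi x = psi (x / √(2 * Real.pi)) / √(2 * Real.pi) := by
  rw [phi, psi, div_pow, Real.sq_sqrt (by positivity), inv_mul_eq_div]
  congr 2
  field_simp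

/-- Division by `√(2π)` carries `γ` to `exp(-πx²) dx`, so statements about `δ_*` reduce to
statements about `δ`. -/
theorem integral_gauss_comp_div (g : ℝ → ℝ) :
    ∫ x, g (x / √(2 * Real.pi)) ∂gauss = ∫ z, g z ∂densityMeasure psi := by
  rw [integral_gauss, integral_densityMeasure continuous_psi.measurable fun x => (psi_pos x).le]
  simp_rw [phi_eq_psi]
  rw [Measure.integral_comp_div (fun z => g z * (psi z / √(2 * Real.pi))),
    abs_of_pos sqrt_two_pi_pos, smul_eq_mul, ← integral_const_mul]
  congr 1 with z
  have := sqrt_two_pi_pos.ne'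
  field_simp

instance : IsProbabilityMeasure (densityMeasure psi) := isContDensity_psi.isProbabilityMeasure

theorem measurePreserving_div_gauss :
    MeasurePreserving (fun x : ℝ => x / √(2 * Real.pi)) gauss (densityMeasure psi) := by
  have hm : Measurable fun x : ℝ => x / √(2 * Real.pi) := measurable_id.div_const _
  refine ⟨hm, Measure.ext fun s hs => ?_⟩
  rw [Measure.map_apply hm hs, ← ENNReal.toReal_eq_toReal_iff' (measure_ne_top _ _)
    (measure_ne_top _ _)]
  have h1 := integral_gauss_comp_div (s.indicator 1)
  rw [integral_indicator_one hs] at h1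
  change _ = (densityMeasure psi).real s
  rw [← h1, ← Measure.real, ← integral_indicator_one (hm hs)]
  rfl

theorem memLp_gauss_comp_div {g : ℝ → ℝ} {p : ℝ≥0∞} (hg : MemLp g p (densityMeasure psi)) :
    MemLp (fun x => g (x / √(2 * Real.pi))) p gauss :=
  hg.comp_measurePreserving measurePreserving_div_gauss

/-- The continuous functions `v` and `|v|` agree almost everywhere, hence everywhere. -/
theorem IsPrimitive.nonneg_of_ae {v w : ℝ → ℝ} (h : IsPrimitive v w) (h0 : ∀ᵐ x, 0 ≤ v x) (x : ℝ) :
    0 ≤ v x := by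
  have := (h.continuous.ae_eq_iff_eq volume h.continuous.abs).1
    (h0.mono fun x hx => (abs_of_nonneg hx).symm)
  rw [this]
  exact abs_nonneg _

/-! ### Densities -/

theorem IsDensity.exists_isProfile {α : ℝ} {f : ℝ → ℝ} (hf : IsDensity α f) :
    ∃ m ≤ α, ∃ v w, IsProfile m v w ∧ f =ᵐ[volume] fun x => v x ^ 2 := by
  obtain ⟨hL, hex, hG⟩ := hf.sqrt_mem
  have h0 := hf.nonneg
  have hmi := hf.moment_integrable
  have hml := hf.moment_le
  have hn := hf.normalized
  have hc := hf.centered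
  rw [gammaMeasure_real] at *
  obtain ⟨v, hv, hsv⟩ := (isWeakGradient_weakGrad hex).exists_isPrimitive
  have h0' := ae_of_ae_densityMeasure continuous_phi.measurable phi_pos h0
  have hv0 : ∀ x, 0 ≤ v x := hv.nonneg_of_ae (hsv.mono fun x hx => hx ▸ Real.sqrt_nonneg _)
  have hfv : f =ᵐ[volume] fun x => v x ^ 2 := by
    filter_upwards [hsv, h0'] with x hx hx0
    rw [← hx, Real.sq_sqrt hx0]
  have hfv' : f =ᵐ[gauss] fun x => v x ^ 2 :=
    (densityMeasure_absolutelyContinuous phi).ae_eq hfv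
  have hsv' := (densityMeasure_absolutelyContinuous phi).ae_eq hsv
  refine ⟨∫ x, |x| ^ 2 * f x ∂gauss, hml, v, _, ⟨hv, hv0, (memLp_congr_ae hsv').1 hL, hG, ?_, ?_,
    ?_, ?_⟩, hfv⟩
  · rw [memLp_two_iff_integrable_sq (by exact (continuous_id.mul hv.continuous).aestronglyMeasurable)]
    refine hmi.congr (hfv'.mono fun x hx => ?_)
    simp only [hx, sq_abs, mul_pow]
  · rw [← hn]
    exact integral_congr_ae hfv'.symm
  · rw [← hc]
    exact integral_congr_ae (hfv'.mono fun x hx => by simp only [hx])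
  · exact integral_congr_ae (hfv'.mono fun x hx => by simp only [hx, sq_abs])

/-- The scaling by `√(2π)` multiplies second moments by `2π` and divides derivatives by `√(2π)`. -/
theorem IsAmplitude.exists_isPrimitive {α : ℝ} {u : ℝ → ℝ} (hu : IsAmplitude α u) :
    ∃ v w, IsPrimitive v w ∧ (∀ x, 0 ≤ v x) ∧ u =ᵐ[volume] v ∧
      MemLp v 2 (densityMeasure psi) ∧ MemLp w 2 (densityMeasure psi) ∧
      (∫ x, v x ^ 2 ∂densityMeasure psi) = 1 ∧
      ∃ m ≤ 2 * Real.pi * α, IsProfile m (fun x => v (x / √(2 * Real.pi)))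
        (fun x => w (x / √(2 * Real.pi)) / √(2 * Real.pi)) := by
  obtain ⟨hL, hex, hG⟩ := hu.mem
  have h0 := hu.nonneg
  have hmi := hu.moment_integrable
  have hml := hu.moment_le
  have hn := hu.normalized
  have hc := hu.centered
  rw [piMeasure_real] at *
  obtain ⟨v, hv, hsv⟩ := (isWeakGradient_weakGrad hex).exists_isPrimitive
  have h0' := ae_of_ae_densityMeasure continuous_psi.measurable psi_pos h0
  have hv0 : ∀ x, 0 ≤ v x := hv.nonneg_of_ae (by
    filter_upwards [hsv, h0'] with x hx hx0
    rwa [← hx])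
  have hsv' := (densityMeasure_absolutelyContinuous psi).ae_eq hsv
  have hLv := (memLp_congr_ae hsv').1 hL
  have hs := sqrt_two_pi_pos
  have hs2 : √(2 * Real.pi) ^ 2 = 2 * Real.pi := Real.sq_sqrt (by positivity)
  have hn' : ∫ x, v x ^ 2 ∂densityMeasure psi = 1 := by
    rw [← hn]
    exact integral_congr_ae (hsv'.mono fun x hx => by simp only [hx, sq_abs])
  refine ⟨v, _, hv, hv0, hsv, hLv, hG, hn',
    2 * Real.pi * ∫ x, |x| ^ 2 * |u x| ^ 2 ∂densityMeasure psi,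
    mul_le_mul_of_nonneg_left hml (by positivity), hv.comp_div hs, fun x => hv0 _,
    memLp_gauss_comp_div hLv, ?_, ?_, ?_, ?_, ?_⟩
  · simp only [div_eq_mul_inv]
    exact (memLp_gauss_comp_div hG).mul_const _
  · have h1 : MemLp (fun x => x * v x) 2 (densityMeasure psi) := by
      rw [memLp_two_iff_integrable_sq (by exact (continuous_id.mul hv.continuous).aestronglyMeasurable)]
      refine hmi.congr (hsv'.mono fun x hx => ?_)
      simp only [hx, sq_abs, mul_pow]
    convert! (memLp_gauss_comp_div h1).const_mul √(2 * Real.pi) using 2 with x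
    field_simp
  · rw [integral_gauss_comp_div fun x => v x ^ 2, hn']
  · have h1 : ∀ x : ℝ, x * v (x / √(2 * Real.pi)) ^ 2 = √(2 * Real.pi) *
        ((x / √(2 * Real.pi)) * v (x / √(2 * Real.pi)) ^ 2) := fun x => by field_simp
    simp_rw [h1]
    rw [integral_const_mul, integral_gauss_comp_div fun x => x * v x ^ 2]
    have : ∫ x, x * v x ^ 2 ∂densityMeasure psi = 0 := by
      rw [← hc]
      exact integral_congr_ae (hsv'.mono fun x hx => by simp only [hx, sq_abs])
    rw [this, mul_zero]
  · have h1 : ∀ x : ℝ, x ^ 2 * v (x / √(2 * Real.pi)) ^ 2 = 2 * Real.pi *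
        ((x / √(2 * Real.pi)) ^ 2 * v (x / √(2 * Real.pi)) ^ 2) := fun x => by
      rw [div_pow, hs2]; field_simp
    simp_rw [h1]
    rw [integral_const_mul, integral_gauss_comp_div fun x => x ^ 2 * v x ^ 2]
    congr 1
    exact integral_congr_ae (hsv'.mono fun x hx => by simp only [hx, sq_abs])

/-! ### Products of one-dimensional functions -/

/-- The product measure on `ℝⁿ` with one-dimensional density `ρ`. -/
noncomputable def tensorMeasure (ρ : ℝ → ℝ) (n : ℕ) : Measure (EuclideanSpace ℝ (Fin n)) :=
  volume.withDensity fun x => ENNReal.ofReal (tensor (fun _ => ρ) x)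

theorem gammaMeasure_euclideanSpace (n : ℕ) :
    gammaMeasure (EuclideanSpace ℝ (Fin n)) = tensorMeasure phi n := by
  rw [gammaMeasure, tensorMeasure]
  congr 1 with x
  simp only [tensor, phi]
  rw [Finset.prod_mul_distrib, Finset.prod_const, ← Real.exp_sum, finrank_euclideanSpace_fin,
    Finset.card_univ, Fintype.card_fin, EuclideanSpace.real_norm_sq_eq, ← Finset.sum_div,
    Finset.sum_neg_distrib, Real.sqrt_eq_rpow, ← Real.rpow_neg (by positivity),
    ← Real.rpow_mul_natCast (by positivity)]
  congr 3
  ring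

theorem piMeasure_euclideanSpace (n : ℕ) :
    piMeasure (EuclideanSpace ℝ (Fin n)) = tensorMeasure psi n := by
  rw [piMeasure, tensorMeasure]
  congr 1 with x
  simp only [tensor, psi]
  rw [← Real.exp_sum, EuclideanSpace.real_norm_sq_eq, Finset.mul_sum]

theorem tensor_congr_ae {n : ℕ} {f g : Fin n → ℝ → ℝ} (h : ∀ k, f k =ᵐ[volume] g k) :
    tensor f =ᵐ[volume] tensor g := by
  have h1 : ∀ᵐ y : Fin n → ℝ, ∀ k, f k (y k) = g k (y k) :=
    ae_all_iff.2 fun k =>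
      (Measure.quasiMeasurePreserving_eval (fun _ : Fin n => (volume : Measure ℝ)) k).ae
        (p := fun t => f k t = g k t) (h k)
  filter_upwards [(PiLp.volume_preserving_ofLp (Fin n)).quasiMeasurePreserving.ae h1] with x hx
  exact Finset.prod_congr rfl fun k _ => hx k

section Tensor

variable {ρ : ℝ → ℝ} {n : ℕ} {f g : Fin n → ℝ → ℝ}

theorem continuous_tensor (hf : ∀ k, Continuous (f k)) : Continuous (tensor f) :=
  continuous_finsetProd _ fun k _ => (hf k).comp (EuclideanSpace.proj k).continuous

variable (hρ : IsContDensity ρ)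
include hρ

/-- It transfers Fubini for `Measure.pi` to Euclidean space. Equality is tested on boxes, where the
indicator of the box times the density is itself a product. -/
theorem measurePreserving_ofLp_tensorMeasure (n : ℕ) :
    MeasurePreserving (WithLp.ofLp : EuclideanSpace ℝ (Fin n) → Fin n → ℝ) (tensorMeasure ρ n)
      (Measure.pi fun _ => densityMeasure ρ) := by
  have := hρ.isProbabilityMeasure
  have hm : Measurable (WithLp.ofLp : EuclideanSpace ℝ (Fin n) → Fin n → ℝ) :=
    (PiLp.volume_preserving_ofLp (Fin n)).measurable
  refine ⟨hm, (Measure.pi_eq fun s hs => ?_).symm⟩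
  have hs' : MeasurableSet (univ.pi s) := MeasurableSet.univ_pi hs
  have hprod : Measurable fun y : Fin n → ℝ => ENNReal.ofReal (∏ k, ρ (y k)) := by
    have := hρ.continuous.measurable
    exact (Finset.measurable_prod _ fun k _ => this.comp (measurable_pi_apply k)).ennreal_ofReal
  rw [Measure.map_apply hm hs', tensorMeasure, withDensity_apply _ (hm hs')]
  have h1 := (PiLp.volume_preserving_ofLp (Fin n)).setLIntegral_comp_preimage hs' hprod
  refine h1.trans ?_
  have hi : ∀ k, Integrable ((s k).indicator ρ) := fun k => hρ.integrable.indicator (hs k)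
  have h0 : ∀ k x, 0 ≤ (s k).indicator ρ x := fun k x =>
    indicator_nonneg (fun x _ => hρ.nonneg x) x
  have h2 : ∀ k, densityMeasure ρ (s k) = ENNReal.ofReal (∫ x, (s k).indicator ρ x) := fun k => by
    rw [densityMeasure, withDensity_apply _ (hs k), integral_indicator (hs k),
      ofReal_integral_eq_lintegral_ofReal hρ.integrable.integrableOn
        (Eventually.of_forall hρ.nonneg)]
  simp_rw [h2]
  rw [← ENNReal.ofReal_prod_of_nonneg fun k _ => integral_nonneg (h0 k),
    ← integral_fintype_prod_eq_prod, ofReal_integral_eq_lintegral_ofReal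
      (Integrable.fintype_prod hi) (Eventually.of_forall fun y => Finset.prod_nonneg fun k _ => h0 k _),
    ← lintegral_indicator hs']
  refine lintegral_congr fun y => ?_
  by_cases hy : y ∈ univ.pi s
  · rw [indicator_of_mem hy]
    congr 1
    exact Finset.prod_congr rfl fun k _ => (indicator_of_mem (hy k (mem_univ k)) _).symm
  · rw [indicator_of_notMem hy]
    simp only [Set.mem_pi, mem_univ, true_imp_iff, not_forall] at hy
    obtain ⟨k, hk⟩ := hy
    rw [Finset.prod_eq_zero (Finset.mem_univ k) (indicator_of_notMem hk _), ENNReal.ofReal_zero]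

theorem integrable_tensor (hf : ∀ k, Integrable (f k) (densityMeasure ρ)) :
    Integrable (tensor f) (tensorMeasure ρ n) := by
  have := hρ.isProbabilityMeasure
  have h := Integrable.fintype_prod (μ := fun _ : Fin n => densityMeasure ρ) hf
  have h1 := (measurePreserving_ofLp_tensorMeasure hρ n).integrable_comp h.aestronglyMeasurable
  exact h1.2 h

theorem integral_tensor (f : Fin n → ℝ → ℝ) :
    ∫ x, tensor f x ∂tensorMeasure ρ n = ∏ k, ∫ x, f k x ∂densityMeasure ρ := by
  have := hρ.isProbabilityMeasure
  rw [← integral_fintype_prod_eq_prod]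
  exact (measurePreserving_ofLp_tensorMeasure hρ n).integral_comp
    (MeasurableEquiv.toLp 2 (Fin n → ℝ)).symm.measurableEmbedding (fun y => ∏ k, f k (y k))

theorem isProbabilityMeasure_tensorMeasure (n : ℕ) : IsProbabilityMeasure (tensorMeasure ρ n) := by
  have := hρ.isProbabilityMeasure
  refine ⟨?_⟩
  have h := (measurePreserving_ofLp_tensorMeasure hρ n).measure_preimage
    MeasurableSet.univ.nullMeasurableSet
  have h1 : (Measure.pi fun _ : Fin n => densityMeasure ρ) univ = 1 := measure_univ
  rwa [preimage_univ, h1] at h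

/-- The density is continuous and positive, so multiplying by its inverse preserves local
integrability. -/
theorem locallyIntegrable_of_integrable_tensorMeasure (hpos : ∀ x, 0 < ρ x)
    {F : EuclideanSpace ℝ (Fin n) → ℝ} (hF : Integrable F (tensorMeasure ρ n)) :
    LocallyIntegrable F volume := by
  have hc : Continuous (tensor fun _ : Fin n => ρ) := continuous_tensor fun _ => hρ.continuous
  have hp : ∀ x, 0 < tensor (fun _ : Fin n => ρ) x := fun x => Finset.prod_pos fun k _ => hpos _
  rw [tensorMeasure, integrable_withDensity_iff_integrable_smul' hc.measurable.ennreal_ofReal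
    (by simp)] at hF
  have h1 := (locallyIntegrableOn_univ.2 hF.locallyIntegrable).continuousOn_mul
    (hc.inv₀ fun x => (hp x).ne').continuousOn isOpen_univ.isLocallyClosed
  rw [locallyIntegrableOn_univ] at h1
  refine h1.congr (Eventually.of_forall fun x => ?_)
  simp only [ENNReal.toReal_ofReal (hp x).le, smul_eq_mul, Pi.inv_apply]
  rw [← mul_assoc, inv_mul_cancel₀ (hp x).ne', one_mul]

end Tensor

/-- The gradient of `tensor f` when `g k` is the derivative of `f k`. -/
noncomputable def tensorGrad {n : ℕ} (f g : Fin n → ℝ → ℝ) (x : EuclideanSpace ℝ (Fin n)) :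
    EuclideanSpace ℝ (Fin n) :=
  WithLp.toLp 2 fun k => tensor (Function.update f k (g k)) x

theorem tensor_update_apply {n : ℕ} (f : Fin n → ℝ → ℝ) (k : Fin n) (h : ℝ → ℝ)
    (x : EuclideanSpace ℝ (Fin n)) :
    tensor (Function.update f k h) x = h (x k) * ∏ j ∈ Finset.univ.erase k, f j (x j) := by
  rw [tensor, ← Finset.mul_prod_erase _ _ (Finset.mem_univ k), Function.update_self]
  congr 1
  exact Finset.prod_congr rfl fun j hj => by
    rw [Function.update_of_ne (Finset.ne_of_mem_erase hj)]

theorem tensor_eq_mul {n : ℕ} (f : Fin n → ℝ → ℝ) (k : Fin n) (x : EuclideanSpace ℝ (Fin n)) :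
    tensor f x = f k (x k) * ∏ j ∈ Finset.univ.erase k, f j (x j) := by
  rw [tensor, ← Finset.mul_prod_erase _ _ (Finset.mem_univ k)]

/-- Integration by parts in one coordinate for a product function. -/
theorem integral_tensor_mul_fderiv {n : ℕ} {f : Fin n → ℝ → ℝ} {k : Fin n} {h : ℝ → ℝ}
    (hfh : IsWeakGradient (f k) h) (hf : LocallyIntegrable (tensor f) volume)
    (hg : LocallyIntegrable (tensor (Function.update f k h)) volume)
    {φ : EuclideanSpace ℝ (Fin n) → ℝ} (hφ : ContDiff ℝ ∞ φ) (hc : HasCompactSupport φ) :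
    ∫ x, tensor f x * fderiv ℝ φ x (EuclideanSpace.single k 1) =
      -∫ x, φ x * tensor (Function.update f k h) x := by
  obtain _ | m := n
  · exact k.elim0
  let e : EuclideanSpace ℝ (Fin (m + 1)) := EuclideanSpace.single k 1
  have hd : Continuous fun x => fderiv ℝ φ x e :=
    (hφ.continuous_fderiv (by simp)).clm_apply continuous_const
  have hdc : HasCompactSupport fun x => fderiv ℝ φ x e :=
    (hc.fderiv ℝ).comp_left (g := fun L : EuclideanSpace ℝ (Fin (m + 1)) →L[ℝ] ℝ => L e) rfl
  have i1 : Integrable fun x => tensor f x * fderiv ℝ φ x e := by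
    simpa [mul_comm] using hf.integrable_smul_left_of_hasCompactSupport hd hdc
  have i2 : Integrable fun x => φ x * tensor (Function.update f k h) x :=
    hg.integrable_smul_left_of_hasCompactSupport hφ.continuous hc
  -- The coordinate `k` is separated from the others. For fixed `y`, the slice of `φ` is a test
  -- function on the line, to which the one-dimensional weak derivative applies; Fubini does the
  -- rest.
  let ι : ℝ × (Fin m → ℝ) → EuclideanSpace ℝ (Fin (m + 1)) := fun z =>
    WithLp.toLp 2 (k.insertNth (α := fun _ => ℝ) z.1 z.2)
  have hι : MeasurePreserving ι (volume.prod volume) volume :=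
    (PiLp.volume_preserving_toLp (Fin (m + 1))).comp
      (volume_preserving_piFinSuccAbove (fun _ => ℝ) k).symm
  have hιe : MeasurableEmbedding ι :=
    (MeasurableEquiv.toLp 2 (Fin (m + 1) → ℝ)).measurableEmbedding.comp
      (MeasurableEquiv.piFinSuccAbove (fun _ => ℝ) k).symm.measurableEmbedding
  have hfι : ∀ t y, tensor f (ι (t, y)) = f k t * ∏ j, f (k.succAbove j) (y j) := fun t y => by
    simp [tensor, ι, Fin.prod_univ_succAbove _ k]
  have hgι : ∀ t y, tensor (Function.update f k h) (ι (t, y))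
      = h t * ∏ j, f (k.succAbove j) (y j) := fun t y => by
    simp [tensor, ι, Fin.prod_univ_succAbove _ k]
  have hιadd : ∀ t y, ι (t, y) = ι (0, y) + t • e := fun t y => by
    ext j
    rcases Fin.eq_self_or_eq_succAbove k j with rfl | ⟨i, rfl⟩ <;> simp [ι, e]
  have hιd : ∀ y t, HasDerivAt (fun t => ι (t, y)) e t := fun y t => by
    have h1 : HasDerivAt (fun t : ℝ => ι (0, y) + t • e) ((1 : ℝ) • e) t :=
      ((hasDerivAt_id' t).smul_const e).const_add _
    rw [one_smul] at h1
    simpa only [← hιadd] using h1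
  have j1 : Integrable (fun z => tensor f (ι z) * fderiv ℝ φ (ι z) e) (volume.prod volume) :=
    (hι.integrable_comp_emb hιe).2 i1
  have j2 : Integrable (fun z => φ (ι z) * tensor (Function.update f k h) (ι z))
      (volume.prod volume) := (hι.integrable_comp_emb hιe).2 i2
  change ∫ x, tensor f x * fderiv ℝ φ x e = _
  rw [← hι.integral_comp hιe, ← hι.integral_comp hιe, integral_prod_symm _ j1,
    integral_prod_symm _ j2, ← integral_neg]
  congr 1 with y
  have hψ : ContDiff ℝ ∞ fun t => φ (ι (t, y)) := by
    have h1 : (fun t => φ (ι (t, y))) = fun t => φ (ι (0, y) + t • e) :=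
      funext fun t => by rw [← hιadd]
    rw [h1]
    exact hφ.comp (contDiff_const.add (contDiff_id.smul contDiff_const))
  have hψd : ∀ t, fderiv ℝ (fun t => φ (ι (t, y))) t 1 = fderiv ℝ φ (ι (t, y)) e := fun t => by
    rw [fderiv_apply_one_eq_deriv]
    exact ((hφ.differentiable (by simp) _).hasFDerivAt.comp_hasDerivAt t (hιd y t)).deriv
  have hψc : HasCompactSupport fun t => φ (ι (t, y)) := by
    obtain ⟨R, hR⟩ := hc.isCompact.isBounded.subset_closedBall 0
    refine HasCompactSupport.intro (isCompact_closedBall (0 : ℝ) R) fun t ht => ?_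
    refine image_eq_zero_of_notMem_tsupport fun hmem => ht ?_
    have h1 := hR hmem
    rw [mem_closedBall_zero_iff] at h1 ⊢
    refine le_trans ?_ h1
    have := PiLp.norm_apply_le (ι (t, y)) k
    simpa [ι] using this
  have key := hfh.2.2 _ hψ hψc 1
  simp_rw [hψd] at key
  simp_rw [hfι, hgι]
  calc ∫ t, f k t * (∏ j, f (k.succAbove j) (y j)) * fderiv ℝ φ (ι (t, y)) e
      = (∏ j, f (k.succAbove j) (y j)) * ∫ t, f k t * fderiv ℝ φ (ι (t, y)) e := by
        rw [← integral_const_mul]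
        congr 1 with t
        ring
    _ = -∫ t, φ (ι (t, y)) * (h t * ∏ j, f (k.succAbove j) (y j)) := by
        rw [key, mul_neg, ← integral_const_mul]
        congr 2 with t
        simp [inner]
        ring

/-- By linearity in the direction only the coordinate directions matter, and there all but one
factor are constants. -/
theorem isWeakGradient_tensor {ρ : ℝ → ℝ} (hρ : IsContDensity ρ) (hpos : ∀ x, 0 < ρ x) {n : ℕ}
    {f g : Fin n → ℝ → ℝ} (hfg : ∀ k, IsWeakGradient (f k) (g k))
    (hf : ∀ k, Integrable (f k) (densityMeasure ρ))
    (hg : ∀ k, Integrable (g k) (densityMeasure ρ)) :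
    IsWeakGradient (tensor f) (tensorGrad f g) := by
  have hu : ∀ k, Integrable (tensor (Function.update f k (g k))) (tensorMeasure ρ n) := fun k => by
    refine integrable_tensor hρ fun j => ?_
    rcases eq_or_ne j k with rfl | hjk
    · simpa using hg j
    · simpa [hjk] using hf j
  have h1 := locallyIntegrable_of_integrable_tensorMeasure hρ hpos (integrable_tensor hρ hf)
  have h2 := fun k => locallyIntegrable_of_integrable_tensorMeasure hρ hpos (hu k)
  have h3 : LocallyIntegrable (tensorGrad f g) volume := by
    rw [locallyIntegrable_iff]
    intro K hK
    rw [IntegrableOn, ← memLp_one_iff_integrable]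
    exact MemLp.of_eval_piLp fun k =>
      memLp_one_iff_integrable.2 ((h2 k).integrableOn_isCompact hK)
  refine ⟨h1, h3, fun φ hφ hc v => ?_⟩
  have hv : ∀ x, fderiv ℝ φ x v
      = ∑ k, v k * fderiv ℝ φ x (EuclideanSpace.single k 1) := fun x => by
    conv_lhs => rw [← (EuclideanSpace.basisFun (Fin n) ℝ).sum_repr v]
    simp
  have hin : ∀ x, inner ℝ (tensorGrad f g x) v
      = ∑ k, v k * tensor (Function.update f k (g k)) x := fun x => by
    simp [tensorGrad, PiLp.inner_apply]
  have hd : ∀ k, Integrable fun x => tensor f x * fderiv ℝ φ x (EuclideanSpace.single k 1) := by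
    intro k
    have := h1.integrable_smul_left_of_hasCompactSupport
      (g := fun x => fderiv ℝ φ x (EuclideanSpace.single k 1))
      ((hφ.continuous_fderiv (by simp)).clm_apply continuous_const)
      ((hc.fderiv ℝ).comp_left
        (g := fun L : EuclideanSpace ℝ (Fin n) →L[ℝ] ℝ => L (EuclideanSpace.single k 1)) rfl)
    simpa [mul_comm] using this
  have hφi : ∀ k, Integrable fun x => φ x * tensor (Function.update f k (g k)) x := fun k =>
    (h2 k).integrable_smul_left_of_hasCompactSupport hφ.continuous hc
  simp_rw [hv, hin, Finset.mul_sum, mul_left_comm _ (v _)]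
  rw [integral_finsetSum _ fun k _ => (hd k).const_mul _,
    integral_finsetSum _ fun k _ => (hφi k).const_mul _, ← Finset.sum_neg_distrib]
  refine Finset.sum_congr rfl fun k _ => ?_
  rw [integral_const_mul, integral_const_mul, integral_tensor_mul_fderiv (hfg k) h1 (h2 k) hφ hc,
    mul_neg]

/-! ### Pointwise identities for products -/

section Pointwise

variable {n : ℕ} (f g : Fin n → ℝ → ℝ) (x : EuclideanSpace ℝ (Fin n))

theorem sq_tensor : tensor f x ^ 2 = tensor (fun k t => f k t ^ 2) x :=
  (Finset.prod_pow _ _ _).symm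

theorem sq_tensor_update (k : Fin n) (h : ℝ → ℝ) : tensor (Function.update f k h) x ^ 2 =
    tensor (Function.update (fun j t => f j t ^ 2) k fun t => h t ^ 2) x := by
  rw [tensor_update_apply, tensor_update_apply, mul_pow, Finset.prod_pow]

theorem norm_tensorGrad_sq : ‖tensorGrad f g x‖ ^ 2 =
    ∑ k, tensor (Function.update (fun j t => f j t ^ 2) k fun t => g k t ^ 2) x := by
  rw [EuclideanSpace.real_norm_sq_eq]
  exact Finset.sum_congr rfl fun k _ => sq_tensor_update f x k (g k)

/-- No positivity is needed: the product `P` of the other factors satisfies `P * P / P = P` also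
when it is zero, by the convention for division. -/
theorem norm_tensorGrad_sq_div : ‖tensorGrad f g x‖ ^ 2 / tensor f x =
    ∑ k, tensor (Function.update f k fun t => g k t ^ 2 / f k t) x := by
  rw [EuclideanSpace.real_norm_sq_eq, Finset.sum_div]
  refine Finset.sum_congr rfl fun k _ => ?_
  change tensor (Function.update f k (g k)) x ^ 2 / _ = _
  rw [tensor_update_apply, tensor_update_apply, tensor_eq_mul f k, mul_pow, mul_div_mul_comm, sq (∏ j ∈ _, _),
    mul_self_div_self]

/-- If some factor vanishes, both sides are zero because every term on the right contains the full
product; otherwise the logarithm of the product splits. -/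
theorem tensor_mul_log : tensor f x * Real.log (tensor f x) =
    ∑ k, tensor (Function.update f k fun t => f k t * Real.log (f k t)) x := by
  have h1 : ∀ k, tensor (Function.update f k fun t => f k t * Real.log (f k t)) x =
      tensor f x * Real.log (f k (x k)) := fun k => by
    rw [tensor_update_apply, tensor_eq_mul f k]
    ring
  simp_rw [h1, ← Finset.mul_sum]
  by_cases h0 : ∃ k, f k (x k) = 0
  · obtain ⟨k, hk⟩ := h0
    rw [tensor_eq_mul f k, hk]
    simp
  · push Not at h0
    rw [tensor, Real.log_prod fun k _ => h0 k]

theorem norm_tensorGrad_le : ‖tensorGrad f g x‖ ≤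
    ∑ k, tensor (Function.update (fun j t => |f j t|) k fun t => |g k t|) x := by
  have h1 : tensorGrad f g x =
      ∑ k, EuclideanSpace.single k (tensor (Function.update f k (g k)) x) := by
    ext j
    simp [tensorGrad]
  rw [h1]
  refine (norm_sum_le _ _).trans (Finset.sum_le_sum fun k _ => ?_)
  rw [PiLp.norm_single, tensor_update_apply, tensor_update_apply, Real.norm_eq_abs,
    abs_mul, Finset.abs_prod]

/-- Telescoping: the factors are replaced by `1` one at a time, in the order of the indices. -/
theorem abs_tensor_sub_one_le : |tensor f x - 1| ≤
    ∑ k, tensor (fun j t => if j < k then |f j t| else if j = k then |f j t - 1| else 1) x := by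
  have h1 : tensor f x = ∏ k, (1 - (1 - f k (x k))) := by simp [tensor]
  rw [h1, Finset.prod_one_sub_ordered, sub_sub_cancel_left, abs_neg]
  refine (Finset.abs_sum_le_sum_abs _ _).trans (Finset.sum_le_sum fun k _ => le_of_eq ?_)
  rw [abs_mul, Finset.abs_prod, tensor, ← Finset.mul_prod_erase _ _ (Finset.mem_univ k)]
  simp only [lt_self_iff_false, if_false, if_true, sub_sub_cancel, abs_sub_comm (1 : ℝ)]
  rw [mul_comm, mul_comm |f k (x k) - 1|]
  congr 1
  rw [Finset.prod_filter]
  refine (Finset.prod_erase _ (by simp)).symm.trans (Finset.prod_congr rfl fun j hj => ?_)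
  rw [if_neg (Finset.ne_of_mem_erase hj)]

end Pointwise

/-! ### Integrals of products -/

theorem tensorMeasure_absolutelyContinuous {ρ : ℝ → ℝ} {n : ℕ} : tensorMeasure ρ n ≪ volume :=
  withDensity_absolutelyContinuous _ _

section Integrals

variable {ρ : ℝ → ℝ} {n : ℕ} {f g : Fin n → ℝ → ℝ} (hρ : IsContDensity ρ)
include hρ

theorem integrable_tensor_update (hf : ∀ k, Integrable (f k) (densityMeasure ρ)) (k : Fin n)
    {h : ℝ → ℝ} (hh : Integrable h (densityMeasure ρ)) :
    Integrable (tensor (Function.update f k h)) (tensorMeasure ρ n) := by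
  refine integrable_tensor hρ fun j => ?_
  rcases eq_or_ne j k with rfl | hjk
  · simpa using hh
  · simpa [hjk] using hf j

theorem integral_tensor_update (hf : ∀ k, ∫ x, f k x ∂densityMeasure ρ = 1) (k : Fin n)
    (h : ℝ → ℝ) :
    ∫ x, tensor (Function.update f k h) x ∂tensorMeasure ρ n = ∫ x, h x ∂densityMeasure ρ := by
  rw [integral_tensor hρ, ← Finset.mul_prod_erase _ _ (Finset.mem_univ k), Function.update_self,
    Finset.prod_eq_one, mul_one]
  intro j hj
  rw [Function.update_of_ne (Finset.ne_of_mem_erase hj), hf]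

theorem integral_tensor_update_le (hf : ∀ k, ∫ x, |f k x| ∂densityMeasure ρ ≤ 1) (k : Fin n)
    {h : ℝ → ℝ} (hh : ∀ x, 0 ≤ h x) :
    ∫ x, tensor (Function.update (fun j t => |f j t|) k h) x ∂tensorMeasure ρ n ≤
      ∫ x, h x ∂densityMeasure ρ := by
  rw [integral_tensor hρ, ← Finset.mul_prod_erase _ _ (Finset.mem_univ k), Function.update_self]
  refine mul_le_of_le_one_right (integral_nonneg hh) ?_
  refine Finset.prod_le_one (fun j hj => ?_) fun j hj => ?_ <;>
    rw [Function.update_of_ne (Finset.ne_of_mem_erase hj)]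
  exacts [integral_nonneg fun _ => abs_nonneg _, hf j]

theorem integrable_tensorGrad (hf : ∀ k, Integrable (f k) (densityMeasure ρ))
    (hg : ∀ k, Integrable (g k) (densityMeasure ρ)) :
    Integrable (tensorGrad f g) (tensorMeasure ρ n) := by
  rw [← memLp_one_iff_integrable]
  exact MemLp.of_eval_piLp fun k =>
    memLp_one_iff_integrable.2 (integrable_tensor_update hρ hf k (hg k))

/-- A product of functions of mean at most one is as close to one in `W^{1,1}` as the sum of the
distances of its factors. -/
theorem memSobolev_sobolevNorm_tensor_sub_one (hpos : ∀ x, 0 < ρ x)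
    (hfg : ∀ k, IsWeakGradient (f k) (g k)) (hf : ∀ k, Integrable (f k) (densityMeasure ρ))
    (hg : ∀ k, Integrable (g k) (densityMeasure ρ))
    (hf1 : ∀ k, ∫ x, |f k x| ∂densityMeasure ρ ≤ 1) :
    MemSobolev 1 (tensorMeasure ρ n) (fun x => tensor f x - 1) ∧
      sobolevNorm (tensorMeasure ρ n) (fun x => tensor f x - 1) ≤
        ∑ k, ((∫ x, |f k x - 1| ∂densityMeasure ρ) + ∫ x, |g k x| ∂densityMeasure ρ) := by
  have := hρ.isProbabilityMeasure
  have := isProbabilityMeasure_tensorMeasure hρ n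
  have h := (isWeakGradient_tensor hρ hpos hfg hf hg).sub_const 1
  have hac : tensorMeasure ρ n ≪ volume := tensorMeasure_absolutelyContinuous
  have i1 : Integrable (fun x => tensor f x - 1) (tensorMeasure ρ n) :=
    (integrable_tensor hρ hf).sub (integrable_const _)
  have i2 := integrable_tensorGrad hρ hf hg
  refine ⟨memSobolev_of_isWeakGradient h hac (memLp_one_iff_integrable.2 i1)
    (memLp_one_iff_integrable.2 i2), ?_⟩
  rw [sobolevNorm_eq h hac, Finset.sum_add_distrib]
  refine add_le_add ?_ ?_
  · have i3 : ∀ k : Fin n, Integrable (tensor fun j t => if j < k then |f j t| else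
        if j = k then |f j t - 1| else 1) (tensorMeasure ρ n) := fun k =>
      integrable_tensor hρ fun j => by
        split_ifs
        exacts [(hf j).abs, ((hf j).sub (integrable_const _)).abs, integrable_const _]
    refine (integral_mono i1.abs (integrable_finsetSum _ fun k _ => i3 k)
      fun x => abs_tensor_sub_one_le f x).trans ?_
    rw [integral_finsetSum _ fun k _ => i3 k]
    refine Finset.sum_le_sum fun k _ => ?_
    rw [integral_tensor hρ, ← Finset.mul_prod_erase _ _ (Finset.mem_univ k)]
    simp only [lt_self_iff_false, if_false, if_true]
    -- In each telescoping term the remaining factors have integral at most one; this is the only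
    -- place where a mean bound on the `L¹` norms is needed for the distance itself.
    refine mul_le_of_le_one_right (integral_nonneg fun _ => abs_nonneg _) ?_
    refine Finset.prod_le_one (fun j hj => integral_nonneg fun t => ?_) fun j hj => ?_
    · dsimp only
      split_ifs <;> positivity
    · have hjk := Finset.ne_of_mem_erase hj
      simp only [hjk, if_false]
      split_ifs
      · exact hf1 j
      · simp
  · have i3 := fun k => integrable_tensor_update hρ (fun j => (hf j).abs) k (hg k).abs
    refine (integral_mono i2.norm (integrable_finsetSum _ fun k _ => i3 k)
      fun x => norm_tensorGrad_le f g x).trans ?_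
    rw [integral_finsetSum _ fun k _ => i3 k]
    exact Finset.sum_le_sum fun k _ => integral_tensor_update_le hρ hf1 k fun _ => abs_nonneg _

theorem memLp_two_tensor (hf : ∀ k, MemLp (f k) 2 (densityMeasure ρ)) :
    MemLp (tensor f) 2 (tensorMeasure ρ n) := by
  have := hρ.isProbabilityMeasure
  rw [memLp_two_iff_integrable_sq
    (integrable_tensor hρ fun k => (hf k).integrable one_le_two).aestronglyMeasurable]
  simp_rw [sq_tensor]
  exact integrable_tensor hρ fun k => (hf k).integrable_sq

theorem memSobolev_two_tensor (hpos : ∀ x, 0 < ρ x) (hfg : ∀ k, IsWeakGradient (f k) (g k))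
    (hf : ∀ k, MemLp (f k) 2 (densityMeasure ρ)) (hg : ∀ k, MemLp (g k) 2 (densityMeasure ρ)) :
    MemSobolev 2 (tensorMeasure ρ n) (tensor f) := by
  have := hρ.isProbabilityMeasure
  refine memSobolev_of_isWeakGradient (isWeakGradient_tensor hρ hpos hfg
    (fun k => (hf k).integrable one_le_two) fun k => (hg k).integrable one_le_two)
    (tensorMeasure_absolutelyContinuous) (memLp_two_tensor hρ hf) (MemLp.of_eval_piLp fun k => ?_)
  refine memLp_two_tensor hρ fun j => ?_
  rcases eq_or_ne j k with rfl | hjk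
  · simpa using hg j
  · simpa [hjk] using hf j

theorem integrable_sum_tensor_update {e : Fin n → ℝ → ℝ}
    (hf : ∀ k, Integrable (f k) (densityMeasure ρ)) (he : ∀ k, Integrable (e k) (densityMeasure ρ)) :
    Integrable (fun x => ∑ k, tensor (Function.update f k (e k)) x) (tensorMeasure ρ n) :=
  integrable_finsetSum _ fun k _ => integrable_tensor_update hρ hf k (he k)

theorem integral_sum_tensor_update {e : Fin n → ℝ → ℝ}
    (hf : ∀ k, Integrable (f k) (densityMeasure ρ)) (hf1 : ∀ k, ∫ x, f k x ∂densityMeasure ρ = 1)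
    (he : ∀ k, Integrable (e k) (densityMeasure ρ)) :
    ∫ x, ∑ k, tensor (Function.update f k (e k)) x ∂tensorMeasure ρ n =
      ∑ k, ∫ x, e k x ∂densityMeasure ρ := by
  rw [integral_finsetSum _ fun k _ => integrable_tensor_update hρ hf k (he k)]
  exact Finset.sum_congr rfl fun k _ => integral_tensor_update hρ hf1 k _

end Integrals

/-- The power mean inequality with exponent `1 / r`, that is, Jensen for the concave function `t ^
r`. It is the source of `n ^ (3/4)`. -/
theorem sum_rpow_le {n : ℕ} {x : Fin n → ℝ} (hx : ∀ k, 0 ≤ x k) {r : ℝ} (hr : 0 < r)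
    (hr1 : r ≤ 1) : ∑ k, x k ^ r ≤ (n : ℝ) ^ (1 - r) * (∑ k, x k) ^ r := by
  have h1 := Real.rpow_sum_le_const_mul_sum_rpow_of_nonneg (p := 1 / r) Finset.univ
    (f := fun k => x k ^ r) ((one_le_div hr).2 hr1) fun k _ => Real.rpow_nonneg (hx k) r
  have h2 : ∀ y : ℝ, 0 ≤ y → (y ^ r) ^ (1 / r) = y := fun y hy => by
    rw [← Real.rpow_mul hy, mul_one_div_cancel hr.ne', Real.rpow_one]
  have h3 : ∀ y : ℝ, 0 ≤ y → (y ^ (1 / r)) ^ r = y := fun y hy => by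
    rw [← Real.rpow_mul hy, one_div_mul_cancel hr.ne', Real.rpow_one]
  simp only [h2 _ (hx _), Finset.card_univ, Fintype.card_fin] at h1
  have h0 : 0 ≤ ∑ k, x k ^ r := Finset.sum_nonneg fun k _ => Real.rpow_nonneg (hx k) r
  have h4 := Real.rpow_le_rpow (by positivity) h1 hr.le
  rwa [h3 _ h0, Real.mul_rpow (by positivity) (Finset.sum_nonneg fun k _ => hx k),
    ← Real.rpow_mul (by positivity), sub_mul, one_div_mul_cancel hr.ne', one_mul] at h4

/-! ### The deficit of a density -/

namespace IsProfile

variable {m : ℝ} {v w f : ℝ → ℝ} (H : IsProfile m v w)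
include H

/-- On the zero set of `v` the derivative `w` vanishes almost everywhere, so the convention `0 / 0 =
0` loses no Fisher information. -/
theorem fisher_ae_eq :
    (fun x => (2 * (w x * v x)) ^ 2 / v x ^ 2) =ᵐ[gauss] fun x => 4 * w x ^ 2 := by
  filter_upwards [(densityMeasure_absolutelyContinuous phi).ae_le
    (H.primitive.ae_eq_zero H.nonneg)] with x hx
  rcases eq_or_ne (v x) 0 with h0 | h0
  · simp [h0, hx h0]
  · field_simp
    ring

theorem integrable_fisher : Integrable (fun x => (2 * (w x * v x)) ^ 2 / v x ^ 2) gauss :=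
  (H.memLp_deriv.integrable_sq.const_mul 4).congr H.fisher_ae_eq.symm

theorem integral_fisher_sub_entropy :
    (1 / 2) * (∫ x, (2 * (w x * v x)) ^ 2 / v x ^ 2 ∂gauss) -
      ∫ x, v x ^ 2 * Real.log (v x ^ 2) ∂gauss = profileDeficit v w := by
  rw [integral_congr_ae H.fisher_ae_eq, integral_const_mul, profileDeficit]
  ring

theorem isWeakGradient_sq : IsWeakGradient (fun x => v x ^ 2) fun x => 2 * (w x * v x) :=
  H.sq_primitive.isWeakGradient

theorem integrable_two_mul : Integrable (fun x => 2 * (w x * v x)) gauss :=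
  H.integrable_deriv_mul.const_mul 2

theorem integral_abs_sq : ∫ x, |v x ^ 2| ∂gauss ≤ 1 := by
  simp_rw [abs_sq]
  exact H.normalized.le

theorem sqrt_ae_eq (hf : f =ᵐ[volume] fun x => v x ^ 2) :
    (fun x => √(f x)) =ᵐ[volume] v :=
  hf.mono fun x hx => by simp only [hx, Real.sqrt_sq (H.nonneg x)]

theorem norm_sq_div_ae_eq (hf : f =ᵐ[volume] fun x => v x ^ 2) :
    (fun x => ‖weakGrad f x‖ ^ 2 / f x) =ᵐ[gauss]
      fun x => (2 * (w x * v x)) ^ 2 / v x ^ 2 := by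
  have hac := densityMeasure_absolutelyContinuous phi
  filter_upwards [hac.ae_eq hf, hac.ae_eq (weakGrad_ae_eq (H.isWeakGradient_sq.congr hf.symm))]
    with x h1 h2
  rw [h1, h2, Real.norm_eq_abs, sq_abs]

omit H in
theorem mul_log_ae_eq (hf : f =ᵐ[volume] fun x => v x ^ 2) :
    (fun x => f x * Real.log (f x)) =ᵐ[gauss] fun x => v x ^ 2 * Real.log (v x ^ 2) :=
  ((densityMeasure_absolutelyContinuous phi).ae_eq hf).mono fun x hx => by simp only [hx]

theorem deficitWellDefined (hf : f =ᵐ[volume] fun x => v x ^ 2) : DeficitWellDefined f where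
  sqrt_mem := by
    rw [memSobolev_congr (H.sqrt_ae_eq hf) gammaMeasure_absolutelyContinuous, gammaMeasure_real]
    exact memSobolev_of_isWeakGradient H.primitive.isWeakGradient
      (densityMeasure_absolutelyContinuous phi) H.memLp H.memLp_deriv
  fisher := by
    rw [gammaMeasure_real]
    exact H.integrable_fisher.congr (H.norm_sq_div_ae_eq hf).symm
  entropy := by
    rw [gammaMeasure_real]
    exact H.entropy_integrable.congr (mul_log_ae_eq hf).symm

theorem deficit_eq (hf : f =ᵐ[volume] fun x => v x ^ 2) : deficit f = profileDeficit v w := by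
  rw [deficit, gammaMeasure_real, integral_congr_ae (H.norm_sq_div_ae_eq hf),
    integral_congr_ae (mul_log_ae_eq hf), H.integral_fisher_sub_entropy]

theorem memSobolev_sobolevNorm_sub_one (hf : f =ᵐ[volume] fun x => v x ^ 2) :
    MemSobolev 1 (gammaMeasure ℝ) (fun x => f x - 1) ∧
      sobolevNorm (gammaMeasure ℝ) (fun x => f x - 1) =
        (∫ x, |v x ^ 2 - 1| ∂gauss) + ∫ x, |2 * (w x * v x)| ∂gauss := by
  have h := (H.isWeakGradient_sq.congr hf.symm).sub_const 1
  have hac := densityMeasure_absolutelyContinuous phi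
  rw [gammaMeasure_real]
  have h1 : (fun x => f x - 1) =ᵐ[gauss] fun x => v x ^ 2 - 1 :=
    (hac.ae_eq hf).mono fun x hx => by simp only [hx]
  refine ⟨memSobolev_of_isWeakGradient h hac (memLp_one_iff_integrable.2
    (H.integrable_sq_sub_one.congr h1.symm)) (memLp_one_iff_integrable.2 H.integrable_two_mul), ?_⟩
  rw [sobolevNorm_eq h hac]
  congr 1
  exact integral_congr_ae (h1.mono fun x hx => by simp only [hx])

end IsProfile

section Density

variable {n : ℕ} {m : Fin n → ℝ} {v w f : Fin n → ℝ → ℝ} (H : ∀ k, IsProfile (m k) (v k) (w k))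
  (hf : ∀ k, f k =ᵐ[volume] fun x => v k x ^ 2)
include H hf

theorem isWeakGradient_tensor_density : IsWeakGradient (tensor f)
    (tensorGrad (fun k x => v k x ^ 2) fun k x => 2 * (w k x * v k x)) :=
  (isWeakGradient_tensor isContDensity_phi phi_pos (fun k => (H k).isWeakGradient_sq)
    (fun k => (H k).memLp.integrable_sq) fun k => (H k).integrable_two_mul).congr
      (tensor_congr_ae hf).symm

theorem fisher_tensor_ae_eq :
    (fun x => ‖weakGrad (tensor f) x‖ ^ 2 / tensor f x) =ᵐ[tensorMeasure phi n] fun x =>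
      ∑ k, tensor (Function.update (fun j t => v j t ^ 2) k
        fun t => (2 * (w k t * v k t)) ^ 2 / v k t ^ 2) x := by
  have hac : tensorMeasure phi n ≪ volume := tensorMeasure_absolutelyContinuous
  filter_upwards [hac.ae_eq (tensor_congr_ae hf),
    hac.ae_eq (weakGrad_ae_eq (isWeakGradient_tensor_density H hf))] with x h1 h2
  rw [h1, h2]
  exact norm_tensorGrad_sq_div _ _ _

omit H in
theorem entropy_tensor_ae_eq :
    (fun x => tensor f x * Real.log (tensor f x)) =ᵐ[tensorMeasure phi n] fun x =>
      ∑ k, tensor (Function.update (fun j t => v j t ^ 2) k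
        fun t => v k t ^ 2 * Real.log (v k t ^ 2)) x := by
  have hac : tensorMeasure phi n ≪ volume := tensorMeasure_absolutelyContinuous
  filter_upwards [hac.ae_eq (tensor_congr_ae hf)] with x h1
  rw [h1]
  exact tensor_mul_log _ _

theorem deficitWellDefined_tensor : DeficitWellDefined (tensor f) where
  sqrt_mem := by
    have h1 : (fun x => √(tensor f x)) =ᵐ[volume] tensor v := by
      filter_upwards [tensor_congr_ae hf] with x hx
      rw [hx, ← sq_tensor v, Real.sqrt_sq (by exact Finset.prod_nonneg fun k _ => (H k).nonneg _)]
    rw [memSobolev_congr h1 gammaMeasure_absolutelyContinuous, gammaMeasure_euclideanSpace]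
    exact memSobolev_two_tensor isContDensity_phi phi_pos
      (fun k => (H k).primitive.isWeakGradient) (fun k => (H k).memLp) fun k => (H k).memLp_deriv
  fisher := by
    rw [gammaMeasure_euclideanSpace]
    exact (integrable_sum_tensor_update isContDensity_phi (fun k => (H k).memLp.integrable_sq)
      fun k => (H k).integrable_fisher).congr (fisher_tensor_ae_eq H hf).symm
  entropy := by
    rw [gammaMeasure_euclideanSpace]
    exact (integrable_sum_tensor_update isContDensity_phi (fun k => (H k).memLp.integrable_sq)
      fun k => (H k).entropy_integrable).congr (entropy_tensor_ae_eq hf).symm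

/-- Fisher information and entropy are sums in which one factor is replaced; the other factors have
mean one and integrate out. -/
theorem deficit_tensor : deficit (tensor f) = ∑ k, profileDeficit (v k) (w k) := by
  rw [deficit, gammaMeasure_euclideanSpace, integral_congr_ae (fisher_tensor_ae_eq H hf),
    integral_congr_ae (entropy_tensor_ae_eq hf),
    integral_sum_tensor_update isContDensity_phi (fun k => (H k).memLp.integrable_sq)
      (fun k => (H k).normalized) fun k => (H k).integrable_fisher,
    integral_sum_tensor_update isContDensity_phi (fun k => (H k).memLp.integrable_sq)
      (fun k => (H k).normalized) fun k => (H k).entropy_integrable,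
    Finset.mul_sum, ← Finset.sum_sub_distrib]
  exact Finset.sum_congr rfl fun k _ => (H k).integral_fisher_sub_entropy

theorem memSobolev_sobolevNorm_tensor_density :
    MemSobolev 1 (gammaMeasure (EuclideanSpace ℝ (Fin n))) (fun x => tensor f x - 1) ∧
      sobolevNorm (gammaMeasure (EuclideanSpace ℝ (Fin n))) (fun x => tensor f x - 1) ≤
        ∑ k, ((∫ x, |v k x ^ 2 - 1| ∂gauss) + ∫ x, |2 * (w k x * v k x)| ∂gauss) := by
  have h1 : (fun x => tensor f x - 1) =ᵐ[volume] fun x => tensor (fun k x => v k x ^ 2) x - 1 :=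
    (tensor_congr_ae hf).mono fun x hx => by simp only [hx]
  have hac : tensorMeasure phi n ≪ volume := tensorMeasure_absolutelyContinuous
  rw [gammaMeasure_euclideanSpace, memSobolev_congr h1 hac, sobolevNorm_congr h1 hac]
  exact memSobolev_sobolevNorm_tensor_sub_one isContDensity_phi phi_pos
    (fun k => (H k).isWeakGradient_sq) (fun k => (H k).memLp.integrable_sq)
    (fun k => (H k).integrable_two_mul) fun k => (H k).integral_abs_sq

end Density

/-! ### The deficit of an amplitude -/

/-- A normalized element of `W^{1,2}(e^{-πx²}dx)` with its derivative, whose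
rescaling is a profile. -/
structure IsAmplitudeProfile (m : ℝ) (v w : ℝ → ℝ) : Prop where
  primitive : IsPrimitive v w
  memLp : MemLp v 2 (densityMeasure psi)
  memLp_deriv : MemLp w 2 (densityMeasure psi)
  normalized : ∫ x, v x ^ 2 ∂densityMeasure psi = 1
  isProfile : IsProfile m (fun x => v (x / √(2 * Real.pi)))
    fun x => w (x / √(2 * Real.pi)) / √(2 * Real.pi)

/-- The deficit of an amplitude in terms of its derivative. -/
noncomputable def amplitudeDeficit (v w : ℝ → ℝ) : ℝ :=
  (1 / Real.pi) * ((∫ x, w x ^ 2 ∂densityMeasure psi) -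
    Real.pi * ∫ x, v x ^ 2 * Real.log (v x ^ 2) ∂densityMeasure psi)

/-- The factor `2` of the Fisher term meets `1 / (2π)` from the rescaled derivative and becomes `1 /
π`. -/
theorem amplitudeDeficit_eq (v w : ℝ → ℝ) : amplitudeDeficit v w =
    profileDeficit (fun x => v (x / √(2 * Real.pi)))
      fun x => w (x / √(2 * Real.pi)) / √(2 * Real.pi) := by
  simp_rw [profileDeficit, div_pow]
  rw [integral_div, integral_gauss_comp_div fun x => w x ^ 2,
    integral_gauss_comp_div fun x => v x ^ 2 * Real.log (v x ^ 2), amplitudeDeficit,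
    Real.sq_sqrt (by positivity)]
  have := Real.pi_ne_zero
  field_simp

namespace IsAmplitudeProfile

variable {m : ℝ} {v w u : ℝ → ℝ} (H : IsAmplitudeProfile m v w)
include H

theorem entropy_integrable :
    Integrable (fun x => v x ^ 2 * Real.log (v x ^ 2)) (densityMeasure psi) := by
  have hc : Continuous fun x => v x ^ 2 * Real.log (v x ^ 2) :=
    Real.continuous_mul_log.comp (H.primitive.continuous.pow 2)
  exact (measurePreserving_div_gauss.integrable_comp hc.aestronglyMeasurable).1
    H.isProfile.entropy_integrable

/-- The `L¹` norm is at most the `L²` norm, which is one; this is the mean bound required for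
products. -/
theorem integral_abs_le_one : ∫ x, |v x| ∂densityMeasure psi ≤ 1 := by
  have h1 := integral_abs_mul_le H.memLp (memLp_const (1 : ℝ))
  simpa [H.normalized] using h1

-- The gradient term acquires `1 / √(2π)` under the rescaling, so the factor `√(2π)`, which exceeds
-- `1`, compensates it exactly and is harmless for the other term.
omit H in
theorem integral_abs_add_le : (∫ x, |v x - 1| ∂densityMeasure psi) +
    ∫ x, |w x| ∂densityMeasure psi ≤ √(2 * Real.pi) *
      ((∫ x, |v (x / √(2 * Real.pi)) - 1| ∂gauss) +
        ∫ x, |w (x / √(2 * Real.pi)) / √(2 * Real.pi)| ∂gauss) := by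
  have hs := sqrt_two_pi_pos
  have h1 : 1 ≤ √(2 * Real.pi) := Real.one_le_sqrt.2 (by linarith [Real.pi_gt_three])
  simp_rw [abs_div, abs_of_pos hs]
  rw [integral_div, integral_gauss_comp_div fun x => |v x - 1|,
    integral_gauss_comp_div fun x => |w x|, mul_add, mul_div_cancel₀ _ hs.ne']
  exact add_le_add_left (le_mul_of_one_le_left (integral_nonneg fun _ => abs_nonneg _) h1) _

theorem deficitStarWellDefined_deficitStar (hu : u =ᵐ[volume] v) :
    DeficitStarWellDefined u ∧ deficitStar u = amplitudeDeficit v w := by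
  have hac := densityMeasure_absolutelyContinuous psi
  have h1 : (fun x => |u x| ^ 2 * Real.log (|u x| ^ 2)) =ᵐ[densityMeasure psi]
      fun x => v x ^ 2 * Real.log (v x ^ 2) :=
    (hac.ae_eq hu).mono fun x hx => by simp only [hx, sq_abs]
  have hG := H.primitive.isWeakGradient.congr hu.symm
  have h2 : (fun x => ‖weakGrad u x‖ ^ 2) =ᵐ[densityMeasure psi] fun x => w x ^ 2 :=
    (hac.ae_eq (weakGrad_ae_eq hG)).mono fun x hx => by simp only [hx, Real.norm_eq_abs, sq_abs]
  refine ⟨⟨?_, ?_⟩, ?_⟩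
  · rw [piMeasure_real]
    exact memSobolev_of_isWeakGradient hG hac ((memLp_congr_ae (hac.ae_eq hu)).2 H.memLp)
      H.memLp_deriv
  · rw [piMeasure_real]
    exact H.entropy_integrable.congr h1.symm
  · rw [deficitStar, piMeasure_real, integral_congr_ae h1, integral_congr_ae h2, amplitudeDeficit]

theorem memSobolev_sobolevNorm_sub_one (hu : u =ᵐ[volume] v) :
    MemSobolev 1 (piMeasure ℝ) (fun x => u x - 1) ∧
      sobolevNorm (piMeasure ℝ) (fun x => u x - 1) =
        (∫ x, |v x - 1| ∂densityMeasure psi) + ∫ x, |w x| ∂densityMeasure psi := by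
  have h := (H.primitive.isWeakGradient.congr hu.symm).sub_const 1
  have hac := densityMeasure_absolutelyContinuous psi
  rw [piMeasure_real]
  have h1 : (fun x => u x - 1) =ᵐ[densityMeasure psi] fun x => v x - 1 :=
    (hac.ae_eq hu).mono fun x hx => by simp only [hx]
  have i1 : Integrable (fun x => v x - 1) (densityMeasure psi) :=
    (H.memLp.integrable one_le_two).sub (integrable_const _)
  refine ⟨memSobolev_of_isWeakGradient h hac (memLp_one_iff_integrable.2 (i1.congr h1.symm))
    (memLp_one_iff_integrable.2 (H.memLp_deriv.integrable one_le_two)), ?_⟩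
  rw [sobolevNorm_eq h hac]
  congr 1
  exact integral_congr_ae (h1.mono fun x hx => by simp only [hx])

end IsAmplitudeProfile

section Amplitude

variable {n : ℕ} {m : Fin n → ℝ} {v w u : Fin n → ℝ → ℝ}
  (H : ∀ k, IsAmplitudeProfile (m k) (v k) (w k)) (hu : ∀ k, u k =ᵐ[volume] v k)
include H hu

theorem deficitStarWellDefined_deficitStar_tensor : DeficitStarWellDefined (tensor u) ∧
    deficitStar (tensor u) = ∑ k, amplitudeDeficit (v k) (w k) := by
  have hac : tensorMeasure psi n ≪ volume := tensorMeasure_absolutelyContinuous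
  have hT := tensor_congr_ae hu
  have hG : IsWeakGradient (tensor u) (tensorGrad v w) :=
    (isWeakGradient_tensor isContDensity_psi psi_pos (fun k => (H k).primitive.isWeakGradient)
      (fun k => (H k).memLp.integrable one_le_two)
      fun k => (H k).memLp_deriv.integrable one_le_two).congr hT.symm
  have h1 : (fun x => |tensor u x| ^ 2 * Real.log (|tensor u x| ^ 2)) =ᵐ[tensorMeasure psi n]
      fun x => ∑ k, tensor (Function.update (fun j t => v j t ^ 2) k
        fun t => v k t ^ 2 * Real.log (v k t ^ 2)) x :=
    (hac.ae_eq hT).mono fun x hx => by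
      simp only [hx, sq_abs, sq_tensor]
      exact tensor_mul_log _ _
  have h2 : (fun x => ‖weakGrad (tensor u) x‖ ^ 2) =ᵐ[tensorMeasure psi n]
      fun x => ∑ k, tensor (Function.update (fun j t => v j t ^ 2) k fun t => w k t ^ 2) x :=
    (hac.ae_eq (weakGrad_ae_eq hG)).mono fun x hx => by simp only [hx, norm_tensorGrad_sq]
  have i1 := fun k => (H k).memLp.integrable_sq
  refine ⟨⟨?_, ?_⟩, ?_⟩
  · rw [piMeasure_euclideanSpace, memSobolev_congr hT hac]
    exact memSobolev_two_tensor isContDensity_psi psi_pos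
      (fun k => (H k).primitive.isWeakGradient) (fun k => (H k).memLp) fun k => (H k).memLp_deriv
  · rw [piMeasure_euclideanSpace]
    exact (integrable_sum_tensor_update isContDensity_psi i1
      fun k => (H k).entropy_integrable).congr h1.symm
  · rw [deficitStar, piMeasure_euclideanSpace, integral_congr_ae h1, integral_congr_ae h2,
      integral_sum_tensor_update isContDensity_psi i1 (fun k => (H k).normalized)
        fun k => (H k).entropy_integrable,
      integral_sum_tensor_update isContDensity_psi i1 (fun k => (H k).normalized)
        fun k => (H k).memLp_deriv.integrable_sq,
      Finset.mul_sum, ← Finset.sum_sub_distrib, Finset.mul_sum]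
    rfl

theorem memSobolev_sobolevNorm_tensor_amplitude :
    MemSobolev 1 (piMeasure (EuclideanSpace ℝ (Fin n))) (fun x => tensor u x - 1) ∧
      sobolevNorm (piMeasure (EuclideanSpace ℝ (Fin n))) (fun x => tensor u x - 1) ≤
        ∑ k, ((∫ x, |v k x - 1| ∂densityMeasure psi) + ∫ x, |w k x| ∂densityMeasure psi) := by
  have h1 : (fun x => tensor u x - 1) =ᵐ[volume] fun x => tensor v x - 1 :=
    (tensor_congr_ae hu).mono fun x hx => by simp only [hx]
  have hac : tensorMeasure psi n ≪ volume := tensorMeasure_absolutelyContinuous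
  rw [piMeasure_euclideanSpace, memSobolev_congr h1 hac, sobolevNorm_congr h1 hac]
  exact memSobolev_sobolevNorm_tensor_sub_one isContDensity_psi psi_pos
    (fun k => (H k).primitive.isWeakGradient) (fun k => (H k).memLp.integrable one_le_two)
    (fun k => (H k).memLp_deriv.integrable one_le_two) fun k => (H k).integral_abs_le_one

end Amplitude

theorem IsAmplitude.exists_isAmplitudeProfile {α : ℝ} {u : ℝ → ℝ} (hu : IsAmplitude α u) :
    ∃ m ≤ 2 * Real.pi * α, ∃ v w, IsAmplitudeProfile m v w ∧ u =ᵐ[volume] v := by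
  obtain ⟨v, w, h1, -, h3, h4, h5, h6, m, hm, h7⟩ := hu.exists_isPrimitive
  exact ⟨m, hm, v, w, ⟨h1, h4, h5, h6, h7⟩, h3⟩

theorem exists_amplitude_bound (α : ℝ) : ∃ b : ℝ, 0 < b ∧ ∀ (m : ℝ) (v w : ℝ → ℝ),
    m ≤ 2 * Real.pi * α → IsAmplitudeProfile m v w → 0 ≤ amplitudeDeficit v w ∧
      (∫ x, |v x - 1| ∂densityMeasure psi) + ∫ x, |w x| ∂densityMeasure psi ≤
        b * (amplitudeDeficit v w ^ (1 / 4 : ℝ) + amplitudeDeficit v w) := by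
  obtain ⟨a, ha, h⟩ := exists_profile_bound (2 * Real.pi * α)
  refine ⟨√(2 * Real.pi) * a, mul_pos sqrt_two_pi_pos ha, fun m v w hm H => ?_⟩
  rw [amplitudeDeficit_eq]
  refine ⟨H.isProfile.deficit_nonneg, (IsAmplitudeProfile.integral_abs_add_le).trans ?_⟩
  rw [mul_assoc]
  exact mul_le_mul_of_nonneg_left (h m _ _ hm H.isProfile).2 sqrt_two_pi_pos.le

end LSI

/-! ### Conclusion: the line and products -/

theorem corollary1p2 (α : ℝ) :
    -- Part (1): one constant `a`, depending only on `α`, serves for all densities on the line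
    -- and for products of such densities in every dimension.
    (∃ a : ℝ, 0 < a ∧
      (∀ f : ℝ → ℝ, LSI.IsDensity α f →
        LSI.DeficitWellDefined f ∧
        LSI.MemSobolev 1 (LSI.gammaMeasure ℝ) (fun x => f x - 1) ∧
        LSI.sobolevNorm (LSI.gammaMeasure ℝ) (fun x => f x - 1) ≤
          a * (LSI.deficit f ^ (1 / 4 : ℝ) + LSI.deficit f ^ (3 / 4 : ℝ))) ∧
      (∀ (n : ℕ) (f : Fin n → ℝ → ℝ), (∀ k, LSI.IsDensity α (f k)) →
        LSI.DeficitWellDefined (LSI.tensor f) ∧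
        LSI.MemSobolev 1 (LSI.gammaMeasure (EuclideanSpace ℝ (Fin n)))
          (fun x => LSI.tensor f x - 1) ∧
        LSI.sobolevNorm (LSI.gammaMeasure (EuclideanSpace ℝ (Fin n)))
            (fun x => LSI.tensor f x - 1) ≤
          a * (n : ℝ) ^ (3 / 4 : ℝ) *
            (LSI.deficit (LSI.tensor f) ^ (1 / 4 : ℝ) +
              LSI.deficit (LSI.tensor f) ^ (3 / 4 : ℝ)))) ∧
    -- Part (2): the same for `u`, with a constant `b` depending only on `α`.
    (∃ b : ℝ, 0 < b ∧
      (∀ u : ℝ → ℝ, LSI.IsAmplitude α u →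
        LSI.DeficitStarWellDefined u ∧
        LSI.MemSobolev 1 (LSI.piMeasure ℝ) (fun x => u x - 1) ∧
        LSI.sobolevNorm (LSI.piMeasure ℝ) (fun x => u x - 1) ≤
          b * (LSI.deficitStar u ^ (1 / 4 : ℝ) + LSI.deficitStar u)) ∧
      (∀ (n : ℕ) (u : Fin n → ℝ → ℝ), (∀ k, LSI.IsAmplitude α (u k)) →
        LSI.DeficitStarWellDefined (LSI.tensor u) ∧
        LSI.MemSobolev 1 (LSI.piMeasure (EuclideanSpace ℝ (Fin n)))
          (fun x => LSI.tensor u x - 1) ∧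
        LSI.sobolevNorm (LSI.piMeasure (EuclideanSpace ℝ (Fin n)))
            (fun x => LSI.tensor u x - 1) ≤
          (n : ℝ) * b *
            (LSI.deficitStar (LSI.tensor u) ^ (1 / 4 : ℝ) + LSI.deficitStar (LSI.tensor u)))) := by
  constructor
  · obtain ⟨a, ha, hb⟩ := LSI.exists_profile_bound α
    refine ⟨a, ha, fun f hf => ?_, fun n f hf => ?_⟩
    · obtain ⟨m, hm, v, w, H, hfv⟩ := hf.exists_isProfile
      obtain ⟨h1, h2⟩ := H.memSobolev_sobolevNorm_sub_one hfv
      refine ⟨H.deficitWellDefined hfv, h1, ?_⟩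
      rw [h2, H.deficit_eq hfv]
      exact (hb m v w hm H).1
    · choose m hm v w H hfv using fun k => (hf k).exists_isProfile
      obtain ⟨h1, h2⟩ := LSI.memSobolev_sobolevNorm_tensor_density H hfv
      refine ⟨LSI.deficitWellDefined_tensor H hfv, h1, h2.trans ?_⟩
      rw [LSI.deficit_tensor H hfv]
      have h0 : ∀ k, 0 ≤ LSI.profileDeficit (v k) (w k) := fun k => (H k).deficit_nonneg
      refine (Finset.sum_le_sum fun k _ => (hb _ _ _ (hm k) (H k)).1).trans ?_
      rw [← Finset.mul_sum, Finset.sum_add_distrib, mul_assoc]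
      refine mul_le_mul_of_nonneg_left ?_ ha.le
      rw [mul_add]
      -- The exponent `1 / 4` gives `n ^ (3/4)`, while `3 / 4` gives `n ^ (1/4)`. The latter is
      -- smaller for `n ≥ 1`, and for `n = 0` both powers are zero.
      refine add_le_add ((LSI.sum_rpow_le h0 (by norm_num) (by norm_num)).trans_eq (by norm_num))
        ((LSI.sum_rpow_le h0 (by norm_num) (by norm_num)).trans ?_)
      refine mul_le_mul_of_nonneg_right ?_
        (Real.rpow_nonneg (Finset.sum_nonneg fun k _ => h0 k) _)
      obtain rfl | hn := Nat.eq_zero_or_pos n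
      · norm_num
      · exact Real.rpow_le_rpow_of_exponent_le (by exact_mod_cast hn) (by norm_num)
  · obtain ⟨b, hb0, hb⟩ := LSI.exists_amplitude_bound α
    refine ⟨b, hb0, fun u hu => ?_, fun n u hu => ?_⟩
    · obtain ⟨m, hm, v, w, H, huv⟩ := hu.exists_isAmplitudeProfile
      obtain ⟨h1, h2⟩ := H.memSobolev_sobolevNorm_sub_one huv
      obtain ⟨h3, h4⟩ := H.deficitStarWellDefined_deficitStar huv
      refine ⟨h3, h1, ?_⟩
      rw [h2, h4]
      exact (hb m v w hm H).2
    · choose m hm v w H huv using fun k => (hu k).exists_isAmplitudeProfile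
      obtain ⟨h1, h2⟩ := LSI.memSobolev_sobolevNorm_tensor_amplitude H huv
      obtain ⟨h3, h4⟩ := LSI.deficitStarWellDefined_deficitStar_tensor H huv
      refine ⟨h3, h1, h2.trans ?_⟩
      rw [h4]
      have h0 : ∀ k, 0 ≤ LSI.amplitudeDeficit (v k) (w k) := fun k => (hb _ _ _ (hm k) (H k)).1
      -- As every deficit is nonnegative by the log-Sobolev inequality, each one is at most their
      -- sum, and `n` equal bounds are added.
      have hle : ∀ k, LSI.amplitudeDeficit (v k) (w k) ≤
          ∑ j, LSI.amplitudeDeficit (v j) (w j) := fun k =>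
        Finset.single_le_sum (fun j _ => h0 j) (Finset.mem_univ k)
      refine (Finset.sum_le_sum fun k _ => (hb _ _ _ (hm k) (H k)).2.trans
        (mul_le_mul_of_nonneg_left (add_le_add
          (Real.rpow_le_rpow (h0 k) (hle k) (by norm_num)) (hle k)) hb0.le)).trans_eq ?_
      rw [Finset.sum_const, Finset.card_univ, Fintype.card_fin, nsmul_eq_mul, mul_assoc]
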